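/- **Conventions.** All categories have objects in one fixed universe and Hom-sets in another; "small" means small with respect to the universe of Hom-sets. A $(2,1)$-category is a (weak) 2-category all of whose 2-morphisms are invertible. A functor from a category to a 2-category is a pseudo-functor. *Model categories.* A pre-model category is a category $\mathcal M$ with three subcategories $\mathcal W_{\mathcal M},\mathcal Cof_{\mathcal M},\mathcal Fib_{\mathcal M}$ containing all objects; trivial (co)fibrations are the (co)fibrations in $\mathcal W_{\mathcal M}$. A model category is a complete and cocomplete category with classes $\mathcal W,\mathcal Cof,\mathcal Fib$ such that $\mathcal W$ has the two-out-of-three property, the three classes contain all isomorphisms and are closed under retracts, cofibrations (resp. trivial cofibrations) have the left lifting property against trivial fibrations (resp. fibrations), and every map factors as a cofibration followed by a trivial fibration and as a trivial cofibration followed by a fibration. This is read in one of two ways, fixed throughout: (plain) factorizations are only required to exist; (functorial) the two factorizations are required to be functorial. An adjunction is Quillen if its left adjoint preserves cofibrations and trivial cofibrations and its right adjoint preserves fibrations and trivial fibrations. A Quillen adjunction $F\dashv U$ of model categories is a Quillen equivalence if for $X$ cofibrant and any trivial cofibration $F(X)\to Y$ with $Y$ fibrant, the map $X\to U(F(X))\to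 U(Y)$ is a weak equivalence, and for $Y$ fibrant and any trivial fibration $X\to U(Y)$ with $X$ cofibrant, the map $F(X)\to F(U(Y))\to Y$ is a weak equivalence. $\mathrm{ModCat}$ is the $(2,1)$-category of model categories, Quillen adjunctions (in the direction of the left adjoint), and isomorphisms of adjunctions (pairs of mate natural isomorphisms). *Proper relative functors.* Let $\mathcal M$ be a pre-model category and $\mathcal F:\mathcal M\to\mathrm{ModCat}$ a functor; write $f_!\dashv f^*$ for the image of $f:A\to B$. $\mathcal F$ is relative if $f_!\dashv f^*$ is a Quillen equivalence for every $f\in\mathcal W_{\mathcal M}$; it is proper if $f_!$ preserves weak equivalences for every trivial cofibration $f$ and $f^*$ preserves weak equivalences for every trivial fibration $f$. $\mathrm{Fun}_{PR}(\mathcal M,\mathrm{ModCat})$ is the full sub-2-category, on the proper relative functors, of the 2-category of pseudo-functors, pseudo-natural transformations and modifications; it is a $(2,1)$-category. *Grothendieck construction.* $\int_{\mathcal M}\mathcal F$ has objects $(A,X)$ with $X\in\mathcal F(A)$ and morphisms $(f,\varphi):(A,X)\to(B,Y)$ with $f:A\to B$ and $\varphi:f_!X\to Y$. Such a morphism is a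 cofibration if $f$ and $\varphi$ are cofibrations; a fibration if $f$ and the adjoint $\varphi^{ad}:X\to f^*Y$ are fibrations; and a weak equivalence if $f\in\mathcal W_{\mathcal M}$ and $f_!(Q)\to f_!(X)\to Y$ is a weak equivalence for every trivial fibration $Q\to X$ with $Q$ cofibrant. A pseudo-natural transformation $\alpha:\mathcal F\Rightarrow\mathcal G$, with components $\alpha_A\dashv\alpha_A^*$, induces an adjunction over $\mathcal M$ given on objects by $(A,X)\mapsto(A,\alpha_A X)$ and $(A,Y)\mapsto(A,\alpha_A^*Y)$; a modification induces an isomorphism of such adjunctions, given by its components in the fibres. *Relative model categories.* Let $\pi:\mathcal N\to\mathcal M$ be a functor. It is bicomplete if for every small $I$, every $\delta:I\to\mathcal N$ and every extension of $\pi\delta$ to a cocone (resp. cone), there is an initial (resp. terminal) lift of it to a cocone (resp. cone) on $\delta$; morphisms of lifts are those lying over the identity of the vertex. Given classes $L',R'$ of maps in $\mathcal M$ and $L,R$ in $\mathcal N$, $(L,R)$ is a $\pi$-weak factorization system relative to $(L',R')$ if $\pi(L)\subseteq L'$, $\pi(R)\subseteq R'$, and: (i) a retract $f$ of a map in $L$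 (resp. $R$) is in $L$ (resp. $R$) provided $\pi(f)\in L'$ (resp. $R'$); (ii) for every $\varphi$ in $\mathcal N$ and every factorization $\pi\varphi=g\circ h$ with $h\in L'$, $g\in R'$ there is $\varphi=\psi\circ\eta$ with $\eta\in L$, $\psi\in R$, $\pi\eta=h$, $\pi\psi=g$; (iii) for every commutative square from $\psi\in L$ to $\eta\in R$, every diagonal lift $u$ of its image in $\mathcal M$ is $\pi\gamma$ for a diagonal lift $\gamma$. For pre-model categories $\mathcal M,\mathcal N$, $\pi$ is a relative model category if it is bicomplete; whenever two of $f,g,gf$ are in $\mathcal W_{\mathcal N}$ and the image of the third is in $\mathcal W_{\mathcal M}$, the third is in $\mathcal W_{\mathcal N}$; and $(\mathcal Cof_{\mathcal N}\cap\mathcal W_{\mathcal N},\mathcal Fib_{\mathcal N})$ and $(\mathcal Cof_{\mathcal N},\mathcal Fib_{\mathcal N}\cap\mathcal W_{\mathcal N})$ are $\pi$-weak factorization systems relative to $(\mathcal Cof_{\mathcal M}\cap\mathcal W_{\mathcal M},\mathcal Fib_{\mathcal M})$ and $(\mathcal Cof_{\mathcal M},\mathcal Fib_{\mathcal M}\cap\mathcal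 W_{\mathcal M})$. In the functorial reading the two factorizations in every fibre $\pi^{-1}(A)$ are moreover required to be functorial. *Model fibrations.* A morphism $\phi:x\to y$ of $\mathcal N$ is $\pi$-Cartesian if for all $\psi:u\to y$ and $g:\pi(u)\to\pi(x)$ with $\pi(\psi)=\pi(\phi)g$ there is a unique $\gamma:u\to x$ with $\pi(\gamma)=g$ and $\phi\gamma=\psi$; coCartesian is dual. $\pi$ is a biCartesian fibration if every $A\to\pi(y)$ has a Cartesian lift with target $y$ and every $\pi(x)\to B$ has a coCartesian lift with source $x$. An object is $\pi$-cofibrant ($\pi$-fibrant) if the map from the initial (to the terminal) object of its fibre is a cofibration (fibration) of $\mathcal N$. A relative model category $\pi$ is a model fibration if it is a biCartesian fibration, coCartesian morphisms with $\pi$-cofibrant source lying over weak equivalences are weak equivalences, and Cartesian morphisms with $\pi$-fibrant target lying over weak equivalences are weak equivalences. $\mathrm{ModFib}(\mathcal M)$ is the $(2,1)$-category of model fibrations over $\mathcal M$, with morphisms the Quillen adjunctions $\Phi\dashv\Psi$ over $\mathcal M$ (both functors commute with the projections, and unit and counit lie over identities) such that $\Phi$ preserves coCartesian and $\Psi$ preserves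 Cartesian morphisms, and with 2-morphisms the isomorphisms of adjunctions lying over identities. **Theorem.** Let $\mathcal M$ be a pre-model category. In either reading of the factorization axiom, for every proper relative functor $\mathcal F:\mathcal M\to\mathrm{ModCat}$ the projection $\int_{\mathcal M}\mathcal F\to\mathcal M$ is a model fibration, every pseudo-natural transformation of proper relative functors induces a morphism of model fibrations, and the resulting functor of $(2,1)$-categories $$\int_{\mathcal M}:\mathrm{Fun}_{PR}(\mathcal M,\mathrm{ModCat})\longrightarrow\mathrm{ModFib}(\mathcal M)$$ is an equivalence of $(2,1)$-categories: every model fibration over $\mathcal M$ is equivalent in $\mathrm{ModFib}(\mathcal M)$ to some $\int_{\mathcal M}\mathcal F$, and for all $\mathcal F,\mathcal G$ the induced functor from the category of pseudo-natural transformations $\mathcal F\Rightarrow\mathcal G$ and modifications to the category of morphisms $\int_{\mathcal M}\mathcal F\to\int_{\mathcal M}\mathcal G$ and 2-morphisms is an equivalence of categories. -/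

import Mathlib

open CategoryTheory Bicategory
open scoped Pseudofunctor.StrongTrans

namespace ModelGrothendieck

section SubTwoOne
universe w₁ v₁ u₁ u₂

/-- A class of 1-cells between the objects `ob X` of a bicategory `B` (indexed by `X : C`), which
contains the identities and is closed under composition. -/
structure CellClass {B : Type u₁} [Bicategory.{w₁, v₁} B] {C : Type u₂} (ob : C → B) where
  mem : ∀ ⦃X Y : C⦄, (ob X ⟶ ob Y) → Prop
  id_mem : ∀ X : C, mem (𝟙 (ob X))
  comp_mem : ∀ ⦃X Y Z : C⦄ (f : ob X ⟶ ob Y) (g : ob Y ⟶ ob Z), mem f → mem g → mem (f ≫ g)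

variable {B : Type u₁} [Bicategory.{w₁, v₁} B] {C : Type u₂} {ob : C → B}

/-- The (2,1)-category with objects `X : C`, with 1-cells `X ⟶ Y` the 1-cells `ob X ⟶ ob Y` of `B`
belonging to the class `P`, and with 2-cells all the invertible 2-cells of `B` between those. -/
def SubTwoOne (_P : CellClass ob) : Type u₂ := C

namespace SubTwoOne

variable {P : CellClass ob}

/-- 1-cells of `SubTwoOne P`. -/
structure Hom (X Y : SubTwoOne P) where
  cell : ob X ⟶ ob Y
  mem : P.mem cell

instance : CategoryStruct (SubTwoOne P) where
  Hom X Y := Hom X Y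
  id X := ⟨𝟙 (ob X), P.id_mem X⟩
  comp f g := ⟨f.cell ≫ g.cell, P.comp_mem _ _ f.mem g.mem⟩

@[simp] lemma id_cell (X : SubTwoOne P) : Hom.cell (𝟙 X) = 𝟙 (ob X) := rfl
@[simp] lemma comp_cell {X Y Z : SubTwoOne P} (f : X ⟶ Y) (g : Y ⟶ Z) :
    Hom.cell (f ≫ g) = Hom.cell f ≫ Hom.cell g := rfl

/-- 2-cells of `SubTwoOne P`: invertible 2-cells of `B`. -/
@[ext]
structure Hom₂ {X Y : SubTwoOne P} (f g : X ⟶ Y) where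
  iso : f.cell ≅ g.cell

instance (X Y : SubTwoOne P) : Category (X ⟶ Y) where
  Hom f g := Hom₂ f g
  id f := ⟨Iso.refl _⟩
  comp a b := ⟨a.iso ≪≫ b.iso⟩

variable {X Y Z : SubTwoOne P}

@[ext] lemma hom₂_ext {f g : X ⟶ Y} {a b : f ⟶ g} (h : a.iso.hom = b.iso.hom) : a = b :=
  Hom₂.ext (Iso.ext h)

@[simp] lemma id_iso (f : X ⟶ Y) : Hom₂.iso (𝟙 f) = Iso.refl _ := rfl
@[simp] lemma comp_iso {f g h : X ⟶ Y} (a : f ⟶ g) (b : g ⟶ h) :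
    Hom₂.iso (a ≫ b) = a.iso ≪≫ b.iso := rfl

/-- An invertible 2-cell of `B` as an invertible 2-cell of `SubTwoOne P`. -/
@[simps] def isoMk {f g : X ⟶ Y} (e : f.cell ≅ g.cell) : f ≅ g where
  hom := ⟨e⟩
  inv := ⟨e.symm⟩
  hom_inv_id := by ext; simp
  inv_hom_id := by ext; simp

/-- Left whiskering in `SubTwoOne P`. -/
def whiskerL (f : X ⟶ Y) {g h : Y ⟶ Z} (a : g ⟶ h) : f ≫ g ⟶ f ≫ h :=
  Hom₂.mk (whiskerLeftIso f.cell a.iso)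

/-- Right whiskering in `SubTwoOne P`. -/
def whiskerR {f g : X ⟶ Y} (a : f ⟶ g) (h : Y ⟶ Z) : f ≫ h ⟶ g ≫ h :=
  Hom₂.mk (whiskerRightIso a.iso h.cell)

@[simp] lemma whiskerL_iso (f : X ⟶ Y) {g h : Y ⟶ Z} (a : g ⟶ h) :
    Hom₂.iso (whiskerL f a) = whiskerLeftIso f.cell a.iso := rfl
@[simp] lemma whiskerR_iso {f g : X ⟶ Y} (a : f ⟶ g) (h : Y ⟶ Z) :
    Hom₂.iso (whiskerR a h) = whiskerRightIso a.iso h.cell := rfl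

/-- The associator of `SubTwoOne P`. -/
@[simps!] def assoc' {W : SubTwoOne P} (f : W ⟶ X) (g : X ⟶ Y) (h : Y ⟶ Z) :
    (f ≫ g) ≫ h ≅ f ≫ g ≫ h :=
  isoMk (α_ f.cell g.cell h.cell)

/-- The left unitor of `SubTwoOne P`. -/
@[simps!] def leftUnitor' (f : X ⟶ Y) : 𝟙 X ≫ f ≅ f := isoMk (λ_ f.cell)

/-- The right unitor of `SubTwoOne P`. -/
@[simps!] def rightUnitor' (f : X ⟶ Y) : f ≫ 𝟙 Y ≅ f := isoMk (ρ_ f.cell)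

instance : Bicategory (SubTwoOne P) where
  whiskerLeft f _ _ a := whiskerL f a
  whiskerRight a h := whiskerR a h
  associator f g h := assoc' f g h
  leftUnitor f := leftUnitor' f
  rightUnitor f := rightUnitor' f
  whisker_exchange a b := by ext; simp [whisker_exchange]

@[simp] lemma associator_eq {W : SubTwoOne P} (f : W ⟶ X) (g : X ⟶ Y) (h : Y ⟶ Z) :
    α_ f g h = isoMk (α_ f.cell g.cell h.cell) := rfl
@[simp] lemma leftUnitor_eq (f : X ⟶ Y) : λ_ f = isoMk (λ_ f.cell) := rfl
@[simp] lemma rightUnitor_eq (f : X ⟶ Y) : ρ_ f = isoMk (ρ_ f.cell) := rfl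
@[simp] lemma whiskerLeft_iso (f : X ⟶ Y) {g h : Y ⟶ Z} (a : g ⟶ h) :
    Hom₂.iso (f ◁ a) = whiskerLeftIso f.cell a.iso := rfl
@[simp] lemma whiskerRight_iso {f g : X ⟶ Y} (a : f ⟶ g) (h : Y ⟶ Z) :
    Hom₂.iso (a ▷ h) = whiskerRightIso a.iso h.cell := rfl

end SubTwoOne
end SubTwoOne

section Classes
universe v u u'

/-- Three distinguished classes of morphisms: weak equivalences, cofibrations, fibrations. -/
structure MapClasses (C : Type u) [Category.{v} C] where
  W : MorphismProperty C
  cof : MorphismProperty C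
  fib : MorphismProperty C

namespace MapClasses
variable {C : Type u} [Category.{v} C] (S : MapClasses C)

/-- Trivial cofibrations. -/
def trivCof : MorphismProperty C := S.cof ⊓ S.W

/-- Trivial fibrations. -/
def trivFib : MorphismProperty C := S.fib ⊓ S.W

/-- A pre-model category: the three classes are subcategories containing all objects. -/
structure IsPreModel : Prop where
  W : S.W.IsMultiplicative
  cof : S.cof.IsMultiplicative
  fib : S.fib.IsMultiplicative

/-- The restriction of the three classes along a functor. -/
def pullback {D : Type u'} [Category.{v} D] (G : D ⥤ C) : MapClasses D where
  W := S.W.inverseImage G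
  cof := S.cof.inverseImage G
  fib := S.fib.inverseImage G

/-- The map from any initial object is a cofibration. -/
def IsCofibrant (X : C) : Prop := ∀ ⦃I : C⦄ (h : Limits.IsInitial I), S.cof (h.to X)

/-- The map to any terminal object is a fibration. -/
def IsFibrant (X : C) : Prop := ∀ ⦃T : C⦄ (h : Limits.IsTerminal T), S.fib (h.from X)

end MapClasses

/-- The two readings of the factorization axiom: factorizations are merely required to exist,
or they are required to be functorial. -/
inductive FactorizationKind
  | plain
  | functorial

/-- The factorization axiom for a pair of classes of maps, in either reading. -/
def FactorizationKind.HasFactorization (k : FactorizationKind) {C : Type u} [Category.{v} C]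
    (L R : MorphismProperty C) : Prop :=
  match k with
  | plain => L.HasFactorization R
  | functorial => L.HasFunctorialFactorization R

/-- The axioms of a model category. -/
structure IsModelCategory (k : FactorizationKind) {C : Type u} [Category.{v} C]
    (S : MapClasses C) : Prop where
  hasLimits : Limits.HasLimits C
  hasColimits : Limits.HasColimits C
  two_out_of_three : S.W.HasTwoOutOfThreeProperty
  iso_W : MorphismProperty.isomorphisms C ≤ S.W
  iso_cof : MorphismProperty.isomorphisms C ≤ S.cof
  iso_fib : MorphismProperty.isomorphisms C ≤ S.fib
  retract_W : S.W.IsStableUnderRetracts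
  retract_cof : S.cof.IsStableUnderRetracts
  retract_fib : S.fib.IsStableUnderRetracts
  lift_trivFib : ∀ ⦃A B X Y : C⦄ (i : A ⟶ B) (p : X ⟶ Y), S.cof i → S.trivFib p →
    HasLiftingProperty i p
  lift_trivCof : ∀ ⦃A B X Y : C⦄ (i : A ⟶ B) (p : X ⟶ Y), S.trivCof i → S.fib p →
    HasLiftingProperty i p
  factor_trivFib : k.HasFactorization S.cof S.trivFib
  factor_trivCof : k.HasFactorization S.trivCof S.fib

/-- The condition for a pair of adjoint functors `F ⊣ G` to be a Quillen adjunction. -/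
structure IsQuillenPair {C : Type u} [Category.{v} C] {D : Type u'} [Category.{v} D]
    (S : MapClasses C) (T : MapClasses D) (F : C ⥤ D) (G : D ⥤ C) : Prop where
  cof : S.cof ≤ T.cof.inverseImage F
  trivCof : S.trivCof ≤ T.trivCof.inverseImage F
  fib : T.fib ≤ S.fib.inverseImage G
  trivFib : T.trivFib ≤ S.trivFib.inverseImage G

lemma IsQuillenPair.id {C : Type u} [Category.{v} C] (S : MapClasses C) :
    IsQuillenPair S S (𝟭 C) (𝟭 C) := ⟨fun _ _ _ h => h, fun _ _ _ h => h, fun _ _ _ h => h,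
      fun _ _ _ h => h⟩

lemma IsQuillenPair.comp {C : Type u} [Category.{v} C] {D : Type u} [Category.{v} D]
    {E : Type u} [Category.{v} E] {S : MapClasses C} {T : MapClasses D} {U : MapClasses E}
    {F : C ⥤ D} {G : D ⥤ C} {F' : D ⥤ E} {G' : E ⥤ D} (h : IsQuillenPair S T F G)
    (h' : IsQuillenPair T U F' G') : IsQuillenPair S U (F ⋙ F') (G' ⋙ G) :=
  ⟨fun _ _ _ a => h'.cof _ (h.cof _ a), fun _ _ _ a => h'.trivCof _ (h.trivCof _ a),
    fun _ _ _ a => h.fib _ (h'.fib _ a), fun _ _ _ a => h.trivFib _ (h'.trivFib _ a)⟩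

/-- Quillen equivalences, among the Quillen adjunctions `F ⊣ G` of model categories: the composites
`X ⟶ G (F X) ⟶ G Y` (with `X` cofibrant and `F X ⟶ Y` a fibrant replacement) and
`F X ⟶ F (G Y) ⟶ Y` (with `Y` fibrant and `X ⟶ G Y` a cofibrant replacement) are weak
equivalences. -/
structure IsQuillenEquivalence {C : Type u} [Category.{v} C] {D : Type u'} [Category.{v} D]
    (S : MapClasses C) (T : MapClasses D) {F : C ⥤ D} {G : D ⥤ C} (adj : F ⊣ G) : Prop where
  unit : ∀ ⦃X : C⦄ ⦃Y : D⦄ (j : F.obj X ⟶ Y), S.IsCofibrant X → T.IsFibrant Y → T.trivCof j →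
    S.W (adj.unit.app X ≫ G.map j)
  counit : ∀ ⦃Y : D⦄ ⦃X : C⦄ (q : X ⟶ G.obj Y), T.IsFibrant Y → S.IsCofibrant X →
    S.trivFib q → T.W (F.map q ≫ adj.counit.app Y)

end Classes

section ModCat
universe v u

set_option linter.checkUnivs false in
/-- A model category, bundled. -/
structure ModelCat (k : FactorizationKind) where
  cat : Cat.{v, u}
  classes : MapClasses cat
  isModel : IsModelCategory k classes

variable {k : FactorizationKind}

/-- The adjunctions between the underlying categories of two model categories which are Quillen. -/
def quillenCells (k : FactorizationKind) :
    CellClass (fun X : ModelCat.{v, u} k => Adj.mk X.cat) where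
  mem X Y f := IsQuillenPair X.classes Y.classes f.l.toFunctor f.r.toFunctor
  id_mem X := IsQuillenPair.id X.classes
  comp_mem _ _ _ _ _ hf hg := hf.comp hg

set_option linter.checkUnivs false in
/-- The (2,1)-category of model categories, Quillen adjunctions and pseudo-transformations of
adjunctions. -/
abbrev ModCat (k : FactorizationKind) := SubTwoOne (quillenCells.{v, u} k)

namespace ModCat

/-- The underlying category. -/
abbrev cat (X : ModCat.{v, u} k) : Cat.{v, u} := ModelCat.cat X
/-- The three classes of maps. -/
abbrev classes (X : ModCat.{v, u} k) : MapClasses X.cat := ModelCat.classes X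

variable {X Y Z : ModCat.{v, u} k}

/-- The left Quillen functor of a 1-cell. -/
abbrev left (f : X ⟶ Y) : X.cat ⥤ Y.cat := (SubTwoOne.Hom.cell f).l.toFunctor
/-- The right Quillen functor of a 1-cell. -/
abbrev right (f : X ⟶ Y) : Y.cat ⥤ X.cat := (SubTwoOne.Hom.cell f).r.toFunctor
/-- The Quillen adjunction of a 1-cell. -/
abbrev adj (f : X ⟶ Y) : left f ⊣ right f := Adjunction.ofCat (SubTwoOne.Hom.cell f).adj

end ModCat

/-- A functor (that is, a pseudofunctor) from a category to the (2,1)-category of model categories. -/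
abbrev Diagram (M : Type u) [Category.{v} M] (k : FactorizationKind) :=
  LocallyDiscrete M ⥤ᵖ ModCat.{v, u} k

variable {M : Type u} [Category.{v} M] (S : MapClasses M)

namespace Diagram

/-- The model category `F(A)`. -/
abbrev at' (F : Diagram M k) (A : M) : ModCat.{v, u} k := F.obj ⟨A⟩

/-- The left Quillen functor `f_!`. -/
abbrev push (F : Diagram M k) {A B : M} (f : A ⟶ B) : (F.at' A).cat ⥤ (F.at' B).cat :=
  ModCat.left (F.map f.toLoc)

/-- The right Quillen functor `f^*`. -/
abbrev pull (F : Diagram M k) {A B : M} (f : A ⟶ B) : (F.at' B).cat ⥤ (F.at' A).cat :=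
  ModCat.right (F.map f.toLoc)

/-- The adjunction `f_! ⊣ f^*`. -/
abbrev adj (F : Diagram M k) {A B : M} (f : A ⟶ B) : F.push f ⊣ F.pull f :=
  ModCat.adj (F.map f.toLoc)

/-- Relative functors send weak equivalences to Quillen equivalences. -/
def IsRelative (F : Diagram M k) : Prop :=
  ∀ ⦃A B : M⦄ (f : A ⟶ B), S.W f →
    IsQuillenEquivalence (F.at' A).classes (F.at' B).classes (F.adj f)

/-- Left and right properness. -/
structure IsProper (F : Diagram M k) : Prop where
  left : ∀ ⦃A B : M⦄ (f : A ⟶ B), S.trivCof f →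
    (F.at' A).classes.W ≤ (F.at' B).classes.W.inverseImage (F.push f)
  right : ∀ ⦃A B : M⦄ (f : A ⟶ B), S.trivFib f →
    (F.at' B).classes.W ≤ (F.at' A).classes.W.inverseImage (F.pull f)

end Diagram


/-- The (2,1)-category of proper relative functors from `M` to model categories: the full
sub-2-category of the 2-category of pseudofunctors, pseudonatural transformations and
modifications. -/
abbrev FunPR (k : FactorizationKind) :=
  InducedBicategory (Diagram M k)
    (Subtype.val : {F : Diagram M k // F.IsRelative S ∧ F.IsProper S} → Diagram M k)

end ModCat

section ModFib
universe v₁ u₁ v u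

variable {M : Type u₁} [Category.{v₁} M]  {N : Type u} [Category.{v} N]

/-- Given a cone `t` over `π ∘ δ`, i.e. an extension of `π ∘ δ` to `J^◁`, a lift of it to a
cone over `δ`. -/
structure IsConeLift (π : N ⥤ M) {J : Type v} [Category.{v} J] {δ : J ⥤ N}
    (t : Limits.Cone (δ ⋙ π)) (s : Limits.Cone δ) : Prop where
  pt : π.obj s.pt = t.pt
  leg : ∀ j, π.IsHomLift (t.π.app j) (s.π.app j)

/-- Given a cocone `t` under `π ∘ δ`, i.e. an extension of `π ∘ δ` to `J^▷`, a lift of it to a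
cocone under `δ`. -/
structure IsCoconeLift (π : N ⥤ M) {J : Type v} [Category.{v} J] {δ : J ⥤ N}
    (t : Limits.Cocone (δ ⋙ π)) (s : Limits.Cocone δ) : Prop where
  pt : π.obj s.pt = t.pt
  leg : ∀ j, π.IsHomLift (t.ι.app j) (s.ι.app j)

/-- A functor is bicomplete if it has all small relative limits (terminal lifts of cones) and all
small relative colimits (initial lifts of cocones). -/
structure IsBicomplete (π : N ⥤ M) : Prop where
  limits : ∀ (J : Type v) [Category.{v} J] (δ : J ⥤ N) (t : Limits.Cone (δ ⋙ π)),
    ∃ s : Limits.Cone δ, IsConeLift π t s ∧ ∀ s' : Limits.Cone δ, IsConeLift π t s' →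
      ∃! m : s'.pt ⟶ s.pt, π.IsHomLift (𝟙 t.pt) m ∧ ∀ j, m ≫ s.π.app j = s'.π.app j
  colimits : ∀ (J : Type v) [Category.{v} J] (δ : J ⥤ N) (t : Limits.Cocone (δ ⋙ π)),
    ∃ s : Limits.Cocone δ, IsCoconeLift π t s ∧ ∀ s' : Limits.Cocone δ, IsCoconeLift π t s' →
      ∃! m : s.pt ⟶ s'.pt, π.IsHomLift (𝟙 t.pt) m ∧ ∀ j, s.ι.app j ≫ m = s'.ι.app j

/-- `(L, R)` is a `π`-weak factorization system relative to `(L', R')`. -/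
structure IsRelativeWFS (π : N ⥤ M) (L R : MorphismProperty N) (L' R' : MorphismProperty M) :
    Prop where
  map_left : L ≤ L'.inverseImage π
  map_right : R ≤ R'.inverseImage π
  retract_left : ∀ ⦃X Y X' Y' : N⦄ (f : X ⟶ Y) (g : X' ⟶ Y'), Nonempty (RetractArrow f g) →
    L g → L' (π.map f) → L f
  retract_right : ∀ ⦃X Y X' Y' : N⦄ (f : X ⟶ Y) (g : X' ⟶ Y'), Nonempty (RetractArrow f g) →
    R g → R' (π.map f) → R f
  factor : ∀ ⦃X Y : N⦄ (φ : X ⟶ Y) ⦃C : M⦄ (h : π.obj X ⟶ C) (g : C ⟶ π.obj Y),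
    h ≫ g = π.map φ → L' h → R' g →
    ∃ (Z : N) (η : X ⟶ Z) (ψ : Z ⟶ Y), η ≫ ψ = φ ∧ L η ∧ R ψ ∧ π.IsHomLift h η ∧ π.IsHomLift g ψ
  lift : ∀ ⦃X Y Z W : N⦄ (a : X ⟶ Z) (ψ : X ⟶ Y) (η : Z ⟶ W) (b : Y ⟶ W), L ψ → R η →
    a ≫ η = ψ ≫ b → ∀ u : π.obj Y ⟶ π.obj Z, π.map ψ ≫ u = π.map a → u ≫ π.map η = π.map b →
    ∃ γ : Y ⟶ Z, ψ ≫ γ = a ∧ γ ≫ η = b ∧ π.map γ = u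

/-- The classes `T` on the fibre of `π` over `A`. -/
abbrev fiberClasses (T : MapClasses N) (π : N ⥤ M) (A : M) : MapClasses (π.Fiber A) :=
  T.pullback Functor.Fiber.fiberInclusion

/-- `π` exhibits `N` as a model category relative to `M`. When model categories are required to
have functorial factorizations, so are the fibres of `π`. -/
structure IsRelativeModelCategory (k : FactorizationKind) (S : MapClasses M) (T : MapClasses N)
    (π : N ⥤ M) : Prop where
  preModel : T.IsPreModel
  bicomplete : IsBicomplete π
  two_out_of_three : ∀ ⦃X Y Z : N⦄ (f : X ⟶ Y) (g : Y ⟶ Z),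
    (T.W f → T.W g → S.W (π.map (f ≫ g)) → T.W (f ≫ g)) ∧
    (T.W f → T.W (f ≫ g) → S.W (π.map g) → T.W g) ∧
    (T.W g → T.W (f ≫ g) → S.W (π.map f) → T.W f)
  wfs_trivCof : IsRelativeWFS π T.trivCof T.fib S.trivCof S.fib
  wfs_trivFib : IsRelativeWFS π T.cof T.trivFib S.cof S.trivFib
  functorial_trivCof : k = .functorial → ∀ A : M,
    (fiberClasses T π A).trivCof.HasFunctorialFactorization (fiberClasses T π A).fib
  functorial_trivFib : k = .functorial → ∀ A : M,
    (fiberClasses T π A).cof.HasFunctorialFactorization (fiberClasses T π A).trivFib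

/-- `φ` is `π`-Cartesian. -/
abbrev IsCartesianMap (π : N ⥤ M) {X Y : N} (φ : X ⟶ Y) : Prop :=
  π.IsStronglyCartesian (π.map φ) φ

/-- `φ` is `π`-coCartesian. -/
abbrev IsCocartesianMap (π : N ⥤ M) {X Y : N} (φ : X ⟶ Y) : Prop :=
  π.IsStronglyCocartesian (π.map φ) φ

/-- BiCartesian fibrations. -/
structure IsBicartesianFibration (π : N ⥤ M) : Prop where
  cartesian : ∀ (Y : N) ⦃A : M⦄ (f : A ⟶ π.obj Y), ∃ (X : N) (φ : X ⟶ Y),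
    π.IsStronglyCartesian f φ
  cocartesian : ∀ (X : N) ⦃B : M⦄ (f : π.obj X ⟶ B), ∃ (Y : N) (φ : X ⟶ Y),
    π.IsStronglyCocartesian f φ

/-- `X` is `π`-cofibrant, i.e. cofibrant in its fibre. -/
def IsCofibrantOver (T : MapClasses N) (π : N ⥤ M) (X : N) : Prop :=
  (fiberClasses T π (π.obj X)).IsCofibrant ⟨X, rfl⟩

/-- `X` is `π`-fibrant, i.e. fibrant in its fibre. -/
def IsFibrantOver (T : MapClasses N) (π : N ⥤ M) (X : N) : Prop :=
  (fiberClasses T π (π.obj X)).IsFibrant ⟨X, rfl⟩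

/-- Model fibrations. -/
structure IsModelFibration (k : FactorizationKind) (S : MapClasses M) (T : MapClasses N)
    (π : N ⥤ M) : Prop extends IsRelativeModelCategory k S T π where
  bicartesian : IsBicartesianFibration π
  cocartesian_W : ∀ ⦃X Y : N⦄ (f : X ⟶ Y), IsCocartesianMap π f → IsCofibrantOver T π X →
    S.W (π.map f) → T.W f
  cartesian_W : ∀ ⦃X Y : N⦄ (f : X ⟶ Y), IsCartesianMap π f → IsFibrantOver T π Y →
    S.W (π.map f) → T.W f

end ModFib

section ModFib
universe v u
variable {M : Type u} [Category.{v} M]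

/-- A model fibration over `M`, bundled. -/
structure ModelFibration (k : FactorizationKind) (S : MapClasses M) where
  based : BasedCategory.{v, u} M
  classes : MapClasses based.obj
  isModelFibration : IsModelFibration k S classes based.p

/-- The condition on an adjunction `Φ ⊣ Ψ` over `M` to be a morphism of model fibrations. -/
structure IsModelFibrationMorphism {X Y : BasedCategory.{v, u} M} (T : MapClasses X.obj)
    (U : MapClasses Y.obj) (Φ : BasedFunctor X Y) (Ψ : BasedFunctor Y X) : Prop where
  quillen : IsQuillenPair T U Φ.toFunctor Ψ.toFunctor
  cocartesian : ∀ ⦃x y : X.obj⦄ (φ : x ⟶ y), IsCocartesianMap X.p φ →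
    IsCocartesianMap Y.p (Φ.map φ)
  cartesian : ∀ ⦃x y : Y.obj⦄ (φ : x ⟶ y), IsCartesianMap Y.p φ →
    IsCartesianMap X.p (Ψ.map φ)

/-- The adjunctions over `M` between model fibrations which are morphisms of model fibrations. -/
def modelFibrationCells (k : FactorizationKind) (S : MapClasses M) :
    CellClass (fun X : ModelFibration k S => Adj.mk X.based) where
  mem X Y f := IsModelFibrationMorphism X.classes Y.classes f.l f.r
  id_mem _ := ⟨IsQuillenPair.id _, fun _ _ _ h => h, fun _ _ _ h => h⟩
  comp_mem _ _ _ _ _ hf hg := ⟨hf.quillen.comp hg.quillen,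
    fun _ _ _ h => hg.cocartesian _ (hf.cocartesian _ h),
    fun _ _ _ h => hf.cartesian _ (hg.cartesian _ h)⟩

/-- The (2,1)-category of model fibrations over `M`. -/
abbrev ModFib (k : FactorizationKind) (S : MapClasses M) := SubTwoOne (modelFibrationCells k S)

end ModFib

section Integral
universe v u
variable {k : FactorizationKind} {M : Type u} [Category.{v} M]

namespace ModCat
variable {X Y : ModCat.{v, u} k}

/-- The component of a 2-cell on left Quillen functors. -/
abbrev leftHom {f g : X ⟶ Y} (a : f ⟶ g) :
    (SubTwoOne.Hom.cell f).l ⟶ (SubTwoOne.Hom.cell g).l := (SubTwoOne.Hom₂.iso a).hom.τl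

/-- The isomorphism of left Quillen functors underlying an invertible 2-cell. -/
@[simps] def leftIso {f g : X ⟶ Y} (e : f ≅ g) :
    (SubTwoOne.Hom.cell f).l ≅ (SubTwoOne.Hom.cell g).l where
  hom := leftHom e.hom
  inv := leftHom e.inv
  hom_inv_id := congrArg leftHom e.hom_inv_id
  inv_hom_id := congrArg leftHom e.inv_hom_id

end ModCat

namespace Diagram

/-- The underlying pseudofunctor to `Cat`, with values the left Quillen functors. -/
@[simps] def leftDiagram (F : Diagram.{v, u} M k) : LocallyDiscrete M ⥤ᵖ Cat.{v, u} where
  obj A := (F.obj A).cat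
  map f := (F.map f).cell.l
  map₂ a := ModCat.leftHom (F.map₂ a)
  map₂_id f := congrArg ModCat.leftHom (F.map₂_id f)
  map₂_comp a b := congrArg ModCat.leftHom (F.map₂_comp a b)
  mapId A := ModCat.leftIso (F.mapId A)
  mapComp f g := ModCat.leftIso (F.mapComp f g)
  map₂_whisker_left f _ _ a := congrArg ModCat.leftHom (F.map₂_whisker_left f a)
  map₂_whisker_right a h := congrArg ModCat.leftHom (F.map₂_whisker_right a h)
  map₂_associator f g h := congrArg ModCat.leftHom (F.map₂_associator f g h)
  map₂_left_unitor f := congrArg ModCat.leftHom (F.map₂_left_unitor f)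
  map₂_right_unitor f := congrArg ModCat.leftHom (F.map₂_right_unitor f)

/-- The pseudonatural transformation of left Quillen functors underlying a 1-cell. -/
@[simps] def leftTrans {F G : Diagram.{v, u} M k} (α : F ⟶ G) : F.leftDiagram ⟶ G.leftDiagram where
  app A := (α.app A).cell.l
  naturality f := ModCat.leftIso (α.naturality f)
  naturality_naturality a := congrArg ModCat.leftHom (α.naturality_naturality a)
  naturality_id A := congrArg ModCat.leftHom (α.naturality_id A)
  naturality_comp f g := congrArg ModCat.leftHom (α.naturality_comp f g)

lemma leftTrans_id (F : Diagram.{v, u} M k) : leftTrans (𝟙 F) = 𝟙 F.leftDiagram := by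
  rfl
lemma leftTrans_comp {F G H : Diagram.{v, u} M k} (α : F ⟶ G) (β : G ⟶ H) :
    leftTrans (α ≫ β) = leftTrans α ≫ leftTrans β := by
  rfl

/-- The Grothendieck construction `∫ F`: objects are pairs `(A, X)` with `X` in `F(A)`, maps
`(A, X) ⟶ (B, Y)` are pairs `(f : A ⟶ B, φ : f_! X ⟶ Y)`. -/
abbrev Total (F : Diagram.{v, u} M k) : Type u := F.leftDiagram.Grothendieck

/-- The integral classes of maps. -/
def totalClasses (S : MapClasses M) (F : Diagram.{v, u} M k) : MapClasses F.Total where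
  W X Y f := S.W f.base ∧ ∀ ⦃Q : (F.at' X.base).cat⦄ (q : Q ⟶ X.fiber),
    (F.at' X.base).classes.IsCofibrant Q → (F.at' X.base).classes.trivFib q →
    (F.at' Y.base).classes.W ((F.push f.base).map q ≫ f.fiber)
  cof _ Y f := S.cof f.base ∧ (F.at' Y.base).classes.cof f.fiber
  fib X Y f := S.fib f.base ∧
    (F.at' X.base).classes.fib ((F.adj f.base).homEquiv X.fiber Y.fiber f.fiber)

/-- `∫ F` as a category over `M`. -/
def totalBased (F : Diagram.{v, u} M k) : BasedCategory.{v, u} M :=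
  BasedCategory.ofFunctor (Pseudofunctor.Grothendieck.forget F.leftDiagram)

end Diagram
end Integral

section Zigzag
universe w₁ v₁ u₁
variable {B : Type u₁} [Bicategory.{w₁, v₁} B] {a b : B} {f : a ⟶ b} {g : b ⟶ a}

lemma leftZigzag_eq (η : 𝟙 a ⟶ f ≫ g) (ξ : g ≫ f ⟶ 𝟙 b) :
    leftZigzag η ξ = η ▷ f ≫ (α_ f g f).hom ≫ f ◁ ξ := by
  simp [bicategoricalComp]

lemma rightZigzag_eq (η : 𝟙 a ⟶ f ≫ g) (ξ : g ≫ f ⟶ 𝟙 b) :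
    rightZigzag η ξ = g ◁ η ≫ (α_ g f g).inv ≫ ξ ▷ g := by
  simp [bicategoricalComp]

end Zigzag

section Grothendieck
universe v u v₂ u₂
variable {M : Type u} [Category.{v} M] {P Q R : LocallyDiscrete M ⥤ᵖ Cat.{v₂, u₂}}

/-- A map of the Grothendieck construction. -/
abbrev mkHom {X Y : P.Grothendieck} (b : X.base ⟶ Y.base)
    (φ : (P.map b.toLoc).toFunctor.obj X.fiber ⟶ Y.fiber) : X ⟶ Y :=
  Pseudofunctor.Grothendieck.Hom.mk b φ

/-- The inclusion of the fibre `P(A)` in the Grothendieck construction, on maps. -/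
def vert (P : LocallyDiscrete M ⥤ᵖ Cat.{v₂, u₂}) {A : M} {x y : P.obj ⟨A⟩} (g : x ⟶ y) :
    (⟨A, x⟩ : P.Grothendieck) ⟶ ⟨A, y⟩ :=
  mkHom (𝟙 A) ((P.mapId ⟨A⟩).hom.toNatTrans.app x ≫ g)

@[simp] lemma vert_base {A : M} {x y : P.obj ⟨A⟩} (g : x ⟶ y) : (vert P g).base = 𝟙 A := rfl

lemma comp_vert {X : P.Grothendieck} {A : M} {x y : P.obj ⟨A⟩} (f : X ⟶ ⟨A, x⟩) (g : x ⟶ y) :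
    f ≫ vert P g = mkHom (Y := ⟨A, y⟩) f.base (f.fiber ≫ g) := by
  refine Eq.trans ?_ (Category.comp_id (mkHom (Y := ⟨A, y⟩) f.base (f.fiber ≫ g)))
  refine congrArg (Pseudofunctor.Grothendieck.Hom.mk _) ?_
  refine congrArg (_ ≫ ·) ?_
  have := (P.mapId ⟨A⟩).hom.toNatTrans.naturality g
  dsimp at this
  exact (Category.assoc _ _ _).symm.trans <| by
    erw [Functor.map_comp, Category.assoc, Category.assoc, this]
    rfl

lemma vert_comp {Y : P.Grothendieck} {A : M} {x y : P.obj ⟨A⟩} (g : x ⟶ y)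
    (f : (⟨A, y⟩ : P.Grothendieck) ⟶ Y) :
    vert P g ≫ f =
      mkHom (X := ⟨A, x⟩) f.base ((P.map f.base.toLoc).toFunctor.map g ≫ f.fiber) := by
  refine Eq.trans ?_ (Category.id_comp
    (mkHom (X := ⟨A, x⟩) f.base ((P.map f.base.toLoc).toFunctor.map g ≫ f.fiber)))
  refine congrArg (Pseudofunctor.Grothendieck.Hom.mk _) ?_
  refine congrArg (_ ≫ ·) ?_
  erw [Functor.map_comp, Category.assoc]
  rfl

lemma vert_id {A : M} (x : P.obj ⟨A⟩) : vert P (𝟙 x) = 𝟙 _ :=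
  congrArg (Pseudofunctor.Grothendieck.Hom.mk _) (Category.comp_id _)

lemma vert_vert {A : M} {x y z : P.obj ⟨A⟩} (f : x ⟶ y) (g : y ⟶ z) :
    vert P f ≫ vert P g = vert P (f ≫ g) := by
  rw [comp_vert]
  exact congrArg (Pseudofunctor.Grothendieck.Hom.mk _) (Category.assoc _ _ _)

lemma map_vert (θ : P ⟶ Q) {A : M} {x y : P.obj ⟨A⟩} (g : x ⟶ y) :
    (Pseudofunctor.Grothendieck.map θ).map (vert P g) = vert Q ((θ.app ⟨A⟩).toFunctor.map g) := by
  have h := comp_vert ((Pseudofunctor.Grothendieck.map θ).map (𝟙 (⟨A, x⟩ : P.Grothendieck)))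
    ((θ.app ⟨A⟩).toFunctor.map g)
  refine Eq.trans ?_ (h.symm.trans (Eq.trans (congrArg (· ≫ vert Q ((θ.app ⟨A⟩).toFunctor.map g))
    ((Pseudofunctor.Grothendieck.map θ).map_id (⟨A, x⟩ : P.Grothendieck))) (Category.id_comp _)))
  refine congrArg (Pseudofunctor.Grothendieck.Hom.mk _) ?_
  refine Eq.trans ?_ (Category.assoc _ _ _).symm
  exact congrArg (_ ≫ ·) (Functor.map_comp _ _ _)

section Adjunction
variable (θ : P ⟶ Q) {τ : ∀ A, Q.obj A ⥤ P.obj A} (adj : ∀ A, (θ.app A).toFunctor ⊣ τ A)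

/-- The functor `(A, X) ↦ (A, θ X)` between Grothendieck constructions. -/
abbrev totalLeft : P.Grothendieck ⥤ Q.Grothendieck := Pseudofunctor.Grothendieck.map θ

/-- `(A, Y) ↦ (A, τ Y)`. -/
abbrev totalRightObj (τ : ∀ A, Q.obj A ⥤ P.obj A) (Y : Q.Grothendieck) : P.Grothendieck :=
  ⟨Y.base, (τ ⟨Y.base⟩).obj Y.fiber⟩

/-- The counit of `totalAdj` below: the map `(A, θ τ Y) ⟶ (A, Y)` in the fibre over `A` given by
the counit. -/
def totalCounit (Y : Q.Grothendieck) : (totalLeft θ).obj (totalRightObj τ Y) ⟶ Y :=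
  vert Q ((adj ⟨Y.base⟩).counit.app Y.fiber)

/-- For a pseudonatural transformation `θ` with right adjoints `τ`, the bijection between maps
`(A, θ X) ⟶ (B, Y)` and maps `(A, X) ⟶ (B, τ Y)`: on fibre components it is the composite of
`θ_B f_! X ≅ f_! θ_A X` and the adjunction `θ_B ⊣ τ_B`. -/
def totalEquiv (X : P.Grothendieck) (Y : Q.Grothendieck) :
    ((totalLeft θ).obj X ⟶ Y) ≃ (X ⟶ totalRightObj τ Y) where
  toFun φ := mkHom (Y := totalRightObj τ Y) φ.base
    ((adj _).homEquiv _ _ ((θ.naturality φ.base.toLoc).hom.toNatTrans.app X.fiber ≫ φ.fiber))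
  invFun ψ := mkHom (X := (totalLeft θ).obj X) ψ.base
    ((θ.naturality ψ.base.toLoc).inv.toNatTrans.app X.fiber ≫
      ((adj _).homEquiv _ _).symm ψ.fiber)
  left_inv φ := by
    refine congrArg (Pseudofunctor.Grothendieck.Hom.mk φ.base) ?_
    exact (congrArg (_ ≫ ·) (Equiv.symm_apply_apply _ _)).trans
      (Cat.Hom.inv_hom_id_toNatTrans_app_assoc (θ.naturality φ.base.toLoc) X.fiber φ.fiber)
  right_inv ψ := by
    refine congrArg (Pseudofunctor.Grothendieck.Hom.mk ψ.base) ?_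
    exact (congrArg _ (Cat.Hom.hom_inv_id_toNatTrans_app_assoc (θ.naturality ψ.base.toLoc)
      X.fiber _)).trans (Equiv.apply_symm_apply _ _)

lemma totalEquiv_symm_apply {X : P.Grothendieck} {Y : Q.Grothendieck}
    (ψ : X ⟶ totalRightObj τ Y) :
    (totalEquiv θ adj X Y).symm ψ = (totalLeft θ).map ψ ≫ totalCounit θ adj Y := by
  refine Eq.trans ?_ (comp_vert ((totalLeft θ).map ψ)
    ((adj ⟨Y.base⟩).counit.app Y.fiber)).symm
  refine congrArg (Pseudofunctor.Grothendieck.Hom.mk (X := (totalLeft θ).obj X) (Y := Y) ψ.base) ?_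
  refine Eq.trans ?_ (Category.assoc _ _ _).symm
  exact congrArg (_ ≫ ·) (Adjunction.homEquiv_counit (adj _) _ _ _)

lemma totalEquiv_symm_naturality {X X' : P.Grothendieck} {Y : Q.Grothendieck} (f : X' ⟶ X)
    (ψ : X ⟶ totalRightObj τ Y) :
    (totalEquiv θ adj X' Y).symm (f ≫ ψ) =
      (totalLeft θ).map f ≫ (totalEquiv θ adj X Y).symm ψ := by
  rw [totalEquiv_symm_apply, totalEquiv_symm_apply, Functor.map_comp, Category.assoc]

lemma totalEquiv_naturality {X X' : P.Grothendieck} {Y : Q.Grothendieck} (f : X' ⟶ X)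
    (φ : (totalLeft θ).obj X ⟶ Y) :
    totalEquiv θ adj X' Y ((totalLeft θ).map f ≫ φ) = f ≫ totalEquiv θ adj X Y φ := by
  apply (totalEquiv θ adj X' Y).symm.injective
  rw [totalEquiv_symm_naturality, Equiv.symm_apply_apply, Equiv.symm_apply_apply]

lemma totalEquiv_comp {X : P.Grothendieck} {Y Y' : Q.Grothendieck}
    (φ : (totalLeft θ).obj X ⟶ Y) (g : Y ⟶ Y') :
    totalEquiv θ adj X Y' (φ ≫ g) =
      totalEquiv θ adj X Y φ ≫
        totalEquiv θ adj (totalRightObj τ Y) Y' (totalCounit θ adj Y ≫ g) := by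
  obtain ⟨ψ, rfl⟩ := (totalEquiv θ adj X Y).symm.surjective φ
  rw [← totalEquiv_naturality, totalEquiv_symm_apply, Category.assoc]
  refine congrArg (totalEquiv θ adj X Y') ?_
  rw [← totalEquiv_symm_apply, Equiv.apply_symm_apply]

/-- The right adjoint `(A, Y) ↦ (A, τ Y)`; on maps it is given by transposing the composite of the
counit and `g`. -/
@[simps obj] def totalRight : Q.Grothendieck ⥤ P.Grothendieck where
  obj Y := totalRightObj τ Y
  map {Y Y'} g := totalEquiv θ adj (totalRightObj τ Y) Y' (totalCounit θ adj Y ≫ g)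
  map_id Y := by
    apply (totalEquiv θ adj _ _).symm.injective
    rw [Equiv.symm_apply_apply, totalEquiv_symm_apply, CategoryTheory.Functor.map_id,
      Category.comp_id, Category.id_comp]
  map_comp f g := by rw [← totalEquiv_comp, Category.assoc]

/-- The adjunction between Grothendieck constructions induced by fibrewise adjunctions. -/
def totalAdj : totalLeft θ ⊣ totalRight θ adj :=
  Adjunction.mkOfHomEquiv
    { homEquiv X Y := totalEquiv θ adj X Y
      homEquiv_naturality_left_symm f g := totalEquiv_symm_naturality θ adj f g
      homEquiv_naturality_right f g := totalEquiv_comp θ adj f g }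

lemma totalAdj_unit_base (X : P.Grothendieck) : ((totalAdj θ adj).unit.app X).base = 𝟙 X.base :=
  rfl

lemma totalAdj_counit_base (Y : Q.Grothendieck) :
    ((totalAdj θ adj).counit.app Y).base = 𝟙 Y.base := rfl

/-- The Grothendieck construction as a category over `M`. -/
abbrev basedOf (P : LocallyDiscrete M ⥤ᵖ Cat.{v₂, u₂}) : BasedCategory M :=
  BasedCategory.ofFunctor (Pseudofunctor.Grothendieck.forget P)

lemma isHomLift_of_base {X Y : P.Grothendieck} (f : X ⟶ Y) {A : M} (hX : X.base = A)
    (hY : Y.base = A) (hf : f.base = eqToHom (hX.trans hY.symm)) :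
    (Pseudofunctor.Grothendieck.forget P).IsHomLift (𝟙 A) f :=
  IsHomLift.of_fac' _ _ _ hX hY (by subst hX; exact hf.trans (Eq.trans (Category.id_comp _) (Category.id_comp _)).symm)

/-- `totalLeft` as a functor over `M`. -/
def basedLeft : basedOf P ⟶ basedOf Q where
  toFunctor := totalLeft θ
  w := rfl

lemma totalRight_comp_forget :
    totalRight θ adj ⋙ Pseudofunctor.Grothendieck.forget P =
      Pseudofunctor.Grothendieck.forget Q :=
  CategoryTheory.Functor.ext (fun _ => rfl) (fun X Y f => by
    exact (Category.id_comp f.base).trans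
      ((Category.id_comp (f.base ≫ 𝟙 _)).trans (Category.comp_id f.base)).symm)

/-- `totalRight` as a functor over `M`. -/
def basedRight : basedOf Q ⟶ basedOf P where
  toFunctor := totalRight θ adj
  w := totalRight_comp_forget θ adj

/-- `totalAdj` as an adjunction over `M`. -/
def basedAdj : Bicategory.Adjunction (basedLeft θ) (basedRight θ adj) where
  unit :=
    { toNatTrans := (totalAdj θ adj).unit
      isHomLift' X := isHomLift_of_base _ rfl rfl rfl }
  counit :=
    { toNatTrans := (totalAdj θ adj).counit
      isHomLift' X := isHomLift_of_base _ rfl rfl rfl }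
  left_triangle := by
    rw [leftZigzag_eq]
    apply BasedNatTrans.homCategory.ext
    ext X
    refine Eq.trans ?_ (((totalAdj θ adj).left_triangle_components X).trans
      (Category.id_comp (𝟙 ((totalLeft θ).obj X))).symm)
    exact congrArg ((totalLeft θ).map ((totalAdj θ adj).unit.app X) ≫ ·)
      (Category.id_comp ((totalAdj θ adj).counit.app ((totalLeft θ).obj X)))
  right_triangle := by
    rw [rightZigzag_eq]
    apply BasedNatTrans.homCategory.ext
    ext X
    refine Eq.trans ?_ (((totalAdj θ adj).right_triangle_components X).trans
      (Category.id_comp (𝟙 ((totalRight θ adj).obj X))).symm)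
    exact congrArg ((totalAdj θ adj).unit.app ((totalRight θ adj).obj X) ≫ ·)
      (Category.id_comp ((totalRight θ adj).map ((totalAdj θ adj).counit.app X)))

end Adjunction

end Grothendieck

section TwoCells
universe v u v₂ u₂
variable {M : Type u} [Category.{v} M] {P Q R : LocallyDiscrete M ⥤ᵖ Cat.{v₂, u₂}}

lemma naturality_aux {C : Type*} [Category C] {p q r s t y : C} (i : p ⟶ q) (j : q ⟶ p)
    (hij : i ≫ j = 𝟙 p) (m : q ⟶ r) (c : r ⟶ y) (d : q ⟶ s) (m' : s ⟶ y) (h₁ : m ≫ c = d ≫ m')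
    (i' : t ⟶ s) (j' : s ⟶ t) (hij' : j' ≫ i' = 𝟙 s) (g : p ⟶ t) (h : d ≫ j' = j ≫ g) :
    (i ≫ m) ≫ c = g ≫ i' ≫ m' := by
  have h₂ : d = j ≫ g ≫ i' := by
    rw [← Category.assoc, ← h, Category.assoc, hij', Category.comp_id]
  rw [Category.assoc, h₁, h₂, Category.assoc, Category.assoc, ← Category.assoc i, hij,
    Category.id_comp]

/-- The isomorphism between the functors on Grothendieck constructions induced by an invertible
modification. -/
def totalIso {θ θ' : P ⟶ Q} (γ : ∀ A, θ.app A ≅ θ'.app A)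
    (hγ : ∀ {A B : LocallyDiscrete M} (f : A ⟶ B),
      P.map f ◁ (γ B).hom ≫ (θ'.naturality f).hom =
        (θ.naturality f).hom ≫ (γ A).hom ▷ Q.map f) :
    totalLeft θ ≅ totalLeft θ' :=
  NatIso.ofComponents
    (fun X =>
      { hom := vert Q ((γ ⟨X.base⟩).hom.toNatTrans.app X.fiber)
        inv := vert Q ((γ ⟨X.base⟩).inv.toNatTrans.app X.fiber)
        hom_inv_id := (vert_vert _ _).trans ((congrArg _
          (Cat.Hom.hom_inv_id_toNatTrans_app (γ ⟨X.base⟩) X.fiber)).trans (vert_id _))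
        inv_hom_id := (vert_vert _ _).trans ((congrArg _
          (Cat.Hom.inv_hom_id_toNatTrans_app (γ ⟨X.base⟩) X.fiber)).trans (vert_id _)) })
    (fun {X Y} f => by
      refine (comp_vert ((totalLeft θ).map f) _).trans (Eq.trans ?_ (vert_comp _ _).symm)
      refine congrArg (Pseudofunctor.Grothendieck.Hom.mk (X := (totalLeft θ).obj X)
        (Y := (totalLeft θ').obj Y) f.base) ?_
      have h : (γ ⟨Y.base⟩).hom.toNatTrans.app ((P.map f.base.toLoc).toFunctor.obj X.fiber) ≫
            (θ'.naturality f.base.toLoc).hom.toNatTrans.app X.fiber =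
          (θ.naturality f.base.toLoc).hom.toNatTrans.app X.fiber ≫
            (Q.map f.base.toLoc).toFunctor.map ((γ ⟨X.base⟩).hom.toNatTrans.app X.fiber) :=
        congrArg (fun t => t.toNatTrans.app X.fiber) (hγ f.base.toLoc)
      have h₁ := (γ ⟨Y.base⟩).hom.toNatTrans.naturality f.fiber
      have h₂ := Cat.Hom.inv_hom_id_toNatTrans_app (θ.naturality f.base.toLoc) X.fiber
      have h₃ := Cat.Hom.hom_inv_id_toNatTrans_app (θ'.naturality f.base.toLoc) X.fiber
      exact naturality_aux _ _ h₂ _ _ _ _ h₁ _ _ h₃ _ h)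

/-- `totalIso` as an isomorphism of functors over `M`. -/
def basedIso {θ θ' : P ⟶ Q} (γ : ∀ A, θ.app A ≅ θ'.app A)
    (hγ : ∀ {A B : LocallyDiscrete M} (f : A ⟶ B),
      P.map f ◁ (γ B).hom ≫ (θ'.naturality f).hom =
        (θ.naturality f).hom ≫ (γ A).hom ▷ Q.map f) :
    basedLeft θ ≅ basedLeft θ' :=
  BasedNatIso.mkNatIso (totalIso γ hγ) (fun _ => isHomLift_of_base _ rfl rfl rfl)

end TwoCells

section Integral
universe v u
variable {k : FactorizationKind} {M : Type u} [Category.{v} M]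

namespace Diagram

/-- The adjunction over `M` between Grothendieck constructions induced by a pseudonatural
transformation: `(A, X) ↦ (A, α_A X)`, with right adjoint `(A, Y) ↦ (A, α_A^* Y)`. -/
def totalAdj {F G : Diagram.{v, u} M k} (α : F ⟶ G) : Adj.mk F.totalBased ⟶ Adj.mk G.totalBased :=
  .mk (basedAdj (leftTrans α) (fun A => ModCat.adj (α.app A)))

/-- A 2-cell in `Adj` from an isomorphism of left adjoints. -/
def adjIso {B : Type*} [Bicategory B] {X Y : Adj B} {f g : X ⟶ Y} (e : f.l ≅ g.l) : f ≅ g :=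
  Adj.iso₂Mk e (conjugateIsoEquiv g.adj f.adj e) rfl

/-- The component of an (automatically invertible) modification. -/
def leftModIso {F G : Diagram.{v, u} M k} {α β : F ⟶ G} (Γ : α ⟶ β) (A : LocallyDiscrete M) :
    (leftTrans α).app A ≅ (leftTrans β).app A :=
  Adj.lIso (SubTwoOne.Hom₂.iso (Γ.as.app A))

lemma leftModIso_naturality {F G : Diagram.{v, u} M k} {α β : F ⟶ G} (Γ : α ⟶ β)
    {A B : LocallyDiscrete M} (f : A ⟶ B) :
    F.leftDiagram.map f ◁ (leftModIso Γ B).hom ≫ ((leftTrans β).naturality f).hom =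
        ((leftTrans α).naturality f).hom ≫ (leftModIso Γ A).hom ▷ G.leftDiagram.map f :=
  congrArg ModCat.leftHom (Γ.as.naturality f)

/-- The 2-cell between adjunctions over `M` induced by a modification `Γ`; its component at `(A, X)`
is the map in the fibre over `A` given by `Γ`. -/
def totalAdjIso {F G : Diagram.{v, u} M k} {α β : F ⟶ G} (Γ : α ⟶ β) : totalAdj α ≅ totalAdj β :=
  adjIso (basedIso (leftModIso Γ) (leftModIso_naturality Γ))

/-- Compatibility of `totalAdj` with identities. -/
def totalAdjId (F : Diagram.{v, u} M k) : totalAdj (𝟙 F) ≅ 𝟙 (Adj.mk F.totalBased) :=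
  adjIso (BasedNatIso.mkNatIso (Pseudofunctor.Grothendieck.mapIdIso F.leftDiagram)
    (fun _ => isHomLift_of_base _ rfl rfl rfl))

/-- Compatibility of `totalAdj` with composition. -/
def totalAdjComp {F G H : Diagram.{v, u} M k} (α : F ⟶ G) (β : G ⟶ H) :
    totalAdj (α ≫ β) ≅ totalAdj α ≫ totalAdj β :=
  adjIso (BasedNatIso.mkNatIso (Pseudofunctor.Grothendieck.mapCompIso (leftTrans α) (leftTrans β))
    (fun _ => isHomLift_of_base _ rfl rfl rfl))

end Diagram
end Integral

section Integral
universe v u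
variable (k : FactorizationKind) {M : Type u} [Category.{v} M] (S : MapClasses M)

variable {k S} in
/-- The component at an object of a 2-cell of model fibrations. -/
def component {X Y : ModFib.{v, u} k S} {f g : X ⟶ Y} (a : f ⟶ g) (x : (ModelFibration.based X).obj) :
    (SubTwoOne.Hom.cell f).l.obj x ⟶ (SubTwoOne.Hom.cell g).l.obj x :=
  (SubTwoOne.Hom₂.iso a).hom.τl.app x

variable {k S} in
lemma ext_component {X Y : ModFib.{v, u} k S} {f g : X ⟶ Y} {a b : f ⟶ g}
    (h : ∀ x, component a x = component b x) : a = b := by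
  apply SubTwoOne.hom₂_ext
  apply Adj.hom₂_ext
  apply BasedNatTrans.homCategory.ext
  ext x
  exact h x

lemma map_id_comp_aux {C D : Type*} [Category C] [Category D] (L : C ⥤ D) (x : C) {y : D}
    (t : L.obj x ⟶ y) : t = L.map (𝟙 x) ≫ t := by simp

section component
variable {k S} {X Y Z : ModFib.{v, u} k S}

lemma component_comp {f g h : X ⟶ Y} (a : f ⟶ g) (b : g ⟶ h)
    (x : (ModelFibration.based X).obj) :
    component (a ≫ b) x = component a x ≫ component b x := rfl

lemma component_whiskerLeft (f : X ⟶ Y) {g h : Y ⟶ Z} (a : g ⟶ h)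
    (x : (ModelFibration.based X).obj) :
    component (f ◁ a) x = component a ((SubTwoOne.Hom.cell f).l.obj x) := rfl

lemma component_whiskerRight {f g : X ⟶ Y} (a : f ⟶ g) (h : Y ⟶ Z)
    (x : (ModelFibration.based X).obj) :
    component (a ▷ h) x = (SubTwoOne.Hom.cell h).l.map (component a x) := rfl

lemma component_associator {W : ModFib.{v, u} k S} (f : W ⟶ X) (g : X ⟶ Y) (h : Y ⟶ Z)
    (x : (ModelFibration.based W).obj) :
    component (α_ f g h).hom x = 𝟙 _ := rfl

lemma component_leftUnitor (f : X ⟶ Y) (x : (ModelFibration.based X).obj) :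
    component (λ_ f).hom x = 𝟙 _ := rfl

lemma component_rightUnitor (f : X ⟶ Y) (x : (ModelFibration.based X).obj) :
    component (ρ_ f).hom x = 𝟙 _ := rfl

end component

variable
    (hobj : ∀ F : FunPR S k, IsModelFibration k S (F.1.totalClasses S) F.1.totalBased.p)
    (hmap : ∀ {F G : FunPR S k} (α : F ⟶ G), IsModelFibrationMorphism (F.1.totalClasses S)
      (G.1.totalClasses S) (Diagram.totalAdj α.hom).l (Diagram.totalAdj α.hom).r)

/-- The model fibration `∫ F ⟶ M`. -/
def integralObj (F : FunPR S k) : ModFib k S :=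
  ModelFibration.mk F.1.totalBased (F.1.totalClasses S) (hobj F)

/-- The morphism of model fibrations `∫ F ⟶ ∫ G` induced by `α : F ⟶ G`. -/
def integralMap {F G : FunPR S k} (α : F ⟶ G) : integralObj k S hobj F ⟶ integralObj k S hobj G :=
  SubTwoOne.Hom.mk (Diagram.totalAdj α.hom) (hmap α)

/-- The functor of (2,1)-categories `F ↦ ∫ F` from proper relative functors to model fibrations,
given the facts that it takes values in model fibrations and morphisms of model fibrations. -/
def integral : FunPR S k ⥤ᵖ ModFib k S where
  obj F := integralObj k S hobj F
  map α := integralMap k S hobj hmap α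
  map₂ Γ := SubTwoOne.Hom₂.mk (Diagram.totalAdjIso Γ.hom)
  mapId F := SubTwoOne.isoMk (Diagram.totalAdjId F.1)
  mapComp α β := SubTwoOne.isoMk (Diagram.totalAdjComp α.hom β.hom)
  map₂_id α := ext_component fun x => by
    exact vert_id _
  map₂_comp Γ Γ' := ext_component fun x => by
    exact (vert_vert _ _).symm
  map₂_whisker_left α β β' Γ := ext_component fun x => by
    refine Eq.trans ?_ ((Category.id_comp _).trans (Category.comp_id _)).symm
    exact rfl
  map₂_whisker_right Γ β := ext_component fun x => by
    refine Eq.trans ?_ ((Category.id_comp _).trans (Category.comp_id _)).symm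
    exact (map_vert (Diagram.leftTrans β.hom) _).symm
  map₂_associator α β γ := ext_component fun x => by
    refine (vert_id _).trans ?_
    simp only [component_comp, component_whiskerLeft, component_whiskerRight, component_associator]
    refine Eq.trans ?_ (Category.id_comp _).symm
    refine Eq.trans ?_ (map_id_comp_aux (totalLeft (Diagram.leftTrans γ.hom))
      ((totalLeft (Diagram.leftTrans β.hom)).obj ((totalLeft (Diagram.leftTrans α.hom)).obj x)) _)
    refine Eq.trans ?_ (Category.id_comp _).symm
    exact (Category.id_comp _).symm
  map₂_left_unitor α := ext_component fun x => by
    refine (vert_id _).trans ?_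
    simp only [component_comp, component_whiskerRight, component_leftUnitor]
    refine Eq.trans ?_ (Category.id_comp _).symm
    refine Eq.trans ?_ (map_id_comp_aux (totalLeft (Diagram.leftTrans α.hom)) x _)
    exact rfl
  map₂_right_unitor α := ext_component fun x => by
    refine (vert_id _).trans ?_
    simp only [component_comp, component_whiskerLeft, component_rightUnitor]
    refine Eq.trans ?_ (Category.id_comp _).symm
    exact (Category.id_comp _).symm

end Integral

section Biequivalence
universe w₁ v₁ u₁ w₂ v₂ u₂
variable {B : Type u₁} [Bicategory.{w₁, v₁} B] {C : Type u₂} [Bicategory.{w₂, v₂} C]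

/-- Equivalences of bicategories: pseudofunctors which are surjective on objects up to equivalence
and are equivalences on all categories of 1-cells. -/
structure IsBiequivalence (P : B ⥤ᵖ C) : Prop where
  exists_equivalence : ∀ Y : C, ∃ X : B, Nonempty (Bicategory.Equivalence (P.obj X) Y)
  isEquivalence_mapFunctor : ∀ X X' : B,
    (P.toPrelaxFunctor.mapFunctor X X').IsEquivalence

end Biequivalence

end ModelGrothendieck

open ModelGrothendieck

universe v u

namespace ModelGrothendieck

section ModelBasics
universe u'

open Limits

lemma FactorizationKind.HasFactorization.exists_fac {k : FactorizationKind} {C : Type u}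
    [Category.{v} C] {L R : MorphismProperty C} (h : k.HasFactorization L R) {X Y : C}
    (f : X ⟶ Y) : ∃ (Z : C) (i : X ⟶ Z) (p : Z ⟶ Y), i ≫ p = f ∧ L i ∧ R p := by
  have : L.HasFactorization R := by
    cases k with
    | plain => exact h
    | functorial =>
      have : L.HasFunctorialFactorization R := h
      infer_instance
  let d := MorphismProperty.factorizationData L R f
  exact ⟨d.Z, d.i, d.p, d.fac, d.hi, d.hp⟩

/-- The retract argument, for the left factor. -/
lemma exists_retract_left {C : Type u} [Category.{v} C] {X Y Z : C} {f : X ⟶ Y} {i : X ⟶ Z}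
    {p : Z ⟶ Y} (fac : i ≫ p = f) (h : HasLiftingProperty f p) : Nonempty (RetractArrow f i) := by
  have sq : CommSq i f p (𝟙 Y) := ⟨by simp [fac]⟩
  exact ⟨{ i := Arrow.homMk (𝟙 X) sq.lift (by simp)
           r := Arrow.homMk (𝟙 X) p (by simp [fac])
           retract := by ext <;> simp }⟩

/-- The retract argument, for the right factor. -/
lemma exists_retract_right {C : Type u} [Category.{v} C] {X Y Z : C} {f : X ⟶ Y} {i : X ⟶ Z}
    {p : Z ⟶ Y} (fac : i ≫ p = f) (h : HasLiftingProperty i f) : Nonempty (RetractArrow f p) := by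
  have sq : CommSq (𝟙 X) i f p := ⟨by simp [fac]⟩
  exact ⟨{ i := Arrow.homMk i (𝟙 Y) (by simp [fac])
           r := Arrow.homMk sq.lift (𝟙 Y) (by simp)
           retract := by ext <;> simp }⟩

namespace IsModelCategory

variable {k : FactorizationKind} {C : Type u} [Category.{v} C] {S : MapClasses C}
  (h : IsModelCategory k S)
include h

lemma W_comp {X Y Z : C} {f : X ⟶ Y} {g : Y ⟶ Z} (hf : S.W f) (hg : S.W g) : S.W (f ≫ g) :=
  h.two_out_of_three.comp_mem f g hf hg

lemma W_comp_iff_left {X Y Z : C} {f : X ⟶ Y} (g : Y ⟶ Z) (hf : S.W f) : S.W (f ≫ g) ↔ S.W g :=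
  ⟨fun hfg => h.two_out_of_three.of_precomp f g hf hfg, fun hg => h.W_comp hf hg⟩

lemma W_comp_iff_right {X Y Z : C} (f : X ⟶ Y) {g : Y ⟶ Z} (hg : S.W g) : S.W (f ≫ g) ↔ S.W f :=
  ⟨fun hfg => h.two_out_of_three.of_postcomp f g hg hfg, fun hf => h.W_comp hf hg⟩

lemma trivCof_retract {X Y X' Y' : C} {f : X ⟶ Y} {g : X' ⟶ Y'} (r : RetractArrow f g)
    (hg : S.trivCof g) : S.trivCof f :=
  ⟨h.retract_cof.of_retract r hg.1, h.retract_W.of_retract r hg.2⟩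

lemma trivFib_retract {X Y X' Y' : C} {f : X ⟶ Y} {g : X' ⟶ Y'} (r : RetractArrow f g)
    (hg : S.trivFib g) : S.trivFib f :=
  ⟨h.retract_fib.of_retract r hg.1, h.retract_W.of_retract r hg.2⟩

lemma W_iso {X Y : C} (f : X ⟶ Y) [IsIso f] : S.W f := h.iso_W _ ‹IsIso f›
lemma cof_iso {X Y : C} (f : X ⟶ Y) [IsIso f] : S.cof f := h.iso_cof _ ‹IsIso f›
lemma fib_iso {X Y : C} (f : X ⟶ Y) [IsIso f] : S.fib f := h.iso_fib _ ‹IsIso f›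
lemma trivCof_iso {X Y : C} (f : X ⟶ Y) [IsIso f] : S.trivCof f := ⟨h.cof_iso f, h.W_iso f⟩
lemma trivFib_iso {X Y : C} (f : X ⟶ Y) [IsIso f] : S.trivFib f := ⟨h.fib_iso f, h.W_iso f⟩

lemma cof_of_lift {X Y : C} {f : X ⟶ Y}
    (hf : ∀ ⦃Z V : C⦄ (p : Z ⟶ V), S.trivFib p → HasLiftingProperty f p) : S.cof f := by
  obtain ⟨Z, i, p, fac, hi, hp⟩ := h.factor_trivFib.exists_fac f
  obtain ⟨r⟩ := exists_retract_left fac (hf p hp)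
  exact h.retract_cof.of_retract r hi

lemma trivCof_of_lift {X Y : C} {f : X ⟶ Y}
    (hf : ∀ ⦃Z V : C⦄ (p : Z ⟶ V), S.fib p → HasLiftingProperty f p) : S.trivCof f := by
  obtain ⟨Z, i, p, fac, hi, hp⟩ := h.factor_trivCof.exists_fac f
  obtain ⟨r⟩ := exists_retract_left fac (hf p hp)
  exact h.trivCof_retract r hi

lemma fib_of_lift {X Y : C} {f : X ⟶ Y}
    (hf : ∀ ⦃Z V : C⦄ (i : Z ⟶ V), S.trivCof i → HasLiftingProperty i f) : S.fib f := by
  obtain ⟨Z, i, p, fac, hi, hp⟩ := h.factor_trivCof.exists_fac f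
  obtain ⟨r⟩ := exists_retract_right fac (hf i hi)
  exact h.retract_fib.of_retract r hp

lemma trivFib_of_lift {X Y : C} {f : X ⟶ Y}
    (hf : ∀ ⦃Z V : C⦄ (i : Z ⟶ V), S.cof i → HasLiftingProperty i f) : S.trivFib f := by
  obtain ⟨Z, i, p, fac, hi, hp⟩ := h.factor_trivFib.exists_fac f
  obtain ⟨r⟩ := exists_retract_right fac (hf i hi)
  exact h.trivFib_retract r hp

lemma cof_comp {X Y Z : C} {f : X ⟶ Y} {g : Y ⟶ Z} (hf : S.cof f) (hg : S.cof g) :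
    S.cof (f ≫ g) :=
  h.cof_of_lift fun _ _ p hp => by
    have := h.lift_trivFib f p hf hp
    have := h.lift_trivFib g p hg hp
    infer_instance

lemma trivCof_comp {X Y Z : C} {f : X ⟶ Y} {g : Y ⟶ Z} (hf : S.trivCof f) (hg : S.trivCof g) :
    S.trivCof (f ≫ g) :=
  ⟨h.cof_comp hf.1 hg.1, h.W_comp hf.2 hg.2⟩

lemma fib_comp {X Y Z : C} {f : X ⟶ Y} {g : Y ⟶ Z} (hf : S.fib f) (hg : S.fib g) :
    S.fib (f ≫ g) :=
  h.fib_of_lift fun _ _ i hi => by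
    have := h.lift_trivCof i f hi hf
    have := h.lift_trivCof i g hi hg
    infer_instance

lemma trivFib_comp {X Y Z : C} {f : X ⟶ Y} {g : Y ⟶ Z} (hf : S.trivFib f) (hg : S.trivFib g) :
    S.trivFib (f ≫ g) :=
  ⟨h.fib_comp hf.1 hg.1, h.W_comp hf.2 hg.2⟩

lemma isCofibrant_of_cof {X Y : C} {f : X ⟶ Y} (hX : S.IsCofibrant X) (hf : S.cof f) :
    S.IsCofibrant Y := fun I hI => by
  rw [hI.hom_ext (hI.to Y) (hI.to X ≫ f)]
  exact h.cof_comp (hX hI) hf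

lemma isFibrant_of_fib {X Y : C} {f : X ⟶ Y} (hY : S.IsFibrant Y) (hf : S.fib f) :
    S.IsFibrant X := fun I hI => by
  rw [hI.hom_ext (hI.from X) (f ≫ hI.from Y)]
  exact h.fib_comp hf (hY hI)

lemma isCofibrant_of_initial {I X : C} (hI : IsInitial I) (hX : S.cof (hI.to X)) :
    S.IsCofibrant X := fun J hJ => by
  have : IsIso (hJ.to I) := ⟨hI.to J, hJ.hom_ext _ _, hI.hom_ext _ _⟩
  rw [hJ.hom_ext (hJ.to X) (hJ.to I ≫ hI.to X)]
  exact h.cof_comp (h.cof_iso _) hX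

lemma isFibrant_of_terminal {T X : C} (hT : IsTerminal T) (hX : S.fib (hT.from X)) :
    S.IsFibrant X := fun J hJ => by
  have : IsIso (hJ.from T) := ⟨hT.from J, hT.hom_ext _ _, hJ.hom_ext _ _⟩
  rw [hJ.hom_ext (hJ.from X) (hT.from X ≫ hJ.from T)]
  exact h.fib_comp hX (h.fib_iso _)

lemma exists_cofibrant (X : C) : ∃ (Q : C) (q : Q ⟶ X), S.IsCofibrant Q ∧ S.trivFib q := by
  have := h.hasColimits
  obtain ⟨Q, i, q, -, hi, hq⟩ := h.factor_trivFib.exists_fac (initial.to X)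
  refine ⟨Q, q, h.isCofibrant_of_initial initialIsInitial ?_, hq⟩
  rwa [initialIsInitial.hom_ext (initialIsInitial.to Q) i]

lemma exists_fibrant (X : C) : ∃ (R : C) (r : X ⟶ R), S.IsFibrant R ∧ S.trivCof r := by
  have := h.hasLimits
  obtain ⟨R, r, p, -, hr, hp⟩ := h.factor_trivCof.exists_fac (terminal.from X)
  refine ⟨R, r, h.isFibrant_of_terminal terminalIsTerminal ?_, hr⟩
  rwa [terminalIsTerminal.hom_ext (terminalIsTerminal.from R) p]

lemma exists_lift_cofibrant {Q X Y : C} (hQ : S.IsCofibrant Q) {p : X ⟶ Y} (hp : S.trivFib p)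
    (g : Q ⟶ Y) : ∃ l : Q ⟶ X, l ≫ p = g := by
  have := h.hasColimits
  have := h.lift_trivFib _ p (hQ initialIsInitial) hp
  have sq : CommSq (initial.to X) (initialIsInitial.to Q) p g := ⟨initialIsInitial.hom_ext _ _⟩
  exact ⟨sq.lift, sq.fac_right⟩

end IsModelCategory

/-- In the presence of the other axioms of a model category, the class of weak equivalences is
automatically stable under retracts. -/
lemma isStableUnderRetracts_W {C : Type u} [Category.{v} C] {S : MapClasses C} [HasPushouts C]
    (hW : S.W.HasTwoOutOfThreeProperty) (h₁ : S.trivCof.IsStableUnderRetracts)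
    (h₂ : S.trivFib.IsStableUnderRetracts)
    (lift : ∀ ⦃A B X Y : C⦄ (i : A ⟶ B) (p : X ⟶ Y), S.trivCof i → S.fib p →
      HasLiftingProperty i p)
    (fac : ∀ ⦃X Y : C⦄ (f : X ⟶ Y), ∃ (Z : C) (i : X ⟶ Z) (p : Z ⟶ Y),
      i ≫ p = f ∧ S.trivCof i ∧ S.fib p) : S.W.IsStableUnderRetracts := by
  have key : ∀ ⦃X Y Z V : C⦄ (f : X ⟶ Y) (w : Z ⟶ V), S.fib f → S.W w → RetractArrow f w →
      S.W f := by
    intro X Y Z V f w hf hw r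
    obtain ⟨T, i, p, rfl, hi, hp⟩ := fac w
    have hp' : S.trivFib p := ⟨hp, hW.of_precomp i p hi.2 hw⟩
    have := lift i f hi hf
    have sq : CommSq r.r.left i f (p ≫ r.r.right) := ⟨by simp⟩
    refine (h₂.of_retract (f := f) (g := p)
      { i := Arrow.homMk (r.i.left ≫ i) r.i.right (by simp)
        r := Arrow.homMk sq.lift r.r.right (by simp)
        retract := ?_ } hp').2
    ext
    · simp
    · simp
  have main : ∀ ⦃X Y Z V : C⦄ (f : X ⟶ Y) (w : Z ⟶ V), S.W w → ∀ (a : X ⟶ Z) (a' : Z ⟶ X)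
      (b : Y ⟶ V) (b' : V ⟶ Y), a ≫ a' = 𝟙 X → b ≫ b' = 𝟙 Y → a ≫ w = f ≫ b → a' ≫ f = w ≫ b' →
      S.W f := by
    intro X Y Z V f w hw a a' b b' ha hb hab hab'
    obtain ⟨T, i, p, rfl, hi, hp⟩ := fac f
    have hinl : S.trivCof (pushout.inl a i) := by
      obtain ⟨Z', i', p', fac', hi', hp'⟩ := fac (pushout.inl a i)
      refine h₁.of_retract (exists_retract_left fac' ?_).some hi'
      have := lift i p' hi hp'
      exact (IsPushout.of_hasPushout a i).hasLiftingProperty p'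
    let d : pushout a i ⟶ V := pushout.desc w (p ≫ b) (by rw [hab, Category.assoc])
    have hd : S.W d := hW.of_precomp (pushout.inl a i) d hinl.2 (by
      rwa [pushout.inl_desc])
    let e : pushout a i ⟶ T := pushout.desc (a' ≫ i) (𝟙 T) (by
      rw [← Category.assoc, ha, Category.id_comp, Category.comp_id])
    have he : pushout.inr a i ≫ e = 𝟙 T := pushout.inr_desc _ _ _
    have hed : e ≫ p = d ≫ b' := by
      apply pushout.hom_ext
      · rw [pushout.inl_desc_assoc, pushout.inl_desc_assoc, Category.assoc, hab']
      · rw [pushout.inr_desc_assoc, pushout.inr_desc_assoc, Category.assoc, hb,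
          Category.comp_id, Category.id_comp]
    refine hW.comp_mem _ _ hi.2 (key p d hp hd
      { i := Arrow.homMk (pushout.inr _ _) b (pushout.inr_desc _ _ _)
        r := Arrow.homMk e b' hed
        retract := by ext; exacts [he, hb] })
  exact ⟨fun r hw => main _ _ hw r.i.left r.r.left r.i.right r.r.right
    r.retract_left r.retract_right r.i.w r.r.w⟩

end ModelBasics

section QuillenEquivalence
universe u'

open Limits

variable {k : FactorizationKind} {C : Type u} [Category.{v} C] {D : Type u'} [Category.{v} D]
  {S : MapClasses C} {T : MapClasses D} (hS : IsModelCategory k S) (hT : IsModelCategory k T)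
  {F : C ⥤ D} {G : D ⥤ C} (adj : F ⊣ G)

lemma isQuillenPair_of_left (hS : IsModelCategory k S) (adj : F ⊣ G)
    (h₁ : S.cof ≤ T.cof.inverseImage F) (h₂ : S.trivCof ≤ T.trivCof.inverseImage F)
    (hT : IsModelCategory k T) : IsQuillenPair S T F G where
  cof := h₁
  trivCof := h₂
  fib _ _ p hp := hS.fib_of_lift fun _ _ i hi =>
    (adj.hasLiftingProperty_iff i p).1 (hT.lift_trivCof _ _ (h₂ _ hi) hp)
  trivFib _ _ p hp := hS.trivFib_of_lift fun _ _ i hi =>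
    (adj.hasLiftingProperty_iff i p).1 (hT.lift_trivFib _ _ (h₁ _ hi) hp)

lemma IsQuillenPair.isCofibrant_obj (h : IsQuillenPair S T F G) (hS : IsModelCategory k S)
    (hT : IsModelCategory k T) (adj : F ⊣ G) {X : C} (hX : S.IsCofibrant X) :
    T.IsCofibrant (F.obj X) := by
  have := hS.hasColimits
  have := adj.leftAdjoint_preservesColimits
  have hI : IsInitial (F.obj (⊥_ C)) := IsInitial.isInitialObj F _ initialIsInitial
  refine hT.isCofibrant_of_initial hI ?_
  rw [hI.hom_ext (hI.to (F.obj X)) (F.map (initialIsInitial.to X))]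
  exact h.cof _ (hX _)

namespace IsQuillenEquivalence

variable {adj}
variable (h : IsQuillenEquivalence S T adj) (hQ : IsQuillenPair S T F G)
include hS hT hQ h

lemma W_homEquiv_iff {X : C} {Y : D} (hX : S.IsCofibrant X) (hY : T.IsFibrant Y)
    (j : F.obj X ⟶ Y) : S.W (adj.homEquiv X Y j) ↔ T.W j := by
  constructor
  · intro hj
    obtain ⟨Z, i, p, fac, hi, hp⟩ := hS.factor_trivFib.exists_fac (adj.homEquiv X Y j)
    have hi' : S.trivCof i := ⟨hi, by rwa [← fac, hS.W_comp_iff_right _ hp.2] at hj⟩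
    have := h.counit p hY (hS.isCofibrant_of_cof hX hi) hp
    have e : j = F.map i ≫ F.map p ≫ adj.counit.app Y := by
      have e := adj.homEquiv_counit X Y (adj.homEquiv X Y j)
      rw [Equiv.symm_apply_apply, ← fac, F.map_comp, Category.assoc] at e
      exact e
    rw [e, hT.W_comp_iff_left _ (hQ.trivCof _ hi').2]
    exact this
  · intro hj
    obtain ⟨Z, i, p, fac, hi, hp⟩ := hT.factor_trivCof.exists_fac j
    have hp' : T.trivFib p := ⟨hp, by rwa [← fac, hT.W_comp_iff_left _ hi.2] at hj⟩
    have := h.unit i hX (hT.isFibrant_of_fib hY hp) hi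
    rw [← fac, adj.homEquiv_unit, G.map_comp, ← Category.assoc,
      hS.W_comp_iff_right _ (hQ.trivFib _ hp').2]
    exact this

lemma W_map_iff {X X' : C} (hX : S.IsCofibrant X) (hX' : S.IsCofibrant X') (f : X ⟶ X') :
    T.W (F.map f) ↔ S.W f := by
  obtain ⟨R, r, hR, hr⟩ := hT.exists_fibrant (F.obj X')
  rw [← hT.W_comp_iff_right _ hr.2, ← h.W_homEquiv_iff hS hT hQ hX hR,
    adj.homEquiv_naturality_left, hS.W_comp_iff_right _
      ((h.W_homEquiv_iff hS hT hQ hX' hR r).2 hr.2)]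

/-- Independence of the cofibrant replacement. -/
lemma W_replacement_iff {X : C} {Y : D} (φ : F.obj X ⟶ Y) {Q : C} (q : Q ⟶ X)
    (hQ' : S.IsCofibrant Q) (hq : S.W q) :
    (∀ ⦃P : C⦄ (p : P ⟶ X), S.IsCofibrant P → S.trivFib p → T.W (F.map p ≫ φ)) ↔
      T.W (F.map q ≫ φ) := by
  have key : ∀ ⦃P : C⦄ (p : P ⟶ X), S.IsCofibrant P → S.trivFib p →
      (T.W (F.map p ≫ φ) ↔ T.W (F.map q ≫ φ)) := by
    intro P p hP hp
    obtain ⟨l, rfl⟩ := hS.exists_lift_cofibrant hQ' hp q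
    have hl : S.W l := by rwa [hS.W_comp_iff_right _ hp.2] at hq
    rw [F.map_comp, Category.assoc, hT.W_comp_iff_left _ ((h.W_map_iff hS hT hQ hQ' hP l).2 hl)]
  constructor
  · intro H
    obtain ⟨P, p, hP, hp⟩ := hS.exists_cofibrant X
    exact (key p hP hp).1 (H p hP hp)
  · intro H P p hP hp
    exact (key p hP hp).2 H

lemma W_replacement_iff_right {X : C} {Y : D} (φ : F.obj X ⟶ Y) {R : D} (r : Y ⟶ R)
    (hR : T.IsFibrant R) (hr : T.W r) :
    (∀ ⦃P : C⦄ (p : P ⟶ X), S.IsCofibrant P → S.trivFib p → T.W (F.map p ≫ φ)) ↔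
      S.W (adj.homEquiv X Y φ ≫ G.map r) := by
  obtain ⟨Q, q, hQ', hq⟩ := hS.exists_cofibrant X
  rw [h.W_replacement_iff hS hT hQ φ q hQ' hq.2, ← hT.W_comp_iff_right _ hr,
    ← h.W_homEquiv_iff hS hT hQ hQ' hR, ← adj.homEquiv_naturality_right, Category.assoc,
    adj.homEquiv_naturality_left, hS.W_comp_iff_left _ hq.2]

end IsQuillenEquivalence

end QuillenEquivalence

section TotalMaps
universe v₂ u₂
variable {M : Type u} [Category.{v} M] (P : LocallyDiscrete M ⥤ᵖ Cat.{v₂, u₂})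

/-- The canonical coCartesian lift of `f` with source `(A, x)`. -/
def coLift {A B : M} (f : A ⟶ B) (x : P.obj ⟨A⟩) :
    (⟨A, x⟩ : P.Grothendieck) ⟶ ⟨B, (P.map f.toLoc).toFunctor.obj x⟩ :=
  mkHom f (𝟙 _)

variable {P}

lemma mkHom_injective {X Y : P.Grothendieck} {b : X.base ⟶ Y.base}
    {φ ψ : (P.map b.toLoc).toFunctor.obj X.fiber ⟶ Y.fiber} (h : mkHom b φ = mkHom b ψ) :
    φ = ψ := by
  injection h

lemma coLift_vert {A B : M} {f : A ⟶ B} {x : P.obj ⟨A⟩} {y : P.obj ⟨B⟩}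
    (φ : (P.map f.toLoc).toFunctor.obj x ⟶ y) :
    coLift P f x ≫ vert P φ = mkHom (X := ⟨A, x⟩) (Y := ⟨B, y⟩) f φ :=
  (comp_vert _ _).trans (congrArg (Pseudofunctor.Grothendieck.Hom.mk _) (Category.id_comp _))

lemma eq_coLift_vert {X Y : P.Grothendieck} (g : X ⟶ Y) :
    g = coLift P g.base X.fiber ≫ vert P g.fiber :=
  (coLift_vert (f := g.base) g.fiber).symm

lemma vert_coLift {A B : M} (f : A ⟶ B) {x y : P.obj ⟨A⟩} (φ : x ⟶ y) :
    vert P φ ≫ coLift P f y = coLift P f x ≫ vert P ((P.map f.toLoc).toFunctor.map φ) :=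
  (vert_comp _ _).trans (Eq.trans (congrArg (Pseudofunctor.Grothendieck.Hom.mk _)
    (Category.comp_id _)) (coLift_vert _).symm)

lemma vert_injective {A : M} {x y : P.obj ⟨A⟩} {φ ψ : x ⟶ y} (h : vert P φ = vert P ψ) :
    φ = ψ :=
  (cancel_epi ((Cat.Hom.toNatIso (P.mapId ⟨A⟩)).hom.app x)).1 (mkHom_injective h)

lemma exists_vert {A : M} {x y : P.obj ⟨A⟩} (g : (⟨A, x⟩ : P.Grothendieck) ⟶ ⟨A, y⟩)
    (hg : g.base = 𝟙 A) : ∃ φ : x ⟶ y, vert P φ = g := by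
  obtain ⟨b, φ⟩ := g
  obtain rfl : b = 𝟙 A := hg
  refine ⟨(Cat.Hom.toNatIso (P.mapId ⟨A⟩)).inv.app x ≫ φ, ?_⟩
  exact congrArg (Pseudofunctor.Grothendieck.Hom.mk _)
    ((Cat.Hom.toNatIso (P.mapId ⟨A⟩)).hom_inv_id_app_assoc x φ)

lemma coLift_mkHom {A B : M} (f : A ⟶ B) (x : P.obj ⟨A⟩) {Z : P.Grothendieck} (h : B ⟶ Z.base)
    (ψ : (P.map h.toLoc).toFunctor.obj ((P.map f.toLoc).toFunctor.obj x) ⟶ Z.fiber) :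
    coLift P f x ≫ mkHom (X := ⟨B, (P.map f.toLoc).toFunctor.obj x⟩) h ψ =
      mkHom (X := ⟨A, x⟩) (f ≫ h) ((P.mapComp f.toLoc h.toLoc).hom.toNatTrans.app x ≫ ψ) := by
  refine congrArg (Pseudofunctor.Grothendieck.Hom.mk _) (congrArg (_ ≫ ·) ?_)
  exact (congrArg (· ≫ ψ) (CategoryTheory.Functor.map_id _ _)).trans (Category.id_comp _)

lemma exists_coLift_comp {A B : M} (f : A ⟶ B) (x : P.obj ⟨A⟩) {Z : P.Grothendieck}
    (g : (⟨A, x⟩ : P.Grothendieck) ⟶ Z) (h : B ⟶ Z.base) (hg : g.base = f ≫ h) :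
    ∃ g' : (⟨B, (P.map f.toLoc).toFunctor.obj x⟩ : P.Grothendieck) ⟶ Z,
      g'.base = h ∧ coLift P f x ≫ g' = g := by
  obtain ⟨b, φ⟩ := g
  obtain rfl : b = f ≫ h := hg
  refine ⟨mkHom h ((Cat.Hom.toNatIso (P.mapComp f.toLoc h.toLoc)).inv.app x ≫ φ), rfl, ?_⟩
  exact (coLift_mkHom f x h _).trans (congrArg (Pseudofunctor.Grothendieck.Hom.mk _)
    ((Cat.Hom.toNatIso (P.mapComp f.toLoc h.toLoc)).hom_inv_id_app_assoc x φ))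

lemma coLift_cancel {A B : M} {f : A ⟶ B} {x : P.obj ⟨A⟩} {Z : P.Grothendieck}
    {g g' : (⟨B, (P.map f.toLoc).toFunctor.obj x⟩ : P.Grothendieck) ⟶ Z}
    (hb : g.base = g'.base) (h : coLift P f x ≫ g = coLift P f x ≫ g') : g = g' := by
  obtain ⟨b, φ⟩ := g
  obtain ⟨b', φ'⟩ := g'
  obtain rfl : b = b' := hb
  have h' := mkHom_injective ((coLift_mkHom f x b φ).symm.trans (h.trans (coLift_mkHom f x b φ')))
  exact congrArg (Pseudofunctor.Grothendieck.Hom.mk _)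
    ((cancel_epi ((Cat.Hom.toNatIso (P.mapComp f.toLoc b.toLoc)).hom.app x)).1 h')

lemma coLift_vert_cancel {A B : M} {f : A ⟶ B} {x : P.obj ⟨A⟩} {y : P.obj ⟨B⟩}
    {φ φ' : (P.map f.toLoc).toFunctor.obj x ⟶ y}
    (h : coLift P f x ≫ vert P φ = coLift P f x ≫ vert P φ') : φ = φ' :=
  vert_injective (coLift_cancel rfl h)

/-- `IsHomLift` for the projection of the Grothendieck construction. -/
lemma isHomLift_forget {X Y : P.Grothendieck} (g : X ⟶ Y) {f : X.base ⟶ Y.base}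
    (h : g.base = f) : (Pseudofunctor.Grothendieck.forget P).IsHomLift f g := by
  subst h
  exact IsHomLift.map (Pseudofunctor.Grothendieck.forget P) g

lemma base_eq_of_isHomLift {X Y : P.Grothendieck} (g : X ⟶ Y) (f : X.base ⟶ Y.base)
    (h : (Pseudofunctor.Grothendieck.forget P).IsHomLift f g) : g.base = f :=
  (@IsHomLift.eq_of_isHomLift _ _ _ _ (Pseudofunctor.Grothendieck.forget P) _ _ f g h).symm

lemma coLift_isStronglyCocartesian {A B : M} (f : A ⟶ B) (x : P.obj ⟨A⟩) :
    (Pseudofunctor.Grothendieck.forget P).IsStronglyCocartesian f (coLift P f x) where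
  toIsHomLift := isHomLift_forget _ rfl
  universal_property' {Z} g φ' hφ := by
    obtain ⟨g', hb, hg⟩ := exists_coLift_comp f x φ' g (base_eq_of_isHomLift _ _ hφ)
    refine ⟨g', ⟨isHomLift_forget _ hb, hg⟩, ?_⟩
    rintro g'' ⟨hb'', hg''⟩
    exact coLift_cancel ((base_eq_of_isHomLift _ _ hb'').trans hb.symm) (hg''.trans hg.symm)

end TotalMaps

section CartesianLifts
variable {k : FactorizationKind} {M : Type u} [Category.{v} M] (F : Diagram.{v, u} M k)

/-- The canonical Cartesian lift of `f` with target `(B, y)`. -/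
def cartLift {A B : M} (f : A ⟶ B) (y : (F.at' B).cat) :
    (⟨A, (F.pull f).obj y⟩ : F.Total) ⟶ ⟨B, y⟩ :=
  mkHom f ((F.adj f).counit.app y)

variable {F}

lemma vert_cartLift {A B : M} {f : A ⟶ B} {x : (F.at' A).cat} {y : (F.at' B).cat}
    (φ : x ⟶ (F.pull f).obj y) :
    vert F.leftDiagram φ ≫ cartLift F f y =
      mkHom (P := F.leftDiagram) (X := ⟨A, x⟩) (Y := ⟨B, y⟩) f (((F.adj f).homEquiv x y).symm φ) :=
  (vert_comp _ _).trans (congrArg (Pseudofunctor.Grothendieck.Hom.mk _)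
    (Adjunction.homEquiv_counit (F.adj f) x y φ).symm)

lemma eq_vert_cartLift {X Y : F.Total} (g : X ⟶ Y) :
    g = vert F.leftDiagram ((F.adj g.base).homEquiv X.fiber Y.fiber g.fiber) ≫
      cartLift F g.base Y.fiber :=
  ((vert_cartLift _).trans (congrArg (Pseudofunctor.Grothendieck.Hom.mk _)
    (Equiv.symm_apply_apply ..))).symm

lemma cartLift_vert {A B : M} (f : A ⟶ B) {x y : (F.at' B).cat} (φ : x ⟶ y) :
    cartLift F f x ≫ vert F.leftDiagram φ =
      vert F.leftDiagram ((F.pull f).map φ) ≫ cartLift F f y :=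
  (comp_vert _ _).trans (Eq.trans (congrArg (Pseudofunctor.Grothendieck.Hom.mk _)
    ((F.adj f).counit_naturality φ).symm) 
    (vert_comp (P := F.leftDiagram) ((F.pull f).map φ) (cartLift F f y)).symm)

lemma exists_comp_cartLift {A B : M} (f : A ⟶ B) (y : (F.at' B).cat) {Z : F.Total}
    (g : Z ⟶ ⟨B, y⟩) (h : Z.base ⟶ A) (hg : g.base = h ≫ f) :
    ∃ g' : Z ⟶ ⟨A, (F.pull f).obj y⟩, g'.base = h ∧ g' ≫ cartLift F f y = g := by
  obtain ⟨g₁, rfl, rfl⟩ := exists_coLift_comp h Z.fiber g f hg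
  refine ⟨coLift F.leftDiagram h Z.fiber ≫
    vert F.leftDiagram ((F.adj g₁.base).homEquiv _ _ g₁.fiber), Category.comp_id _, ?_⟩
  rw [Category.assoc]
  exact congrArg (_ ≫ ·) (eq_vert_cartLift g₁).symm

lemma cartLift_cancel {A B : M} {f : A ⟶ B} {y : (F.at' B).cat} {Z : F.Total}
    {g g' : Z ⟶ ⟨A, (F.pull f).obj y⟩} (hb : g.base = g'.base)
    (h : g ≫ cartLift F f y = g' ≫ cartLift F f y) : g = g' := by
  obtain ⟨b, φ⟩ := g
  obtain ⟨b', φ'⟩ := g'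
  obtain rfl : b = b' := hb
  refine congrArg (Pseudofunctor.Grothendieck.Hom.mk _) ?_
  have h₁ : coLift F.leftDiagram b Z.fiber ≫ vert F.leftDiagram φ ≫ cartLift F f y =
      coLift F.leftDiagram b Z.fiber ≫ vert F.leftDiagram φ' ≫ cartLift F f y := by
    rw [← Category.assoc, ← Category.assoc]
    exact (congrArg (· ≫ _) (coLift_vert φ)).trans
      (h.trans (congrArg (· ≫ _) (coLift_vert φ')).symm)
  have h₂ := coLift_cancel (P := F.leftDiagram) (f := b) (x := Z.fiber)
    (g := vert F.leftDiagram φ ≫ cartLift F f y) (g' := vert F.leftDiagram φ' ≫ cartLift F f y)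
    rfl h₁
  exact ((F.adj f).homEquiv _ _).symm.injective
    (mkHom_injective ((vert_cartLift φ).symm.trans (h₂.trans (vert_cartLift φ'))))

lemma cartLift_isStronglyCartesian {A B : M} (f : A ⟶ B) (y : (F.at' B).cat) :
    (Pseudofunctor.Grothendieck.forget F.leftDiagram).IsStronglyCartesian f (cartLift F f y) where
  toIsHomLift := isHomLift_forget _ rfl
  universal_property' {Z} g φ' hφ := by
    obtain ⟨g', hb, hg⟩ := exists_comp_cartLift f y φ' g (base_eq_of_isHomLift _ _ hφ)
    refine ⟨g', ⟨isHomLift_forget _ hb, hg⟩, ?_⟩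
    rintro g'' ⟨hb'', hg''⟩
    exact cartLift_cancel ((base_eq_of_isHomLift _ _ hb'').trans hb.symm) (hg''.trans hg.symm)

end CartesianLifts

section BiCleavage
universe v₁ u₁ u'
variable {M : Type u₁} [Category.{v₁} M] {N : Type u} [Category.{v} N]

/-- A cleavage of a biCartesian fibration `π : N ⥤ M`: categories `E A` isomorphic to the fibres,
together with functorially chosen Cartesian and coCartesian lifts. -/
structure BiCleavage (π : N ⥤ M) (E : M → Type u') [∀ A, Category.{v} (E A)] where
  ι (A : M) : E A ⥤ N
  isHomLift_map {A : M} {x y : E A} (φ : x ⟶ y) : π.IsHomLift (𝟙 A) ((ι A).map φ)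
  exists_obj {A : M} (X : N) (hX : π.obj X = A) : ∃ x, (ι A).obj x = X
  exists_map {A : M} {x y : E A} (g : (ι A).obj x ⟶ (ι A).obj y) [π.IsHomLift (𝟙 A) g] :
    ∃ φ, (ι A).map φ = g
  map_injective {A : M} {x y : E A} {φ ψ : x ⟶ y} (h : (ι A).map φ = (ι A).map ψ) : φ = ψ
  push {A B : M} (f : A ⟶ B) : E A ⥤ E B
  pull {A B : M} (f : A ⟶ B) : E B ⥤ E A
  adj {A B : M} (f : A ⟶ B) : push f ⊣ pull f
  co {A B : M} (f : A ⟶ B) (x : E A) : (ι A).obj x ⟶ (ι B).obj ((push f).obj x)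
  cart {A B : M} (f : A ⟶ B) (y : E B) : (ι A).obj ((pull f).obj y) ⟶ (ι B).obj y
  isStronglyCocartesian_co {A B : M} (f : A ⟶ B) (x : E A) : π.IsStronglyCocartesian f (co f x)
  isStronglyCartesian_cart {A B : M} (f : A ⟶ B) (y : E B) : π.IsStronglyCartesian f (cart f y)
  map_co {A B : M} (f : A ⟶ B) {x y : E A} (φ : x ⟶ y) :
    (ι A).map φ ≫ co f y = co f x ≫ (ι B).map ((push f).map φ)
  cart_map {A B : M} (f : A ⟶ B) {x y : E B} (φ : x ⟶ y) :
    cart f x ≫ (ι B).map φ = (ι A).map ((pull f).map φ) ≫ cart f y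
  co_map {A B : M} (f : A ⟶ B) {x : E A} {y : E B} (φ : (push f).obj x ⟶ y) :
    co f x ≫ (ι B).map φ = (ι A).map ((adj f).homEquiv x y φ) ≫ cart f y

lemma isHomLift_unique (π : N ⥤ M) {A B : M} {X Y : N} {f f' : A ⟶ B} (g : X ⟶ Y) (h : π.IsHomLift f g)
    (h' : π.IsHomLift f' g) : f = f' := by
  rw [IsHomLift.fac π f g, IsHomLift.fac π f' g]

lemma exists_retract_maps {X Y X' Y' : N} {f : X ⟶ Y} {g : X' ⟶ Y'} (r : RetractArrow f g) :
    ∃ (i₁ : X ⟶ X') (i₂ : Y ⟶ Y') (r₁ : X' ⟶ X) (r₂ : Y' ⟶ Y), i₁ ≫ g = f ≫ i₂ ∧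
      r₁ ≫ f = g ≫ r₂ ∧ i₁ ≫ r₁ = 𝟙 X ∧ i₂ ≫ r₂ = 𝟙 Y :=
  ⟨r.i.left, r.i.right, r.r.left, r.r.right, r.i.w, r.r.w, r.retract_left, r.retract_right⟩

/-- The lifting and factorization properties of a relative weak factorization system, formulated for
maps lying over given maps of the base. -/
lemma IsRelativeWFS.mk' {π : N ⥤ M} {L R : MorphismProperty N} {L' R' : MorphismProperty M}
    (map_left : L ≤ L'.inverseImage π) (map_right : R ≤ R'.inverseImage π)
    (retract_left : ∀ ⦃X Y X' Y' : N⦄ (f : X ⟶ Y) (g : X' ⟶ Y'), Nonempty (RetractArrow f g) →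
      L g → L' (π.map f) → L f)
    (retract_right : ∀ ⦃X Y X' Y' : N⦄ (f : X ⟶ Y) (g : X' ⟶ Y'), Nonempty (RetractArrow f g) →
      R g → R' (π.map f) → R f)
    (factor : ∀ ⦃A B C : M⦄ (h : A ⟶ C) (g : C ⟶ B) ⦃X Y : N⦄ (φ : X ⟶ Y),
      π.IsHomLift (h ≫ g) φ → π.obj X = A → π.obj Y = B → L' h → R' g →
      ∃ (Z : N) (η : X ⟶ Z) (ψ : Z ⟶ Y), η ≫ ψ = φ ∧ L η ∧ R ψ ∧
        π.IsHomLift h η ∧ π.IsHomLift g ψ)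
    (lift : ∀ ⦃A B C D : M⦄ (i : A ⟶ B) (p : C ⟶ D) (u : B ⟶ C) ⦃X Y Z W : N⦄ (a : X ⟶ Z)
      (ψ : X ⟶ Y) (η : Z ⟶ W) (b : Y ⟶ W), π.IsHomLift i ψ → π.IsHomLift p η →
      π.IsHomLift (i ≫ u) a → π.IsHomLift (u ≫ p) b → L ψ → R η → a ≫ η = ψ ≫ b →
      ∃ γ : Y ⟶ Z, ψ ≫ γ = a ∧ γ ≫ η = b ∧ π.IsHomLift u γ) :
    IsRelativeWFS π L R L' R' where
  map_left := map_left
  map_right := map_right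
  retract_left := retract_left
  retract_right := retract_right
  factor X Y φ C h g hgh hh hg := factor h g φ (by rw [hgh]; infer_instance) rfl rfl hh hg
  lift X Y Z W a ψ η b hψ hη sq u hu₁ hu₂ := by
    obtain ⟨γ, h₁, h₂, h₃⟩ := lift (π.map ψ) (π.map η) u a ψ η b inferInstance inferInstance
      (by rw [hu₁]; infer_instance) (by rw [hu₂]; infer_instance) hψ hη sq
    exact ⟨γ, h₁, h₂, (IsHomLift.eq_of_isHomLift π u γ).symm⟩

namespace BiCleavage

attribute [instance] isHomLift_map isStronglyCocartesian_co isStronglyCartesian_cart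

variable {π : N ⥤ M} {E : M → Type u'} [∀ A, Category.{v} (E A)] (c : BiCleavage π E)

lemma obj_ι {A : M} (x : E A) : π.obj ((c.ι A).obj x) = A :=
  IsHomLift.domain_eq π (𝟙 A) ((c.ι A).map (𝟙 x))

lemma exists_eq (X : N) : ∃ (A : M) (x : E A), (c.ι A).obj x = X :=
  ⟨_, c.exists_obj X rfl⟩

lemma map_cart {A B : M} (f : A ⟶ B) {x : E A} {y : E B} (φ : x ⟶ (c.pull f).obj y) :
    (c.ι A).map φ ≫ c.cart f y = c.co f x ≫ (c.ι B).map (((c.adj f).homEquiv x y).symm φ) := by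
  rw [co_map, Equiv.apply_symm_apply]

lemma exists_co {A B C : M} (f : A ⟶ B) (u : B ⟶ C) {x : E A} {Z : N}
    (g : (c.ι A).obj x ⟶ Z) [π.IsHomLift (f ≫ u) g] :
    ∃ g' : (c.ι B).obj ((c.push f).obj x) ⟶ Z, π.IsHomLift u g' ∧ c.co f x ≫ g' = g :=
  ⟨_, Functor.IsStronglyCocartesian.map_isHomLift π f (c.co f x) rfl g,
    Functor.IsStronglyCocartesian.fac π f (c.co f x) rfl g⟩

lemma exists_cart {A B C : M} (f : A ⟶ B) (u : C ⟶ A) {y : E B} {Z : N}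
    (g : Z ⟶ (c.ι B).obj y) [π.IsHomLift (u ≫ f) g] :
    ∃ g' : Z ⟶ (c.ι A).obj ((c.pull f).obj y), π.IsHomLift u g' ∧ g' ≫ c.cart f y = g :=
  ⟨_, Functor.IsStronglyCartesian.map_isHomLift π f (c.cart f y) rfl g,
    Functor.IsStronglyCartesian.fac π f (c.cart f y) rfl g⟩

lemma co_cancel {A B C : M} {f : A ⟶ B} (u : B ⟶ C) {x : E A} {Z : N}
    {g g' : (c.ι B).obj ((c.push f).obj x) ⟶ Z} [π.IsHomLift u g] [π.IsHomLift u g']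
    (h : c.co f x ≫ g = c.co f x ≫ g') : g = g' :=
  Functor.IsStronglyCocartesian.ext π f (c.co f x) u h

lemma cart_cancel {A B C : M} {f : A ⟶ B} (u : C ⟶ A) {y : E B} {Z : N}
    {g g' : Z ⟶ (c.ι A).obj ((c.pull f).obj y)} [π.IsHomLift u g] [π.IsHomLift u g']
    (h : g ≫ c.cart f y = g' ≫ c.cart f y) : g = g' :=
  Functor.IsStronglyCartesian.ext π f (c.cart f y) u h

lemma co_map_cancel {A B : M} {f : A ⟶ B} {x : E A} {y : E B} {φ ψ : (c.push f).obj x ⟶ y}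
    (h : c.co f x ≫ (c.ι B).map φ = c.co f x ≫ (c.ι B).map ψ) : φ = ψ :=
  c.map_injective (c.co_cancel (𝟙 B) h)

lemma map_cart_cancel {A B : M} {f : A ⟶ B} {x : E A} {y : E B} {φ ψ : x ⟶ (c.pull f).obj y}
    (h : (c.ι A).map φ ≫ c.cart f y = (c.ι A).map ψ ≫ c.cart f y) : φ = ψ :=
  c.map_injective (c.cart_cancel (𝟙 A) h)

lemma exists_co_map {A B : M} (f : A ⟶ B) {x : E A} {y : E B}
    (g : (c.ι A).obj x ⟶ (c.ι B).obj y) [π.IsHomLift f g] :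
    ∃ φ, c.co f x ≫ (c.ι B).map φ = g := by
  obtain ⟨g', hg', rfl⟩ := c.exists_co f (𝟙 B) g
  obtain ⟨φ, rfl⟩ := c.exists_map g'
  exact ⟨φ, rfl⟩

lemma exists_map_cart {A B : M} (f : A ⟶ B) {x : E A} {y : E B}
    (g : (c.ι A).obj x ⟶ (c.ι B).obj y) [π.IsHomLift f g] :
    ∃ φ, (c.ι A).map φ ≫ c.cart f y = g := by
  obtain ⟨g', hg', rfl⟩ := c.exists_cart f (𝟙 A) g
  obtain ⟨φ, rfl⟩ := c.exists_map g'
  exact ⟨φ, rfl⟩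

lemma exists_isHomLift {A B : M} {x : E A} {y : E B} (g : (c.ι A).obj x ⟶ (c.ι B).obj y) :
    ∃ f : A ⟶ B, π.IsHomLift f g :=
  ⟨eqToHom (c.obj_ι x).symm ≫ π.map g ≫ eqToHom (c.obj_ι y), inferInstance⟩

/-- The lifting problem of `ψ` against a map in a fibre, over a given map `u` of the base. -/
lemma exists_lift_map {A B C : M} {i : A ⟶ B} (u : B ⟶ C) {x : E A} {y : E B} {z w : E C}
    (φ : (c.push i).obj x ⟶ y) (p : z ⟶ w) (hl : HasLiftingProperty φ ((c.pull u).map p))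
    (a : (c.ι A).obj x ⟶ (c.ι C).obj z) (b : (c.ι B).obj y ⟶ (c.ι C).obj w)
    [π.IsHomLift (i ≫ u) a] [π.IsHomLift u b]
    (sq : a ≫ (c.ι C).map p = (c.co i x ≫ (c.ι B).map φ) ≫ b) :
    ∃ γ : (c.ι B).obj y ⟶ (c.ι C).obj z, π.IsHomLift u γ ∧
      (c.co i x ≫ (c.ι B).map φ) ≫ γ = a ∧ γ ≫ (c.ι C).map p = b := by
  obtain ⟨a₁, _, rfl⟩ := c.exists_co i u a
  obtain ⟨a₂, rfl⟩ := c.exists_map_cart u a₁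
  obtain ⟨b₂, rfl⟩ := c.exists_map_cart u b
  have sq' : CommSq a₂ φ ((c.pull u).map p) b₂ := by
    constructor
    apply c.map_cart_cancel (f := u)
    apply c.co_cancel u
    simp only [Functor.map_comp, Category.assoc] at sq ⊢
    rw [← c.cart_map, sq]
  refine ⟨(c.ι B).map sq'.lift ≫ c.cart u z, inferInstance, ?_, ?_⟩
  · rw [Category.assoc, ← Functor.map_comp_assoc, sq'.fac_left]
  · rw [Category.assoc, c.cart_map, ← Functor.map_comp_assoc, sq'.fac_right]

lemma exists_lift {A B C D : M} {i : A ⟶ B} {p : C ⟶ D} (u : B ⟶ C) {x : E A} {y : E B} {z : E C}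
    {w : E D} (φ : (c.push i).obj x ⟶ y) (ψ : z ⟶ (c.pull p).obj w)
    (hl : HasLiftingProperty φ ((c.pull u).map ψ))
    (a : (c.ι A).obj x ⟶ (c.ι C).obj z) (b : (c.ι B).obj y ⟶ (c.ι D).obj w)
    [π.IsHomLift (i ≫ u) a] [π.IsHomLift (u ≫ p) b]
    (sq : a ≫ (c.ι C).map ψ ≫ c.cart p w = (c.co i x ≫ (c.ι B).map φ) ≫ b) :
    ∃ γ : (c.ι B).obj y ⟶ (c.ι C).obj z, π.IsHomLift u γ ∧
      (c.co i x ≫ (c.ι B).map φ) ≫ γ = a ∧ γ ≫ (c.ι C).map ψ ≫ c.cart p w = b := by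
  obtain ⟨b₁, _, rfl⟩ := c.exists_cart p u b
  obtain ⟨γ, h₁, h₂, h₃⟩ := c.exists_lift_map u φ ψ hl a b₁ (by
    apply c.cart_cancel (i ≫ u)
    simpa using sq)
  exact ⟨γ, h₁, h₂, by rw [← h₃, Category.assoc]⟩

/-- `L` consists of the maps lying over `L'` whose pushforward to a fibre is in `Lf`. -/
def IsLeftClass (L : MorphismProperty N) (L' : MorphismProperty M)
    (Lf : ∀ A, MorphismProperty (E A)) : Prop :=
  ∀ ⦃A B : M⦄ (f : A ⟶ B) ⦃x : E A⦄ ⦃y : E B⦄ (φ : (c.push f).obj x ⟶ y),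
    L (c.co f x ≫ (c.ι B).map φ) ↔ L' f ∧ Lf B φ

/-- `R` consists of the maps lying over `R'` whose pullback to a fibre is in `Rf`. -/
def IsRightClass (R : MorphismProperty N) (R' : MorphismProperty M)
    (Rf : ∀ A, MorphismProperty (E A)) : Prop :=
  ∀ ⦃A B : M⦄ (f : A ⟶ B) ⦃x : E A⦄ ⦃y : E B⦄ (φ : x ⟶ (c.pull f).obj y),
    R ((c.ι A).map φ ≫ c.cart f y) ↔ R' f ∧ Rf A φ

end BiCleavage

lemma mem_map_iff_of_isHomLift {π : N ⥤ M} (P : MorphismProperty M) {A B : M} (f : A ⟶ B)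
    {X Y : N} (g : X ⟶ Y) [h : π.IsHomLift f g] : P (π.map g) ↔ P f := by
  cases h; rfl

/-- The weak factorization system relative to the base determined by weak factorization systems on
the fibres. -/
lemma BiCleavage.isRelativeWFS {π : N ⥤ M} {E : M → Type u'} [∀ A, Category.{v} (E A)]
    (c : BiCleavage π E) {L R : MorphismProperty N} {L' R' : MorphismProperty M}
    {Lf Rf : ∀ A, MorphismProperty (E A)}
    (hL : c.IsLeftClass L L' Lf) (hR : c.IsRightClass R R' Rf)
    (lift : ∀ (A : M) ⦃x y z w : E A⦄ (i : x ⟶ y) (p : z ⟶ w), Lf A i → Rf A p →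
      HasLiftingProperty i p)
    (fac : ∀ (A : M) ⦃x y : E A⦄ (f : x ⟶ y), ∃ (z : E A) (i : x ⟶ z)
      (p : z ⟶ y), i ≫ p = f ∧ Lf A i ∧ Rf A p)
    (left_of_lift : ∀ (A : M) ⦃x y : E A⦄ (f : x ⟶ y),
      (∀ ⦃z w : E A⦄ (p : z ⟶ w), Rf A p → HasLiftingProperty f p) → Lf A f)
    (right_of_lift : ∀ (A : M) ⦃x y : E A⦄ (f : x ⟶ y),
      (∀ ⦃z w : E A⦄ (i : z ⟶ w), Lf A i → HasLiftingProperty i f) → Rf A f)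
    (pull : ∀ ⦃A B : M⦄ (f : A ⟶ B) ⦃x y : E B⦄ (p : x ⟶ y), Rf B p →
      Rf A ((c.pull f).map p)) :
    IsRelativeWFS π L R L' R' := by
  refine IsRelativeWFS.mk' ?_ ?_ ?_ ?_ ?_ ?_
  · intro X Y g hg
    obtain ⟨A, x, rfl⟩ := c.exists_eq X
    obtain ⟨B, y, rfl⟩ := c.exists_eq Y
    obtain ⟨f, _⟩ := c.exists_isHomLift g
    obtain ⟨φ, rfl⟩ := c.exists_co_map f g
    exact (mem_map_iff_of_isHomLift _ f _).2 ((hL f φ).1 hg).1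
  · intro X Y g hg
    obtain ⟨A, x, rfl⟩ := c.exists_eq X
    obtain ⟨B, y, rfl⟩ := c.exists_eq Y
    obtain ⟨f, _⟩ := c.exists_isHomLift g
    obtain ⟨φ, rfl⟩ := c.exists_map_cart f g
    exact (mem_map_iff_of_isHomLift _ f _).2 ((hR f φ).1 hg).1
  · intro X Y X' Y' g g' hr hg' hg
    obtain ⟨r⟩ := hr
    obtain ⟨A, x, rfl⟩ := c.exists_eq X
    obtain ⟨B, y, rfl⟩ := c.exists_eq Y
    obtain ⟨A', x', rfl⟩ := c.exists_eq X'
    obtain ⟨B', y', rfl⟩ := c.exists_eq Y'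
    obtain ⟨i₁, i₂, r₁, r₂, hiw, hrw, hrl, hrr⟩ := exists_retract_maps r
    obtain ⟨f, _⟩ := c.exists_isHomLift g
    obtain ⟨φ, rfl⟩ := c.exists_co_map f g
    obtain ⟨f', _⟩ := c.exists_isHomLift g'
    obtain ⟨φ', rfl⟩ := c.exists_co_map f' g'
    refine (hL f φ).2 ⟨(mem_map_iff_of_isHomLift _ f _).1 hg,
      left_of_lift _ _ fun z w p hp => ⟨fun {s t} sq => ?_⟩⟩
    obtain ⟨ρ, _⟩ := c.exists_isHomLift r₂
    obtain ⟨σ, _⟩ := c.exists_isHomLift i₂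
    have hσρ : σ ≫ ρ = 𝟙 B := isHomLift_unique π (i₂ ≫ r₂) inferInstance (by
      rw [hrr]; exact IsHomLift.id (c.obj_ι y))
    have : π.IsHomLift (f' ≫ ρ) (r₁ ≫ c.co f x ≫ (c.ι B).map s) := by
      obtain ⟨ρ', _⟩ := c.exists_isHomLift r₁
      have : ρ' ≫ f = f' ≫ ρ :=
        isHomLift_unique π (r₁ ≫ c.co f x ≫ (c.ι B).map φ) inferInstance
          (by rw [hrw]; infer_instance)
      rw [← this]; infer_instance
    obtain ⟨γ, _, h₂, h₃⟩ := c.exists_lift_map ρ φ' p (lift _ _ _ ((hL f' φ').1 hg').2 (pull _ _ hp))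
      (r₁ ≫ c.co f x ≫ (c.ι B).map s) (r₂ ≫ (c.ι B).map t) (by
        simp only [← reassoc_of% hrw, Category.assoc, ← Functor.map_comp, sq.w])
    have : π.IsHomLift (𝟙 B) (i₂ ≫ γ) := by rw [← hσρ]; infer_instance
    obtain ⟨l, hl⟩ := c.exists_map (i₂ ≫ γ)
    refine ⟨⟨{ l := l, fac_left := ?_, fac_right := ?_ }⟩⟩
    · apply c.co_map_cancel
      rw [Functor.map_comp, hl, ← Category.assoc, ← Category.assoc, ← hiw, Category.assoc, h₂,
        reassoc_of% hrl]
    · apply c.map_injective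
      rw [Functor.map_comp, hl, Category.assoc, h₃, reassoc_of% hrr]
  · intro X Y X' Y' g g' hr hg' hg
    obtain ⟨r⟩ := hr
    obtain ⟨A, x, rfl⟩ := c.exists_eq X
    obtain ⟨B, y, rfl⟩ := c.exists_eq Y
    obtain ⟨A', x', rfl⟩ := c.exists_eq X'
    obtain ⟨B', y', rfl⟩ := c.exists_eq Y'
    obtain ⟨i₁, i₂, r₁, r₂, hiw, hrw, hrl, hrr⟩ := exists_retract_maps r
    obtain ⟨f, _⟩ := c.exists_isHomLift g
    obtain ⟨φ, rfl⟩ := c.exists_map_cart f g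
    obtain ⟨f', _⟩ := c.exists_isHomLift g'
    obtain ⟨φ', rfl⟩ := c.exists_map_cart f' g'
    refine (hR f φ).2 ⟨(mem_map_iff_of_isHomLift _ f _).1 hg,
      right_of_lift _ _ fun z w i hi => ⟨fun {s t} sq => ?_⟩⟩
    obtain ⟨ρ, _⟩ := c.exists_isHomLift r₁
    obtain ⟨σ, _⟩ := c.exists_isHomLift i₁
    have hσρ : σ ≫ ρ = 𝟙 A := isHomLift_unique π (i₁ ≫ r₁) inferInstance (by
      rw [hrl]; exact IsHomLift.id (c.obj_ι x))
    have : π.IsHomLift (σ ≫ f') (((c.ι A).map t ≫ c.cart f y) ≫ i₂) := by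
      obtain ⟨σ', _⟩ := c.exists_isHomLift i₂
      have : f ≫ σ' = σ ≫ f' :=
        isHomLift_unique π (((c.ι A).map φ ≫ c.cart f y) ≫ i₂) inferInstance
          (by rw [← hiw]; infer_instance)
      rw [← this]; infer_instance
    let e : (c.push (𝟙 A)).obj z ⟶ w := ((c.adj (𝟙 A)).homEquiv _ _).symm
      (Classical.choose (c.exists_map_cart (𝟙 A) ((c.ι A).map i)))
    have he : c.co (𝟙 A) z ≫ (c.ι A).map e = (c.ι A).map i := by
      rw [← c.map_cart]
      exact Classical.choose_spec (c.exists_map_cart (𝟙 A) ((c.ι A).map i))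
    have hle : Lf A e := by
      refine left_of_lift _ _ fun z' w' p hp => ⟨fun {s t} sq => ?_⟩
      have := lift _ i p hi hp
      obtain ⟨s', hs'⟩ := c.exists_map (c.co (𝟙 A) z ≫ (c.ι A).map s)
      have sq' : CommSq s' i p t := ⟨c.map_injective (by
        rw [Functor.map_comp, hs', Category.assoc, ← Functor.map_comp, sq.w, Functor.map_comp,
          Functor.map_comp, reassoc_of% he])⟩
      refine ⟨⟨{ l := sq'.lift, fac_left := ?_, fac_right := sq'.fac_right }⟩⟩
      apply c.co_map_cancel
      rw [Functor.map_comp, reassoc_of% he, ← Functor.map_comp, sq'.fac_left, hs']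
    obtain ⟨γ, _, h₂, h₃⟩ := c.exists_lift (i := 𝟙 A) σ e φ'
      (lift _ _ _ hle (pull _ _ ((hR f' φ').1 hg').2))
      ((c.ι A).map s ≫ i₁) (((c.ι A).map t ≫ c.cart f y) ≫ i₂) (by
        rw [he, Category.assoc, hiw]
        simp only [Category.assoc, ← Functor.map_comp_assoc, sq.w])
    have : π.IsHomLift (𝟙 A) (γ ≫ r₁) := by rw [← hσρ]; infer_instance
    obtain ⟨l, hl⟩ := c.exists_map (γ ≫ r₁)
    refine ⟨⟨{ l := l, fac_left := ?_, fac_right := ?_ }⟩⟩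
    · apply c.map_injective
      rw [he] at h₂
      rw [Functor.map_comp, hl, reassoc_of% h₂, hrl, Category.comp_id]
    · apply c.map_cart_cancel
      rw [Functor.map_comp, hl, Category.assoc, Category.assoc, hrw, ← Category.assoc, h₃, Category.assoc, hrr,
        Category.comp_id]
  · intro A B C f₁ f₂ X Y g _ hX hY h₁ h₂
    obtain ⟨x, rfl⟩ := c.exists_obj X hX
    obtain ⟨y, rfl⟩ := c.exists_obj Y hY
    obtain ⟨g', _, rfl⟩ := c.exists_co f₁ f₂ g
    obtain ⟨φ, rfl⟩ := c.exists_map_cart f₂ g'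
    obtain ⟨z, i, p, rfl, hi, hp⟩ := fac C φ
    refine ⟨(c.ι C).obj z, c.co f₁ x ≫ (c.ι C).map i, (c.ι C).map p ≫ c.cart f₂ y, ?_,
      (hL _ _).2 ⟨h₁, hi⟩, (hR _ _).2 ⟨h₂, hp⟩, inferInstance, inferInstance⟩
    simp
  · intro A B C D i p u X Y Z W a ψ η b _ _ _ _ hψ hη sq
    obtain ⟨x, rfl⟩ := c.exists_obj X (IsHomLift.domain_eq π i ψ)
    obtain ⟨y, rfl⟩ := c.exists_obj Y (IsHomLift.codomain_eq π i ψ)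
    obtain ⟨z, rfl⟩ := c.exists_obj Z (IsHomLift.domain_eq π p η)
    obtain ⟨w, rfl⟩ := c.exists_obj W (IsHomLift.codomain_eq π p η)
    obtain ⟨φ, rfl⟩ := c.exists_co_map i ψ
    obtain ⟨φ', rfl⟩ := c.exists_map_cart p η
    obtain ⟨γ, h₁, h₂, h₃⟩ := c.exists_lift u φ φ'
      (lift _ _ _ ((hL i φ).1 hψ).2 (pull _ _ ((hR p φ').1 hη).2)) a b sq
    exact ⟨γ, h₂, h₃, h₁⟩

end BiCleavage

namespace BiCleavage

universe v₁ u₁ u'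
variable {M : Type u₁} [Category.{v₁} M] {N : Type u} [Category.{v} N]
  {π : N ⥤ M} {E : M → Type u'} [∀ A, Category.{v} (E A)] (c : BiCleavage π E)

/-- The comparison functor from `E A` to the fibre of `π` over `A`. -/
def toFiber (A : M) : E A ⥤ π.Fiber A where
  obj x := ⟨(c.ι A).obj x, c.obj_ι x⟩
  map φ := ⟨(c.ι A).map φ, inferInstance⟩
  map_id x := Functor.Fiber.hom_ext ((c.ι A).map_id x)
  map_comp φ ψ := Functor.Fiber.hom_ext ((c.ι A).map_comp φ ψ)

instance (A : M) : (c.toFiber A).Faithful where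
  map_injective h := c.map_injective (congrArg Subtype.val h)

instance (A : M) : (c.toFiber A).Full where
  map_surjective {x y} g := by
    let g' : (c.ι A).obj x ⟶ (c.ι A).obj y := g.1
    have : π.IsHomLift (𝟙 A) g' := g.2
    obtain ⟨φ, hφ⟩ := c.exists_map g'
    exact ⟨φ, Subtype.ext hφ⟩

instance (A : M) : (c.toFiber A).EssSurj where
  mem_essImage Y := by
    obtain ⟨x, hx⟩ := c.exists_obj Y.1 Y.2
    exact ⟨x, ⟨eqToIso (Subtype.ext hx)⟩⟩

instance (A : M) : (c.toFiber A).IsEquivalence where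

section Bicomplete
open Limits

lemma exists_terminal_cone (c : BiCleavage π E) {J : Type v} [Category.{v} J] (δ : J ⥤ N) (A : M)
    [HasLimits (E A)] (τ : ∀ j, A ⟶ π.obj (δ.obj j))
    (hτ : ∀ {i j : J} (f : i ⟶ j), τ i ≫ π.map (δ.map f) = τ j) :
    ∃ s : Cone δ, (π.obj s.pt = A ∧ ∀ j, π.IsHomLift (τ j) (s.π.app j)) ∧
      ∀ s' : Cone δ, (π.obj s'.pt = A ∧ ∀ j, π.IsHomLift (τ j) (s'.π.app j)) →
        ∃! m : s'.pt ⟶ s.pt, π.IsHomLift (𝟙 A) m ∧ ∀ j, m ≫ s.π.app j = s'.π.app j := by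
  choose z hz using fun j => c.exists_obj (δ.obj j) rfl
  obtain ⟨κ, hκ'⟩ : ∃ κ : ∀ j, (c.ι A).obj ((c.pull (τ j)).obj (z j)) ⟶ δ.obj j,
      ∀ j, κ j = c.cart (τ j) (z j) ≫ eqToHom (hz j) := ⟨_, fun _ => rfl⟩
  have hκ (j : J) : π.IsStronglyCartesian (τ j) (κ j) := by
    have : π.IsHomLift (𝟙 (π.obj (δ.obj j))) (eqToIso (hz j)).hom :=
      IsHomLift.eqToHom_codomain_lift_id (hz j) rfl
    have := Functor.IsStronglyCartesian.of_iso π (𝟙 (π.obj (δ.obj j))) (eqToIso (hz j))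
    have h : π.IsStronglyCartesian (τ j ≫ 𝟙 (π.obj (δ.obj j)))
        (c.cart (τ j) (z j) ≫ (eqToIso (hz j)).hom) := inferInstance
    rw [Category.comp_id] at h
    rw [hκ' j]
    exact h
  have hδ {i j : J} (f : i ⟶ j) : π.IsHomLift (𝟙 A ≫ τ j) (κ i ≫ δ.map f) := by
    rw [Category.id_comp, ← hτ f]; infer_instance
  have hex {i j : J} (f : i ⟶ j) : ∃ g : (c.pull (τ i)).obj (z i) ⟶
      (c.pull (τ j)).obj (z j), (c.ι A).map g ≫ κ j = κ i ≫ δ.map f := by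
    have := hδ f
    obtain ⟨g, hg⟩ := c.exists_map
      (Functor.IsStronglyCartesian.map π (τ j) (κ j) (g := 𝟙 _) rfl (κ i ≫ δ.map f))
    exact ⟨g, by rw [hg]; exact Functor.IsStronglyCartesian.fac π _ (κ j) rfl _⟩
  choose d hd using @hex
  have cancel {x : E A} {j : J} {g g' : x ⟶ (c.pull (τ j)).obj (z j)}
      (h : (c.ι A).map g ≫ κ j = (c.ι A).map g' ≫ κ j) : g = g' :=
    c.map_injective (Functor.IsStronglyCartesian.ext π (τ j) (κ j) (𝟙 _) h)
  let D : J ⥤ E A :=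
    { obj := fun j => (c.pull (τ j)).obj (z j)
      map := fun f => d f
      map_id := fun j => cancel (by simp [hd])
      map_comp := fun f g => cancel (by
        rw [hd, Functor.map_comp, Functor.map_comp, Category.assoc, hd, reassoc_of% hd]) }
  let s : Cone δ :=
    { pt := (c.ι A).obj (limit D)
      π :=
        { app := fun j => (c.ι A).map (limit.π D j) ≫ κ j
          naturality := fun i j f => by
            dsimp
            rw [Category.id_comp, Category.assoc, ← hd, ← Functor.map_comp_assoc]
            congr 2
            exact (limit.w D f).symm } }
  have hs (j : J) : s.π.app j = (c.ι A).map (limit.π D j) ≫ κ j := rfl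
  refine ⟨s, ⟨c.obj_ι _, fun j => by rw [hs]; infer_instance⟩, fun s' hs' => ?_⟩
  obtain ⟨y, hy⟩ := c.exists_obj s'.pt hs'.1
  have hex' (j : J) : ∃ g : y ⟶ D.obj j, (c.ι A).map g ≫ κ j = eqToHom hy ≫ s'.π.app j := by
    have := hs'.2 j
    have : π.IsHomLift (𝟙 A ≫ τ j) (eqToHom hy ≫ s'.π.app j) := inferInstance
    obtain ⟨g, hg⟩ := c.exists_map
      (Functor.IsStronglyCartesian.map π (τ j) (κ j) (g := 𝟙 _) rfl
        (eqToHom hy ≫ s'.π.app j))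
    exact ⟨g, by rw [hg]; exact Functor.IsStronglyCartesian.fac π _ (κ j) rfl _⟩
  choose e he using hex'
  let m : y ⟶ limit D := limit.lift D
    { pt := y
      π :=
        { app := e
          naturality := fun i j f => by
            dsimp
            rw [Category.id_comp]
            apply cancel
            have : (c.ι A).map (D.map f) ≫ κ j = κ i ≫ δ.map f := hd f
            rw [he, Functor.map_comp, Category.assoc, this, reassoc_of% he, s'.w] } }
  have hm (j : J) : m ≫ limit.π D j = e j := limit.lift_π _ _
  refine ⟨eqToHom hy.symm ≫ (c.ι A).map m, ⟨inferInstance, fun j => ?_⟩, ?_⟩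
  · rw [hs, Category.assoc, ← Functor.map_comp_assoc, hm, he, eqToHom_trans_assoc, eqToHom_refl,
      Category.id_comp]
  · rintro m' ⟨_, hm'⟩
    obtain ⟨m'', hm''⟩ := c.exists_map (eqToHom hy ≫ m')
    have : m'' = m := by
      apply limit.hom_ext
      intro j
      apply cancel
      rw [hm, he, Functor.map_comp, hm'', Category.assoc, Category.assoc, ← hs, hm']
    rw [← this, hm'', eqToHom_trans_assoc, eqToHom_refl, Category.id_comp]

lemma exists_initial_cocone (c : BiCleavage π E) {J : Type v} [Category.{v} J] (δ : J ⥤ N) (A : M)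
    [HasColimits (E A)] (τ : ∀ j, π.obj (δ.obj j) ⟶ A)
    (hτ : ∀ {i j : J} (f : i ⟶ j), π.map (δ.map f) ≫ τ j = τ i) :
    ∃ s : Cocone δ, (π.obj s.pt = A ∧ ∀ j, π.IsHomLift (τ j) (s.ι.app j)) ∧
      ∀ s' : Cocone δ, (π.obj s'.pt = A ∧ ∀ j, π.IsHomLift (τ j) (s'.ι.app j)) →
        ∃! m : s.pt ⟶ s'.pt, π.IsHomLift (𝟙 A) m ∧ ∀ j, s.ι.app j ≫ m = s'.ι.app j := by
  choose z hz using fun j => c.exists_obj (δ.obj j) rfl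
  obtain ⟨κ, hκ'⟩ : ∃ κ : ∀ j, δ.obj j ⟶ (c.ι A).obj ((c.push (τ j)).obj (z j)),
      ∀ j, κ j = eqToHom (hz j).symm ≫ c.co (τ j) (z j) := ⟨_, fun _ => rfl⟩
  have hκ (j : J) : π.IsStronglyCocartesian (τ j) (κ j) := by
    have : π.IsHomLift (𝟙 (π.obj (δ.obj j))) (eqToIso (hz j).symm).hom :=
      IsHomLift.eqToHom_domain_lift_id (hz j).symm rfl
    have := Functor.IsStronglyCocartesian.of_iso π (𝟙 (π.obj (δ.obj j))) (eqToIso (hz j).symm)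
    have h : π.IsStronglyCocartesian (𝟙 (π.obj (δ.obj j)) ≫ τ j)
        ((eqToIso (hz j).symm).hom ≫ c.co (τ j) (z j)) := inferInstance
    rw [Category.id_comp] at h
    rw [hκ' j]
    exact h
  have hδ {i j : J} (f : i ⟶ j) : π.IsHomLift (τ i ≫ 𝟙 A) (δ.map f ≫ κ j) := by
    rw [Category.comp_id, ← hτ f]; infer_instance
  have hex {i j : J} (f : i ⟶ j) : ∃ g : (c.push (τ i)).obj (z i) ⟶
      (c.push (τ j)).obj (z j), κ i ≫ (c.ι A).map g = δ.map f ≫ κ j := by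
    have := hδ f
    obtain ⟨g, hg⟩ := c.exists_map
      (Functor.IsStronglyCocartesian.map π (τ i) (κ i) (g := 𝟙 _) rfl (δ.map f ≫ κ j))
    exact ⟨g, by rw [hg]; exact Functor.IsStronglyCocartesian.fac π _ (κ i) rfl _⟩
  choose d hd using @hex
  have cancel {x : E A} {j : J} {g g' : (c.push (τ j)).obj (z j) ⟶ x}
      (h : κ j ≫ (c.ι A).map g = κ j ≫ (c.ι A).map g') : g = g' :=
    c.map_injective (Functor.IsStronglyCocartesian.ext π (τ j) (κ j) (𝟙 _) h)
  let D : J ⥤ E A :=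
    { obj := fun j => (c.push (τ j)).obj (z j)
      map := fun f => d f
      map_id := fun j => cancel (by simp [hd])
      map_comp := fun f g => cancel (by
        rw [hd, Functor.map_comp, Functor.map_comp, reassoc_of% hd, hd, Category.assoc]) }
  let s : Cocone δ :=
    { pt := (c.ι A).obj (colimit D)
      ι :=
        { app := fun j => κ j ≫ (c.ι A).map (colimit.ι D j)
          naturality := fun i j f => by
            dsimp
            rw [Category.comp_id, ← reassoc_of% hd, ← Functor.map_comp]
            congr 2
            exact colimit.w D f } }
  have hs (j : J) : s.ι.app j = κ j ≫ (c.ι A).map (colimit.ι D j) := rfl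
  refine ⟨s, ⟨c.obj_ι _, fun j => by rw [hs]; infer_instance⟩, fun s' hs' => ?_⟩
  obtain ⟨y, hy⟩ := c.exists_obj s'.pt hs'.1
  have hex' (j : J) : ∃ g : D.obj j ⟶ y,
      κ j ≫ (c.ι A).map g = s'.ι.app j ≫ eqToHom hy.symm := by
    have := hs'.2 j
    have : π.IsHomLift (τ j ≫ 𝟙 A) (s'.ι.app j ≫ eqToHom hy.symm) := inferInstance
    obtain ⟨g, hg⟩ := c.exists_map
      (Functor.IsStronglyCocartesian.map π (τ j) (κ j) (g := 𝟙 _) rfl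
        (s'.ι.app j ≫ eqToHom hy.symm))
    exact ⟨g, by rw [hg]; exact Functor.IsStronglyCocartesian.fac π _ (κ j) rfl _⟩
  choose e he using hex'
  let m : colimit D ⟶ y := colimit.desc D
    { pt := y
      ι :=
        { app := e
          naturality := fun i j f => by
            dsimp
            rw [Category.comp_id]
            apply cancel
            have : κ i ≫ (c.ι A).map (D.map f) = δ.map f ≫ κ j := hd f
            rw [he, Functor.map_comp, reassoc_of% this, he, s'.w_assoc] } }
  have hm (j : J) : colimit.ι D j ≫ m = e j := colimit.ι_desc _ _
  refine ⟨(c.ι A).map m ≫ eqToHom hy, ⟨inferInstance, fun j => ?_⟩, ?_⟩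
  · rw [hs, Category.assoc, ← Functor.map_comp_assoc, hm, reassoc_of% he, eqToHom_trans,
      eqToHom_refl, Category.comp_id]
  · rintro m' ⟨_, hm'⟩
    obtain ⟨m'', hm''⟩ := c.exists_map (m' ≫ eqToHom hy.symm)
    have : m'' = m := by
      apply colimit.hom_ext
      intro j
      apply cancel
      rw [hm, he, Functor.map_comp, hm'', ← Category.assoc, ← Category.assoc, ← hs, hm']
    rw [← this, hm'', Category.assoc, eqToHom_trans, eqToHom_refl, Category.comp_id]


/-- A biCartesian fibration with complete and cocomplete fibres is bicomplete. -/
lemma isBicomplete (c : BiCleavage π E) (hl : ∀ A, HasLimits (E A)) (hc : ∀ A, HasColimits (E A)) :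
    IsBicomplete π where
  limits J _ δ t := by
    have := hl t.pt
    obtain ⟨s, hs, h⟩ := c.exists_terminal_cone δ t.pt (fun j => t.π.app j) (fun f => t.w f)
    exact ⟨s, ⟨hs.1, hs.2⟩, fun s' hs' => h s' ⟨hs'.pt, hs'.leg⟩⟩
  colimits J _ δ t := by
    have := hc t.pt
    obtain ⟨s, hs, h⟩ := c.exists_initial_cocone δ t.pt (fun j => t.ι.app j) (fun f => t.w f)
    exact ⟨s, ⟨hs.1, hs.2⟩, fun s' hs' => h s' ⟨hs'.pt, hs'.leg⟩⟩

end Bicomplete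

end BiCleavage
section Transfer
universe v' u'

/-- Functorial factorizations can be transferred along equivalences. -/
lemma hasFunctorialFactorization_of_isEquivalence {C : Type u} [Category.{v} C] {D : Type u'}
    [Category.{v'} D] (e : C ⥤ D) [e.IsEquivalence] (L R : MorphismProperty D) [L.RespectsIso]
    [R.RespectsIso] (h : (L.inverseImage e).HasFunctorialFactorization (R.inverseImage e)) :
    L.HasFunctorialFactorization R := by
  obtain ⟨⟨d⟩⟩ := h
  exact ⟨⟨{
    Z := e.inv.mapArrow ⋙ d.Z ⋙ e
    i :=
      { app := fun f => e.asEquivalence.counitInv.app f.left ≫ e.map (d.i.app (e.inv.mapArrow.obj f))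
        naturality := fun f g t => by
          have h₁ := e.asEquivalence.counitInv.naturality t.left
          have h₂ := congrArg e.map (d.i.naturality (e.inv.mapArrow.map t))
          rw [Functor.map_comp, Functor.map_comp] at h₂
          exact (Category.assoc _ _ _).symm.trans ((congrArg (· ≫ _) h₁).trans
            ((Category.assoc _ _ _).trans ((congrArg (_ ≫ ·) h₂).trans
              (Category.assoc _ _ _).symm))) }
    p :=
      { app := fun f => e.map (d.p.app (e.inv.mapArrow.obj f)) ≫ e.asEquivalence.counit.app f.right
        naturality := fun f g t => by
          have h₁ := e.asEquivalence.counit.naturality t.right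
          have h₂ := congrArg e.map (d.p.naturality (e.inv.mapArrow.map t))
          rw [Functor.map_comp, Functor.map_comp] at h₂
          exact (Category.assoc _ _ _).symm.trans ((congrArg (· ≫ _) h₂).trans
            ((Category.assoc _ _ _).trans ((congrArg (_ ≫ ·) h₁).trans
              (Category.assoc _ _ _).symm))) }
    fac := by
      ext f
      have h₁ := congrArg e.map (congrArg (fun t => t.app (e.inv.mapArrow.obj f)) d.fac)
      have h₂ := e.asEquivalence.counit.naturality f.hom
      have h₃ := e.asEquivalence.counitIso.inv_hom_id_app_assoc f.left f.hom
      refine Eq.trans ?_ h₃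
      refine (Category.assoc _ _ _).trans (congrArg (_ ≫ ·) ?_)
      refine Eq.trans ?_ h₂
      refine (Category.assoc _ _ _).symm.trans (congrArg (· ≫ _) ?_)
      exact (e.map_comp _ _).symm.trans h₁
    hi := fun f => by
      refine MorphismProperty.RespectsIso.precomp L (e.asEquivalence.counitInv.app f.left) _
        (d.hi (e.inv.mapArrow.obj f))
    hp := fun f => by
      refine MorphismProperty.RespectsIso.postcomp R (e.asEquivalence.counit.app f.right) _
        (d.hp (e.inv.mapArrow.obj f)) }⟩⟩

end Transfer

section IsHomLift
universe v₁ u₁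
variable {M : Type u₁} [Category.{v₁} M] {N : Type u} [Category.{v} N] {π : N ⥤ M}

lemma isStronglyCocartesian_of_isHomLift {A B : M} {X Y : N} {f : A ⟶ B} {g : X ⟶ Y}
    [h : π.IsHomLift f g] (hg : IsCocartesianMap π g) : π.IsStronglyCocartesian f g := by
  cases h; exact hg

lemma isStronglyCartesian_of_isHomLift {A B : M} {X Y : N} {f : A ⟶ B} {g : X ⟶ Y}
    [h : π.IsHomLift f g] (hg : IsCartesianMap π g) : π.IsStronglyCartesian f g := by
  cases h; exact hg

lemma isCocartesianMap_of_isStronglyCocartesian {A B : M} {X Y : N} (f : A ⟶ B) {g : X ⟶ Y}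
    (hg : π.IsStronglyCocartesian f g) : IsCocartesianMap π g := by
  have h := hg.toIsHomLift
  cases h; exact hg

lemma isCartesianMap_of_isStronglyCartesian {A B : M} {X Y : N} (f : A ⟶ B) {g : X ⟶ Y}
    (hg : π.IsStronglyCartesian f g) : IsCartesianMap π g := by
  have h := hg.toIsHomLift
  cases h; exact hg

lemma isStronglyCartesian_comp_eqToHom {A B : M} {X Y Y' : N} {f : A ⟶ B} (g : X ⟶ Y)
    (hg : π.IsStronglyCartesian f g) (h : Y = Y') : π.IsStronglyCartesian f (g ≫ eqToHom h) := by
  subst h; simpa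

lemma isStronglyCocartesian_eqToHom_comp {A B : M} {X X' Y : N} {f : A ⟶ B} (g : X ⟶ Y)
    (hg : π.IsStronglyCocartesian f g) (h : X = X') :
    π.IsStronglyCocartesian f (eqToHom h.symm ≫ g) := by
  subst h; simpa

end IsHomLift

namespace BiCleavage
universe v₁ u₁ u'
variable {M : Type u₁} [Category.{v₁} M] {N : Type u} [Category.{v} N]
  {π : N ⥤ M} {E : M → Type u'} [∀ A, Category.{v} (E A)] (c : BiCleavage π E)

lemma exists_toFiber {A : M} (X : π.Fiber A) : ∃ x, (c.toFiber A).obj x = X := by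
  obtain ⟨x, hx⟩ := c.exists_obj X.1 X.2
  exact ⟨x, Subtype.ext hx⟩

lemma exists_iso_co {A B : M} (f : A ⟶ B) {x : E A} {y : E B}
    (κ : (c.ι A).obj x ⟶ (c.ι B).obj y) [π.IsStronglyCocartesian f κ] :
    ∃ e : (c.push f).obj x ≅ y, c.co f x ≫ (c.ι B).map e.hom = κ := by
  obtain ⟨φ, hφ⟩ := c.exists_co_map f κ
  obtain ⟨ψ, hψ⟩ := c.exists_map (Functor.IsStronglyCocartesian.map π f κ (g := 𝟙 B)
    (Category.comp_id f).symm (c.co f x))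
  have hψ' : κ ≫ (c.ι B).map ψ = c.co f x := by
    rw [hψ]; exact Functor.IsStronglyCocartesian.fac π f κ _ _
  refine ⟨⟨φ, ψ, ?_, ?_⟩, hφ⟩
  · apply c.co_map_cancel
    rw [Functor.map_comp, reassoc_of% hφ, hψ', CategoryTheory.Functor.map_id, Category.comp_id]
  · apply c.map_injective
    apply Functor.IsStronglyCocartesian.ext π f κ (𝟙 B)
    rw [Functor.map_comp, reassoc_of% hψ', hφ, CategoryTheory.Functor.map_id, Category.comp_id]

lemma exists_iso_cart {A B : M} (f : A ⟶ B) {x : E A} {y : E B}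
    (κ : (c.ι A).obj x ⟶ (c.ι B).obj y) [π.IsStronglyCartesian f κ] :
    ∃ e : x ≅ (c.pull f).obj y, (c.ι A).map e.hom ≫ c.cart f y = κ := by
  obtain ⟨φ, hφ⟩ := c.exists_map_cart f κ
  obtain ⟨ψ, hψ⟩ := c.exists_map (Functor.IsStronglyCartesian.map π f κ (g := 𝟙 A)
    (Category.id_comp f).symm (c.cart f y))
  have hψ' : (c.ι A).map ψ ≫ κ = c.cart f y := by
    rw [hψ]; exact Functor.IsStronglyCartesian.fac π f κ _ _
  refine ⟨⟨φ, ψ, ?_, ?_⟩, hφ⟩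
  · apply c.map_injective
    apply Functor.IsStronglyCartesian.ext π f κ (𝟙 A)
    rw [Functor.map_comp, Category.assoc, hψ', hφ, CategoryTheory.Functor.map_id, Category.id_comp]
  · apply c.map_cart_cancel
    rw [Functor.map_comp, Category.assoc, hφ, hψ', CategoryTheory.Functor.map_id, Category.id_comp]

lemma exists_iso_id (A : M) (x : E A) :
    ∃ e : (c.push (𝟙 A)).obj x ≅ x, c.co (𝟙 A) x ≫ (c.ι A).map e.hom = 𝟙 _ := by
  have : π.IsStronglyCocartesian (𝟙 A) (𝟙 ((c.ι A).obj x)) := by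
    have : π.IsHomLift (𝟙 A) (Iso.refl ((c.ι A).obj x)).hom := IsHomLift.id (c.obj_ι x)
    exact Functor.IsStronglyCocartesian.of_iso π (𝟙 A) (Iso.refl ((c.ι A).obj x))
  exact c.exists_iso_co (𝟙 A) (𝟙 _)

lemma exists_iso_id' (A : M) (x : E A) :
    ∃ e : x ≅ (c.pull (𝟙 A)).obj x, (c.ι A).map e.hom ≫ c.cart (𝟙 A) x = 𝟙 _ := by
  have : π.IsStronglyCartesian (𝟙 A) (𝟙 ((c.ι A).obj x)) := by
    have : π.IsHomLift (𝟙 A) (Iso.refl ((c.ι A).obj x)).hom := IsHomLift.id (c.obj_ι x)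
    exact Functor.IsStronglyCartesian.of_iso π (𝟙 A) (Iso.refl ((c.ι A).obj x))
  exact c.exists_iso_cart (𝟙 A) (𝟙 _)

lemma exists_iso_comp {A B C : M} (f : A ⟶ B) (g : B ⟶ C) (x : E A) :
    ∃ e : (c.push (f ≫ g)).obj x ≅ (c.push g).obj ((c.push f).obj x),
      c.co (f ≫ g) x ≫ (c.ι C).map e.hom = c.co f x ≫ c.co g _ :=
  c.exists_iso_co (f ≫ g) _

lemma exists_iso_comp' {A B C : M} (f : A ⟶ B) (g : B ⟶ C) (y : E C) :
    ∃ e : (c.pull f).obj ((c.pull g).obj y) ≅ (c.pull (f ≫ g)).obj y,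
      (c.ι A).map e.hom ≫ c.cart (f ≫ g) y = c.cart f _ ≫ c.cart g y :=
  c.exists_iso_cart (f ≫ g) _

lemma isBicartesianFibration (c : BiCleavage π E) : IsBicartesianFibration π where
  cartesian Y A f := by
    obtain ⟨y, hy⟩ := c.exists_obj Y rfl
    have := isStronglyCartesian_comp_eqToHom (c.cart f y) (c.isStronglyCartesian_cart f y) hy
    exact ⟨_, _, this⟩
  cocartesian X B f := by
    obtain ⟨x, hx⟩ := c.exists_obj X rfl
    have := isStronglyCocartesian_eqToHom_comp (c.co f x) (c.isStronglyCocartesian_co f x) hx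
    exact ⟨_, _, this⟩

lemma respectsIso_of_inverseImage (c : BiCleavage π E) (A : M) (P : MorphismProperty (π.Fiber A))
    (hP : (P.inverseImage (c.toFiber A)).RespectsIso) : P.RespectsIso := by
  apply MorphismProperty.RespectsIso.mk
  · intro X Y Z e f hf
    obtain ⟨x, rfl⟩ := c.exists_toFiber X
    obtain ⟨y, rfl⟩ := c.exists_toFiber Y
    obtain ⟨z, rfl⟩ := c.exists_toFiber Z
    obtain ⟨e, rfl⟩ : ∃ e', (c.toFiber A).mapIso e' = e :=
      ⟨(c.toFiber A).preimageIso e, by ext1; simp⟩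
    obtain ⟨f, rfl⟩ := (c.toFiber A).map_surjective f
    have := MorphismProperty.RespectsIso.precomp (P.inverseImage (c.toFiber A)) e.hom f hf
    rwa [MorphismProperty.inverseImage_iff, Functor.map_comp] at this
  · intro X Y Z e f hf
    obtain ⟨x, rfl⟩ := c.exists_toFiber X
    obtain ⟨y, rfl⟩ := c.exists_toFiber Y
    obtain ⟨z, rfl⟩ := c.exists_toFiber Z
    obtain ⟨e, rfl⟩ : ∃ e', (c.toFiber A).mapIso e' = e :=
      ⟨(c.toFiber A).preimageIso e, by ext1; simp⟩
    obtain ⟨f, rfl⟩ := (c.toFiber A).map_surjective f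
    have := MorphismProperty.RespectsIso.postcomp (P.inverseImage (c.toFiber A)) e.hom f hf
    rwa [MorphismProperty.inverseImage_iff, Functor.map_comp] at this

/-- A cleavage by Quillen adjunctions between model categories which is relative and proper, and the
integral classes of maps on the total category. -/
structure IsModelCleavage (k : FactorizationKind) (S : MapClasses M) (Sf : ∀ A, MapClasses (E A))
    (T : MapClasses N) : Prop where
  base : S.IsPreModel
  model (A : M) : IsModelCategory k (Sf A)
  quillen {A B : M} (f : A ⟶ B) : IsQuillenPair (Sf A) (Sf B) (c.push f) (c.pull f)
  relative {A B : M} (f : A ⟶ B) : S.W f → IsQuillenEquivalence (Sf A) (Sf B) (c.adj f)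
  proper_left {A B : M} (f : A ⟶ B) : S.trivCof f → (Sf A).W ≤ (Sf B).W.inverseImage (c.push f)
  proper_right {A B : M} (f : A ⟶ B) : S.trivFib f → (Sf B).W ≤ (Sf A).W.inverseImage (c.pull f)
  cof : c.IsLeftClass T.cof S.cof (fun A => (Sf A).cof)
  fib : c.IsRightClass T.fib S.fib (fun A => (Sf A).fib)
  W {A B : M} (f : A ⟶ B) {x : E A} {y : E B} (φ : (c.push f).obj x ⟶ y) :
    T.W (c.co f x ≫ (c.ι B).map φ) ↔ S.W f ∧ ∀ ⦃q : E A⦄ (p : q ⟶ x), (Sf A).IsCofibrant q →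
      (Sf A).trivFib p → (Sf B).W ((c.push f).map p ≫ φ)

namespace IsModelCleavage
variable {c} {k : FactorizationKind} {S : MapClasses M} {Sf : ∀ A, MapClasses (E A)}
  {T : MapClasses N} (h : c.IsModelCleavage k S Sf T)
include h

lemma W_iff {A B : M} (f : A ⟶ B) (hf : S.W f) {x : E A} {y : E B} (φ : (c.push f).obj x ⟶ y)
    {q : E A} (p : q ⟶ x) (hq : (Sf A).IsCofibrant q) (hp : (Sf A).W p) :
    T.W (c.co f x ≫ (c.ι B).map φ) ↔ (Sf B).W ((c.push f).map p ≫ φ) := by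
  rw [h.W, (h.relative f hf).W_replacement_iff (h.model A) (h.model B) (h.quillen f) φ p hq hp]
  exact and_iff_right hf

lemma W_iff_right {A B : M} (f : A ⟶ B) (hf : S.W f) {x : E A} {y r : E B}
    (φ : x ⟶ (c.pull f).obj y) (j : y ⟶ r) (hr : (Sf B).IsFibrant r) (hj : (Sf B).W j) :
    T.W ((c.ι A).map φ ≫ c.cart f y) ↔ (Sf A).W (φ ≫ (c.pull f).map j) := by
  rw [c.map_cart, h.W, (h.relative f hf).W_replacement_iff_right (h.model A) (h.model B)
    (h.quillen f) _ j hr hj, Equiv.apply_symm_apply]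
  exact and_iff_right hf

lemma trivCof : c.IsLeftClass T.trivCof S.trivCof (fun A => (Sf A).trivCof) := by
  intro A B f x y φ
  obtain ⟨q, p, hq, hp⟩ := (h.model A).exists_cofibrant x
  have key (hf : S.trivCof f) : T.W (c.co f x ≫ (c.ι B).map φ) ↔ (Sf B).W φ := by
    rw [h.W_iff f hf.2 φ p hq hp.2, (h.model B).W_comp_iff_left _ (h.proper_left f hf _ hp.2)]
  constructor
  · rintro ⟨h₁, h₂⟩
    have h₁' := (h.cof f φ).1 h₁
    have hf : S.trivCof f := ⟨h₁'.1, ((h.W f φ).1 h₂).1⟩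
    exact ⟨hf, h₁'.2, (key hf).1 h₂⟩
  · rintro ⟨hf, h₁, h₂⟩
    exact ⟨(h.cof f φ).2 ⟨hf.1, h₁⟩, (key hf).2 h₂⟩

lemma trivFib : c.IsRightClass T.trivFib S.trivFib (fun A => (Sf A).trivFib) := by
  intro A B f x y φ
  obtain ⟨r, j, hr, hj⟩ := (h.model B).exists_fibrant y
  have key (hf : S.trivFib f) : T.W ((c.ι A).map φ ≫ c.cart f y) ↔ (Sf A).W φ := by
    rw [h.W_iff_right f hf.2 φ j hr hj.2,
      (h.model A).W_comp_iff_right _ (h.proper_right f hf _ hj.2)]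
  constructor
  · rintro ⟨h₁, h₂⟩
    have h₁' := (h.fib f φ).1 h₁
    have hf : S.trivFib f := ⟨h₁'.1, by
      rw [c.map_cart] at h₂
      exact ((h.W f _).1 h₂).1⟩
    exact ⟨hf, h₁'.2, (key hf).1 h₂⟩
  · rintro ⟨hf, h₁, h₂⟩
    exact ⟨(h.fib f φ).2 ⟨hf.1, h₁⟩, (key hf).2 h₂⟩

lemma wfs_trivCof : IsRelativeWFS π T.trivCof T.fib S.trivCof S.fib :=
  c.isRelativeWFS h.trivCof h.fib (fun A => (h.model A).lift_trivCof)
    (fun A _ _ f => (h.model A).factor_trivCof.exists_fac f)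
    (fun A _ _ _ hf => (h.model A).trivCof_of_lift hf)
    (fun A _ _ _ hf => (h.model A).fib_of_lift hf) (fun _ _ f _ _ p hp => (h.quillen f).fib p hp)

lemma wfs_trivFib : IsRelativeWFS π T.cof T.trivFib S.cof S.trivFib :=
  c.isRelativeWFS h.cof h.trivFib (fun A => (h.model A).lift_trivFib)
    (fun A _ _ f => (h.model A).factor_trivFib.exists_fac f)
    (fun A _ _ _ hf => (h.model A).cof_of_lift hf)
    (fun A _ _ _ hf => (h.model A).trivFib_of_lift hf)
    (fun _ _ f _ _ p hp => (h.quillen f).trivFib p hp)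

lemma exists_W_iff {A B C : M} (f : A ⟶ B) (g : B ⟶ C) (hf : S.W f) (hg : S.W g)
    (hfg : S.W (f ≫ g)) {x : E A} {y : E B} {z : E C} (φ : (c.push f).obj x ⟶ y)
    (ψ : (c.push g).obj y ⟶ z) :
    ∃ (p q : E C) (s : p ⟶ q) (t : q ⟶ z), (T.W (c.co f x ≫ (c.ι B).map φ) ↔ (Sf C).W s) ∧
      (T.W (c.co g y ≫ (c.ι C).map ψ) ↔ (Sf C).W t) ∧
      (T.W ((c.co f x ≫ (c.ι B).map φ) ≫ c.co g y ≫ (c.ι C).map ψ) ↔ (Sf C).W (s ≫ t)) := by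
  obtain ⟨p, i, hp, hi⟩ := (h.model A).exists_cofibrant x
  obtain ⟨q, j, hq, hj⟩ := (h.model B).exists_cofibrant y
  have hp' := (h.quillen f).isCofibrant_obj (h.model A) (h.model B) (c.adj f) hp
  obtain ⟨l, hl⟩ := (h.model B).exists_lift_cofibrant hp' hj ((c.push f).map i ≫ φ)
  obtain ⟨e, he⟩ := c.exists_iso_comp f g x
  obtain ⟨e', he'⟩ := c.exists_iso_comp f g p
  refine ⟨_, _, (c.push g).map l, (c.push g).map j ≫ ψ, ?_, h.W_iff g hg ψ j hq hj.2, ?_⟩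
  · rw [h.W_iff f hf φ i hp hi.2, ← hl, (h.model B).W_comp_iff_right _ hj.2,
      (h.relative g hg).W_map_iff (h.model B) (h.model C) (h.quillen g) hp' hq]
  · have hcomp : (c.co f x ≫ (c.ι B).map φ) ≫ c.co g y ≫ (c.ι C).map ψ =
        c.co (f ≫ g) x ≫ (c.ι C).map (e.hom ≫ (c.push g).map φ ≫ ψ) := by
      rw [Functor.map_comp, reassoc_of% he, Functor.map_comp, ← reassoc_of% c.map_co,
        Category.assoc]
    have hnat : (c.push (f ≫ g)).map i ≫ e.hom = e'.hom ≫ (c.push g).map ((c.push f).map i) := by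
      apply c.co_map_cancel
      rw [Functor.map_comp, ← reassoc_of% c.map_co, he, Functor.map_comp, reassoc_of% he',
        ← c.map_co, reassoc_of% c.map_co]
    rw [hcomp, h.W_iff (f ≫ g) hfg _ i hp hi.2, reassoc_of% hnat,
      (h.model C).W_comp_iff_left _ ((h.model C).W_iso _), ← Functor.map_comp_assoc, ← hl,
      Functor.map_comp, Category.assoc]

lemma map_W {X Y : N} (f : X ⟶ Y) (hf : T.W f) : S.W (π.map f) := by
  obtain ⟨A, x, rfl⟩ := c.exists_eq X
  obtain ⟨B, y, rfl⟩ := c.exists_eq Y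
  obtain ⟨f', _⟩ := c.exists_isHomLift f
  obtain ⟨φ, rfl⟩ := c.exists_co_map f' f
  exact (mem_map_iff_of_isHomLift _ f' _).2 ((h.W f' φ).1 hf).1

lemma W_two_out_of_three {X Y Z : N} (f : X ⟶ Y) (g : Y ⟶ Z) (hf : S.W (π.map f))
    (hg : S.W (π.map g)) (hfg : S.W (π.map (f ≫ g))) :
    (T.W f → T.W g → T.W (f ≫ g)) ∧ (T.W f → T.W (f ≫ g) → T.W g) ∧
    (T.W g → T.W (f ≫ g) → T.W f) := by
  obtain ⟨A, x, rfl⟩ := c.exists_eq X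
  obtain ⟨B, y, rfl⟩ := c.exists_eq Y
  obtain ⟨C, z, rfl⟩ := c.exists_eq Z
  obtain ⟨f', _⟩ := c.exists_isHomLift f
  obtain ⟨g', _⟩ := c.exists_isHomLift g
  obtain ⟨φ, rfl⟩ := c.exists_co_map f' f
  obtain ⟨ψ, rfl⟩ := c.exists_co_map g' g
  obtain ⟨_, _, s, t, h₁, h₂, h₃⟩ := h.exists_W_iff f' g' ((mem_map_iff_of_isHomLift _ _ _).1 hf)
    ((mem_map_iff_of_isHomLift _ _ _).1 hg) ((mem_map_iff_of_isHomLift _ _ _).1 hfg) φ ψ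
  rw [h₁, h₂, h₃]
  exact ⟨fun hs ht => (h.model C).W_comp hs ht, fun hs hst => ((h.model C).W_comp_iff_left t hs).1 hst,
    fun ht hst => ((h.model C).W_comp_iff_right s ht).1 hst⟩

lemma cof_map_iff {A : M} {x y : E A} (φ : x ⟶ y) : T.cof ((c.ι A).map φ) ↔ (Sf A).cof φ := by
  obtain ⟨e, he⟩ := c.exists_iso_id A x
  have : (c.ι A).map φ = c.co (𝟙 A) x ≫ (c.ι A).map (e.hom ≫ φ) := by
    rw [Functor.map_comp, reassoc_of% he]
  have _ := h.base.cof
  rw [this, h.cof]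
  have := h.model A
  refine ⟨fun ⟨_, h₁⟩ => ?_, fun h₁ => ⟨S.cof.id_mem A, this.cof_comp (this.cof_iso _) h₁⟩⟩
  have h₂ := this.cof_comp (this.cof_iso e.inv) h₁
  rwa [Iso.inv_hom_id_assoc] at h₂

lemma fib_map_iff {A : M} {x y : E A} (φ : x ⟶ y) : T.fib ((c.ι A).map φ) ↔ (Sf A).fib φ := by
  obtain ⟨e, he⟩ := c.exists_iso_id' A y
  have : (c.ι A).map φ = (c.ι A).map (φ ≫ e.hom) ≫ c.cart (𝟙 A) y := by
    rw [Functor.map_comp, Category.assoc, he, Category.comp_id]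
  have _ := h.base.fib
  rw [this, h.fib]
  have := h.model A
  refine ⟨fun ⟨_, h₁⟩ => ?_, fun h₁ => ⟨S.fib.id_mem A, this.fib_comp h₁ (this.fib_iso _)⟩⟩
  have h₂ := this.fib_comp h₁ (this.fib_iso e.inv)
  rwa [Category.assoc, Iso.hom_inv_id, Category.comp_id] at h₂

lemma W_map_iff {A : M} {x y : E A} (φ : x ⟶ y) : T.W ((c.ι A).map φ) ↔ (Sf A).W φ := by
  obtain ⟨e, he⟩ := c.exists_iso_id A x
  have h₁ : (c.ι A).map φ = c.co (𝟙 A) x ≫ (c.ι A).map (e.hom ≫ φ) := by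
    rw [Functor.map_comp, reassoc_of% he]
  have _ := h.base.W
  have := h.model A
  obtain ⟨q, p, hq, hp⟩ := this.exists_cofibrant x
  obtain ⟨e', he'⟩ := c.exists_iso_id A q
  have h₂ : (c.push (𝟙 A)).map p ≫ e.hom = e'.hom ≫ p := by
    apply c.co_map_cancel
    rw [Functor.map_comp, ← reassoc_of% c.map_co, he, Functor.map_comp, reassoc_of% he',
      Category.comp_id]
  rw [h₁, h.W_iff (𝟙 A) (S.W.id_mem A) _ p hq hp.2, reassoc_of% h₂,
    this.W_comp_iff_left _ (this.W_iso _), this.W_comp_iff_left _ hp.2]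

lemma cof_comp {X Y Z : N} (f : X ⟶ Y) (g : Y ⟶ Z) (hf : T.cof f) (hg : T.cof g) :
    T.cof (f ≫ g) := by
  obtain ⟨A, x, rfl⟩ := c.exists_eq X
  obtain ⟨B, y, rfl⟩ := c.exists_eq Y
  obtain ⟨C, z, rfl⟩ := c.exists_eq Z
  obtain ⟨f', _⟩ := c.exists_isHomLift f
  obtain ⟨g', _⟩ := c.exists_isHomLift g
  obtain ⟨φ, rfl⟩ := c.exists_co_map f' f
  obtain ⟨ψ, rfl⟩ := c.exists_co_map g' g
  obtain ⟨e, he⟩ := c.exists_iso_comp f' g' x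
  have hcomp : (c.co f' x ≫ (c.ι B).map φ) ≫ c.co g' y ≫ (c.ι C).map ψ =
      c.co (f' ≫ g') x ≫ (c.ι C).map (e.hom ≫ (c.push g').map φ ≫ ψ) := by
    rw [Functor.map_comp, reassoc_of% he, Functor.map_comp, ← reassoc_of% c.map_co, Category.assoc]
  rw [h.cof] at hf hg
  have _ := h.base.cof
  have := h.model C
  rw [hcomp, h.cof]
  exact ⟨S.cof.comp_mem _ _ hf.1 hg.1,
    this.cof_comp (this.cof_iso _) (this.cof_comp ((h.quillen g').cof _ hf.2) hg.2)⟩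

lemma fib_comp {X Y Z : N} (f : X ⟶ Y) (g : Y ⟶ Z) (hf : T.fib f) (hg : T.fib g) :
    T.fib (f ≫ g) := by
  obtain ⟨A, x, rfl⟩ := c.exists_eq X
  obtain ⟨B, y, rfl⟩ := c.exists_eq Y
  obtain ⟨C, z, rfl⟩ := c.exists_eq Z
  obtain ⟨f', _⟩ := c.exists_isHomLift f
  obtain ⟨g', _⟩ := c.exists_isHomLift g
  obtain ⟨φ, rfl⟩ := c.exists_map_cart f' f
  obtain ⟨ψ, rfl⟩ := c.exists_map_cart g' g
  obtain ⟨e, he⟩ := c.exists_iso_comp' f' g' z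
  have hcomp : ((c.ι A).map φ ≫ c.cart f' y) ≫ (c.ι B).map ψ ≫ c.cart g' z =
      (c.ι A).map (φ ≫ (c.pull f').map ψ ≫ e.hom) ≫ c.cart (f' ≫ g') z := by
    rw [Functor.map_comp, Functor.map_comp, Category.assoc, Category.assoc, Category.assoc, he,
      ← reassoc_of% c.cart_map]
  rw [h.fib] at hf hg
  have _ := h.base.fib
  have := h.model A
  rw [hcomp, h.fib]
  exact ⟨S.fib.comp_mem _ _ hf.1 hg.1,
    this.fib_comp hf.2 (this.fib_comp ((h.quillen f').fib _ hg.2) (this.fib_iso _))⟩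

lemma preModel : T.IsPreModel where
  W :=
    { id_mem := fun X => by
        obtain ⟨A, x, rfl⟩ := c.exists_eq X
        rw [← CategoryTheory.Functor.map_id, h.W_map_iff]
        exact (h.model A).W_iso _
      comp_mem := fun f g hf hg => by
        have _ := h.base.W
        refine (h.W_two_out_of_three f g (h.map_W f hf) (h.map_W g hg) ?_).1 hf hg
        rw [Functor.map_comp]
        exact S.W.comp_mem _ _ (h.map_W f hf) (h.map_W g hg) }
  cof :=
    { id_mem := fun X => by
        obtain ⟨A, x, rfl⟩ := c.exists_eq X
        rw [← CategoryTheory.Functor.map_id, h.cof_map_iff]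
        exact (h.model A).cof_iso _
      comp_mem := fun f g hf hg => h.cof_comp f g hf hg }
  fib :=
    { id_mem := fun X => by
        obtain ⟨A, x, rfl⟩ := c.exists_eq X
        rw [← CategoryTheory.Functor.map_id, h.fib_map_iff]
        exact (h.model A).fib_iso _
      comp_mem := fun f g hf hg => h.fib_comp f g hf hg }

lemma pullback_toFiber (A : M) : (fiberClasses T π A).pullback (c.toFiber A) = Sf A := by
  have h₁ : ((fiberClasses T π A).pullback (c.toFiber A)).W = (Sf A).W := by
    ext x y φ; exact h.W_map_iff φ
  have h₂ : ((fiberClasses T π A).pullback (c.toFiber A)).cof = (Sf A).cof := by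
    ext x y φ; exact h.cof_map_iff φ
  have h₃ : ((fiberClasses T π A).pullback (c.toFiber A)).fib = (Sf A).fib := by
    ext x y φ; exact h.fib_map_iff φ
  revert h₁ h₂ h₃
  generalize (fiberClasses T π A).pullback (c.toFiber A) = U
  generalize Sf A = V
  cases U; cases V
  rintro rfl rfl rfl
  rfl

lemma trivCof_pullback_toFiber (A : M) :
    (fiberClasses T π A).trivCof.inverseImage (c.toFiber A) = (Sf A).trivCof :=
  congrArg MapClasses.trivCof (h.pullback_toFiber A)

lemma trivFib_pullback_toFiber (A : M) :
    (fiberClasses T π A).trivFib.inverseImage (c.toFiber A) = (Sf A).trivFib :=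
  congrArg MapClasses.trivFib (h.pullback_toFiber A)

lemma hasFunctorialFactorization_fiber_trivCof (hk : k = .functorial) (A : M) :
    (fiberClasses T π A).trivCof.HasFunctorialFactorization (fiberClasses T π A).fib := by
  subst hk
  have hm := h.model A
  have h₁ : (Sf A).trivCof.RespectsIso := MorphismProperty.RespectsIso.mk _
    (fun e f hf => hm.trivCof_comp (hm.trivCof_iso _) hf)
    (fun e f hf => hm.trivCof_comp hf (hm.trivCof_iso _))
  have h₂ : (Sf A).fib.RespectsIso := MorphismProperty.RespectsIso.mk _
    (fun e f hf => hm.fib_comp (hm.fib_iso _) hf) (fun e f hf => hm.fib_comp hf (hm.fib_iso _))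
  have e₂ : (fiberClasses T π A).fib.inverseImage (c.toFiber A) = (Sf A).fib :=
    congrArg MapClasses.fib (h.pullback_toFiber A)
  have _ := c.respectsIso_of_inverseImage A (fiberClasses T π A).trivCof
    (h.trivCof_pullback_toFiber A ▸ h₁)
  have _ := c.respectsIso_of_inverseImage A (fiberClasses T π A).fib (e₂ ▸ h₂)
  apply hasFunctorialFactorization_of_isEquivalence (c.toFiber A)
  rw [h.trivCof_pullback_toFiber, e₂]
  exact hm.factor_trivCof

lemma hasFunctorialFactorization_fiber_trivFib (hk : k = .functorial) (A : M) :
    (fiberClasses T π A).cof.HasFunctorialFactorization (fiberClasses T π A).trivFib := by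
  subst hk
  have hm := h.model A
  have h₁ : (Sf A).cof.RespectsIso := MorphismProperty.RespectsIso.mk _
    (fun e f hf => hm.cof_comp (hm.cof_iso _) hf) (fun e f hf => hm.cof_comp hf (hm.cof_iso _))
  have h₂ : (Sf A).trivFib.RespectsIso := MorphismProperty.RespectsIso.mk _
    (fun e f hf => hm.trivFib_comp (hm.trivFib_iso _) hf)
    (fun e f hf => hm.trivFib_comp hf (hm.trivFib_iso _))
  have e₁ : (fiberClasses T π A).cof.inverseImage (c.toFiber A) = (Sf A).cof :=
    congrArg MapClasses.cof (h.pullback_toFiber A)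
  have _ := c.respectsIso_of_inverseImage A (fiberClasses T π A).cof (e₁ ▸ h₁)
  have _ := c.respectsIso_of_inverseImage A (fiberClasses T π A).trivFib
    (h.trivFib_pullback_toFiber A ▸ h₂)
  apply hasFunctorialFactorization_of_isEquivalence (c.toFiber A)
  rw [h.trivFib_pullback_toFiber, e₁]
  exact hm.factor_trivFib

lemma isCofibrant_of_isCofibrantOver {A : M} {x : E A}
    (hx : IsCofibrantOver T π ((c.ι A).obj x)) : (Sf A).IsCofibrant x := fun I hI => by
  have key : ∀ (A : M) (hA : π.obj ((c.ι _).obj x) = A),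
      (fiberClasses T π A).IsCofibrant ⟨(c.ι _).obj x, hA⟩ := by
    rintro _ rfl; exact hx
  rw [← h.cof_map_iff]
  have := key A (c.obj_ι x) (hI.isInitialObj (c.toFiber A))
  have h' : (fiberClasses T π A).cof ((c.toFiber A).map (hI.to x)) := by
    rw [(hI.isInitialObj (c.toFiber A)).hom_ext ((c.toFiber A).map (hI.to x))
      (Limits.IsInitial.to _ _)]
    exact this
  exact h'

lemma isFibrant_of_isFibrantOver {A : M} {x : E A}
    (hx : IsFibrantOver T π ((c.ι A).obj x)) : (Sf A).IsFibrant x := fun I hI => by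
  have key : ∀ (A : M) (hA : π.obj ((c.ι _).obj x) = A),
      (fiberClasses T π A).IsFibrant ⟨(c.ι _).obj x, hA⟩ := by
    rintro _ rfl; exact hx
  rw [← h.fib_map_iff]
  have := key A (c.obj_ι x) (hI.isTerminalObj (c.toFiber A))
  have h' : (fiberClasses T π A).fib ((c.toFiber A).map (hI.from x)) := by
    rw [(hI.isTerminalObj (c.toFiber A)).hom_ext ((c.toFiber A).map (hI.from x))
      (Limits.IsTerminal.from _ _)]
    exact this
  exact h'

/-- The total category of a relative and proper cleavage by model categories is a model fibration. -/
theorem isModelFibration : IsModelFibration k S T π where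
  preModel := h.preModel
  bicomplete := c.isBicomplete (fun A => (h.model A).hasLimits) (fun A => (h.model A).hasColimits)
  two_out_of_three X Y Z f g := by
    exact ⟨fun hf hg hfg => (h.W_two_out_of_three f g (h.map_W f hf) (h.map_W g hg) hfg).1 hf hg,
      fun hf hfg hg => (h.W_two_out_of_three f g (h.map_W f hf) hg (h.map_W _ hfg)).2.1 hf hfg,
      fun hg hfg hf => (h.W_two_out_of_three f g hf (h.map_W g hg) (h.map_W _ hfg)).2.2 hg hfg⟩
  wfs_trivCof := h.wfs_trivCof
  wfs_trivFib := h.wfs_trivFib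
  functorial_trivCof := h.hasFunctorialFactorization_fiber_trivCof
  functorial_trivFib := h.hasFunctorialFactorization_fiber_trivFib
  bicartesian := c.isBicartesianFibration
  cocartesian_W X Y f hf hX hW := by
    obtain ⟨A, x, rfl⟩ := c.exists_eq X
    obtain ⟨B, y, rfl⟩ := c.exists_eq Y
    obtain ⟨f', _⟩ := c.exists_isHomLift f
    have hf' : π.IsStronglyCocartesian f' f := isStronglyCocartesian_of_isHomLift hf
    obtain ⟨e, rfl⟩ := c.exists_iso_co f' f
    have hm := h.model B
    rw [h.W_iff f' ((mem_map_iff_of_isHomLift _ f' _).1 hW) _ (𝟙 x)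
      (h.isCofibrant_of_isCofibrantOver hX) ((h.model A).W_iso _), CategoryTheory.Functor.map_id,
      Category.id_comp]
    exact hm.W_iso _
  cartesian_W X Y f hf hY hW := by
    obtain ⟨A, x, rfl⟩ := c.exists_eq X
    obtain ⟨B, y, rfl⟩ := c.exists_eq Y
    obtain ⟨f', _⟩ := c.exists_isHomLift f
    have hf' : π.IsStronglyCartesian f' f := isStronglyCartesian_of_isHomLift hf
    obtain ⟨e, rfl⟩ := c.exists_iso_cart f' f
    have hm := h.model A
    rw [h.W_iff_right f' ((mem_map_iff_of_isHomLift _ f' _).1 hW) _ (𝟙 y)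
      (h.isFibrant_of_isFibrantOver hY) ((h.model B).W_iso _), CategoryTheory.Functor.map_id,
      Category.comp_id]
    exact hm.W_iso _

end IsModelCleavage
end BiCleavage
namespace Diagram
variable {k : FactorizationKind} {M : Type u} [Category.{v} M] (F : Diagram.{v, u} M k)

/-- The tautological cleavage of the Grothendieck construction. -/
def cleavage : BiCleavage (Pseudofunctor.Grothendieck.forget F.leftDiagram)
    (fun A => (F.at' A).cat) where
  ι A :=
    { obj := fun x => ⟨A, x⟩
      map := fun φ => vert F.leftDiagram φ
      map_id := fun x => vert_id (P := F.leftDiagram) (A := A) x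
      map_comp := fun φ ψ => (vert_vert (P := F.leftDiagram) φ ψ).symm }
  isHomLift_map {A x y} φ := isHomLift_forget (vert F.leftDiagram φ) rfl
  exists_obj {A} X hX := by
    obtain ⟨B, x⟩ := X
    obtain rfl : B = A := hX
    exact ⟨x, rfl⟩
  exists_map {A x y} g hg :=
    exists_vert (P := F.leftDiagram) (A := A) (x := x) (y := y) g (base_eq_of_isHomLift g _ hg)
  map_injective {A x y φ ψ} h := vert_injective (P := F.leftDiagram) (A := A) h
  push f := F.push f
  pull f := F.pull f
  adj f := F.adj f
  co f x := coLift F.leftDiagram f x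
  cart f y := cartLift F f y
  isStronglyCocartesian_co f x := coLift_isStronglyCocartesian (P := F.leftDiagram) f x
  isStronglyCartesian_cart f y := cartLift_isStronglyCartesian f y
  map_co f x y φ := vert_coLift (P := F.leftDiagram) f φ
  cart_map f x y φ := cartLift_vert f φ
  co_map {A B} f x y φ := (coLift_vert (P := F.leftDiagram) (f := f) φ).trans
    ((vert_cartLift _).trans (congrArg (Pseudofunctor.Grothendieck.Hom.mk _)
      (Equiv.symm_apply_apply ..))).symm

variable {F} {S : MapClasses M}

lemma isModelCleavage (hS : S.IsPreModel) (hF : F.IsRelative S) (hF' : F.IsProper S) :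
    F.cleavage.IsModelCleavage k S (fun A => (F.at' A).classes) (F.totalClasses S) where
  base := hS
  model A := (F.at' A).isModel
  quillen f := (F.map f.toLoc).mem
  relative f hf := hF f hf
  proper_left f hf := hF'.left f hf
  proper_right f hf := hF'.right f hf
  cof A B f x y φ := by
    have : F.cleavage.co f x ≫ (F.cleavage.ι B).map φ = _ := coLift_vert (P := F.leftDiagram) φ
    rw [this]
    exact Iff.rfl
  fib A B f x y φ := by
    have : (F.cleavage.ι A).map φ ≫ F.cleavage.cart f y = _ := vert_cartLift φ
    rw [this]
    have h := (F.adj f).homEquiv x y |>.apply_symm_apply φ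
    have h' : (F.at' A).classes.fib ((F.adj f).homEquiv x y (((F.adj f).homEquiv x y).symm φ)) ↔
        (F.at' A).classes.fib φ := by rw [h]; exact Iff.rfl
    exact and_congr_right fun _ => h'
  W {A B} f x y φ := by
    have : F.cleavage.co f x ≫ (F.cleavage.ι B).map φ = _ := coLift_vert (P := F.leftDiagram) φ
    rw [this]
    exact Iff.rfl

theorem isModelFibration_total (hS : S.IsPreModel) (F : FunPR.{v, u} S k) :
    IsModelFibration k S (F.1.totalClasses S) F.1.totalBased.p :=
  (isModelCleavage hS F.2.1 F.2.2).isModelFibration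

end Diagram
lemma mem_congr {C : Type*} [Category C] (P : MorphismProperty C) {X Y : C} {f g : X ⟶ Y}
    (h : f = g) : P f ↔ P g := by rw [h]

section RelativeWFS
universe v₁ u₁
variable {M : Type u₁} [Category.{v₁} M] {N : Type u} [Category.{v} N] {π : N ⥤ M}

namespace IsRelativeWFS
variable {L R : MorphismProperty N} {L' R' : MorphismProperty M} (h : IsRelativeWFS π L R L' R')
include h

lemma exists_lift {A B C D : M} {i : A ⟶ B} {p : C ⟶ D} (u : B ⟶ C) {X Y Z W : N} {a : X ⟶ Z}
    {ψ : X ⟶ Y} {η : Z ⟶ W} {b : Y ⟶ W} [h₁ : π.IsHomLift i ψ] [h₂ : π.IsHomLift p η]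
    [π.IsHomLift (i ≫ u) a] [π.IsHomLift (u ≫ p) b] (hψ : L ψ) (hη : R η)
    (sq : a ≫ η = ψ ≫ b) : ∃ γ : Y ⟶ Z, ψ ≫ γ = a ∧ γ ≫ η = b ∧ π.IsHomLift u γ := by
  cases h₁
  cases h₂
  obtain ⟨γ, h₁, h₂, rfl⟩ := h.lift a ψ η b hψ hη sq u
    (IsHomLift.eq_of_isHomLift π _ a) (IsHomLift.eq_of_isHomLift π _ b)
  exact ⟨γ, h₁, h₂, inferInstance⟩

lemma exists_factor {A B C : M} (f : A ⟶ C) (g : C ⟶ B) {X Y : N} (φ : X ⟶ Y)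
    [π.IsHomLift (f ≫ g) φ] (hf : L' f) (hg : R' g) :
    ∃ (Z : N) (η : X ⟶ Z) (ψ : Z ⟶ Y), η ≫ ψ = φ ∧ L η ∧ R ψ ∧ π.IsHomLift f η ∧
      π.IsHomLift g ψ := by
  obtain rfl := IsHomLift.domain_eq π (f ≫ g) φ
  obtain rfl := IsHomLift.codomain_eq π (f ≫ g) φ
  exact h.factor φ f g (IsHomLift.eq_of_isHomLift π _ φ) hf hg

lemma right_of_lift (hid : ∀ A, L' (𝟙 A)) {A B : M} {f : A ⟶ B} {Z W : N} (g : Z ⟶ W)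
    [π.IsHomLift f g] (hf : R' f) (lift : ∀ ⦃V : N⦄ (η : Z ⟶ V) (ψ : V ⟶ W), L η →
      π.IsHomLift (𝟙 A) η → π.IsHomLift f ψ → η ≫ ψ = g →
      ∃ γ : V ⟶ Z, η ≫ γ = 𝟙 Z ∧ γ ≫ g = ψ) : R g := by
  have : π.IsHomLift (𝟙 A ≫ f) g := by rwa [Category.id_comp]
  obtain ⟨V, η, ψ, fac, hη, hψ, h₁, h₂⟩ := h.exists_factor (𝟙 A) f g (hid A) hf
  obtain ⟨γ, h₃, h₄⟩ := lift η ψ hη h₁ h₂ fac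
  exact h.retract_right g ψ ⟨{
    i := Arrow.homMk η (𝟙 W) (by simp [fac])
    r := Arrow.homMk γ (𝟙 W) (by simp [h₄])
    retract := by ext <;> simp [h₃] }⟩ hψ ((mem_map_iff_of_isHomLift _ f g).2 hf)

lemma left_of_lift (hid : ∀ A, R' (𝟙 A)) {A B : M} {f : A ⟶ B} {Z W : N} (g : Z ⟶ W)
    [π.IsHomLift f g] (hf : L' f) (lift : ∀ ⦃V : N⦄ (η : Z ⟶ V) (ψ : V ⟶ W), R ψ →
      π.IsHomLift f η → π.IsHomLift (𝟙 B) ψ → η ≫ ψ = g →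
      ∃ γ : W ⟶ V, g ≫ γ = η ∧ γ ≫ ψ = 𝟙 W) : L g := by
  have : π.IsHomLift (f ≫ 𝟙 B) g := by rwa [Category.comp_id]
  obtain ⟨V, η, ψ, fac, hη, hψ, h₁, h₂⟩ := h.exists_factor f (𝟙 B) g hf (hid B)
  obtain ⟨γ, h₃, h₄⟩ := lift η ψ hψ h₁ h₂ fac
  exact h.retract_left g η ⟨{
    i := Arrow.homMk (𝟙 Z) γ (by simp [h₃])
    r := Arrow.homMk (𝟙 Z) ψ (by simp [fac])
    retract := by ext <;> simp [h₄] }⟩ hη ((mem_map_iff_of_isHomLift _ f g).2 hf)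

end IsRelativeWFS
end RelativeWFS

section BasedAdjunction
universe v₁ u₁
variable {M : Type u₁} [Category.{v₁} M] {X Y : BasedCategory.{v, u} M} {Φ : X ⟶ Y} {Ψ : Y ⟶ X}
  (adj : Bicategory.Adjunction Φ Ψ)

/-- The adjunction of functors underlying an adjunction over `M`. -/
def baseAdjunction : Φ.toFunctor ⊣ Ψ.toFunctor where
  unit := adj.unit.toNatTrans
  counit := adj.counit.toNatTrans
  left_triangle_components x := by
    have h := congrArg (fun t => t.toNatTrans.app x) ((leftZigzag_eq _ _).symm.trans
      adj.left_triangle)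
    refine Eq.trans ?_ (h.trans (Category.id_comp _))
    exact congrArg (_ ≫ ·) (Category.id_comp _).symm
  right_triangle_components x := by
    have h := congrArg (fun t => t.toNatTrans.app x) ((rightZigzag_eq _ _).symm.trans
      adj.right_triangle)
    refine Eq.trans ?_ (h.trans (Category.id_comp _))
    exact congrArg (_ ≫ ·) (Category.id_comp _).symm

lemma isHomLift_map {A B : M} {f : A ⟶ B} {x y : X.obj} (g : x ⟶ y) (h : X.p.IsHomLift f g) :
    Y.p.IsHomLift f (Φ.map g) :=
  BasedFunctor.preserves_isHomLift Φ f g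

lemma isHomLift_homEquiv {A B : M} {f : A ⟶ B} {x : X.obj} {y : Y.obj} (g : Φ.obj x ⟶ y)
    (h : Y.p.IsHomLift f g) : X.p.IsHomLift f ((baseAdjunction adj).homEquiv x y g) := by
  rw [Adjunction.homEquiv_unit]
  have h₁ : X.p.IsHomLift (𝟙 A) ((baseAdjunction adj).unit.app x) :=
    BasedNatTrans.isHomLift adj.unit ((Φ.w_obj x).symm.trans (IsHomLift.domain_eq Y.p f g))
  have h₂ := isHomLift_map (Φ := Ψ) g h
  have : X.p.IsHomLift (𝟙 A ≫ f) ((baseAdjunction adj).unit.app x ≫ Ψ.map g) := inferInstance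
  rwa [Category.id_comp] at this

lemma isHomLift_homEquiv_symm {A B : M} {f : A ⟶ B} {x : X.obj} {y : Y.obj} (g : x ⟶ Ψ.obj y)
    (h : X.p.IsHomLift f g) : Y.p.IsHomLift f (((baseAdjunction adj).homEquiv x y).symm g) := by
  rw [Adjunction.homEquiv_counit]
  have h₁ : Y.p.IsHomLift (𝟙 B) ((baseAdjunction adj).counit.app y) :=
    BasedNatTrans.isHomLift adj.counit ((Ψ.w_obj y).symm.trans (IsHomLift.codomain_eq X.p f g))
  have h₂ := isHomLift_map (Φ := Φ) g h
  have : Y.p.IsHomLift (f ≫ 𝟙 B) (Φ.map g ≫ (baseAdjunction adj).counit.app y) := inferInstance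
  rwa [Category.comp_id] at this

include adj

lemma isStronglyCocartesian_map {A B : M} {f : A ⟶ B} {x y : X.obj} (κ : x ⟶ y)
    (hκ : X.p.IsStronglyCocartesian f κ) : Y.p.IsStronglyCocartesian f (Φ.map κ) where
  toIsHomLift := isHomLift_map κ hκ.toIsHomLift
  universal_property' {z} g φ hφ := by
    have h₁ := isHomLift_homEquiv adj φ hφ
    have hΦ (t : y ⟶ Ψ.obj z) : Φ.map κ ≫ ((baseAdjunction adj).homEquiv y z).symm t =
        ((baseAdjunction adj).homEquiv x z).symm (κ ≫ t) :=
      (Adjunction.homEquiv_naturality_left_symm (baseAdjunction adj) κ t).symm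
    refine ⟨((baseAdjunction adj).homEquiv y z).symm
      (Functor.IsStronglyCocartesian.map X.p f κ (g := g) rfl
        ((baseAdjunction adj).homEquiv x z φ)),
      ⟨isHomLift_homEquiv_symm adj _ inferInstance, ?_⟩, ?_⟩
    · refine (hΦ _).trans ?_
      rw [Functor.IsStronglyCocartesian.fac X.p f κ]
      exact Equiv.symm_apply_apply _ _
    · rintro t ⟨ht, rfl⟩
      obtain ⟨t, rfl⟩ := ((baseAdjunction adj).homEquiv y z).symm.surjective t
      have ht' := isHomLift_homEquiv adj _ ht
      rw [Equiv.apply_symm_apply] at ht'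
      refine congrArg _ (Functor.IsStronglyCocartesian.ext X.p f κ g ?_)
      rw [Functor.IsStronglyCocartesian.fac X.p f κ]
      exact ((Equiv.apply_symm_apply _ _).symm.trans (congrArg _ (hΦ t).symm))

lemma isStronglyCartesian_map {A B : M} {f : A ⟶ B} {x y : Y.obj} (κ : x ⟶ y)
    (hκ : Y.p.IsStronglyCartesian f κ) : X.p.IsStronglyCartesian f (Ψ.map κ) where
  toIsHomLift := isHomLift_map κ hκ.toIsHomLift
  universal_property' {z} g φ hφ := by
    have h₁ := isHomLift_homEquiv_symm adj φ hφ
    have hΨ (t : Φ.obj z ⟶ x) : (baseAdjunction adj).homEquiv z x t ≫ Ψ.map κ =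
        (baseAdjunction adj).homEquiv z y (t ≫ κ) :=
      (Adjunction.homEquiv_naturality_right (baseAdjunction adj) t κ).symm
    refine ⟨(baseAdjunction adj).homEquiv z x
      (Functor.IsStronglyCartesian.map Y.p f κ (g := g) rfl
        (((baseAdjunction adj).homEquiv z y).symm φ)),
      ⟨isHomLift_homEquiv adj _ inferInstance, ?_⟩, ?_⟩
    · refine (hΨ _).trans ?_
      rw [Functor.IsStronglyCartesian.fac Y.p f κ]
      exact Equiv.apply_symm_apply _ _
    · rintro t ⟨ht, rfl⟩
      obtain ⟨t, rfl⟩ := ((baseAdjunction adj).homEquiv z x).surjective t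
      have ht' := isHomLift_homEquiv_symm adj _ ht
      rw [Equiv.symm_apply_apply] at ht'
      refine congrArg _ (Functor.IsStronglyCartesian.ext Y.p f κ g ?_)
      rw [Functor.IsStronglyCartesian.fac Y.p f κ]
      exact ((Equiv.symm_apply_apply _ _).symm.trans (congrArg _ (hΨ t).symm))

/-- The right adjoint of a functor over `M` preserving a relative left class preserves the right
class. -/
lemma right_le_of_left_le {L R : MorphismProperty X.obj} {L₁ R₁ : MorphismProperty Y.obj}
    {L' R' : MorphismProperty M} (h : IsRelativeWFS X.p L R L' R')
    (h₁ : IsRelativeWFS Y.p L₁ R₁ L' R') (hid : ∀ A, L' (𝟙 A))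
    (hΦ : L ≤ L₁.inverseImage Φ.toFunctor) : R₁ ≤ R.inverseImage Ψ.toFunctor := by
  intro z w g hg
  have hg' := isHomLift_map (Φ := Ψ) g (inferInstance : Y.p.IsHomLift (Y.p.map g) g)
  refine h.right_of_lift hid (f := Y.p.map g) (Ψ.map g) (h₁.map_right _ hg)
    fun v η ψ hη _ hψ fac => ?_
  have _ := isHomLift_map (Φ := Φ) η ‹_›
  have h₂ := isHomLift_homEquiv_symm adj ψ hψ
  have h₃ : Y.p.IsHomLift (𝟙 (Y.p.obj z) ≫ 𝟙 _)
      (((baseAdjunction adj).homEquiv _ _).symm (𝟙 (Ψ.obj z))) := by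
    rw [Category.comp_id]
    exact isHomLift_homEquiv_symm adj _ (IsHomLift.id (Ψ.w_obj z))
  have h₄ : Y.p.IsHomLift (𝟙 (Y.p.obj z) ≫ Y.p.map g) (((baseAdjunction adj).homEquiv _ _).symm ψ) := by
    rwa [Category.id_comp]
  obtain ⟨γ, e₁, e₂, -⟩ := h₁.exists_lift (i := 𝟙 (Y.p.obj z)) (p := Y.p.map g)
    (𝟙 (Y.p.obj z)) (hΦ η hη) hg
    (a := ((baseAdjunction adj).homEquiv _ _).symm (𝟙 (Ψ.obj z)))
    (b := ((baseAdjunction adj).homEquiv _ _).symm ψ) (by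
      refine (Adjunction.homEquiv_naturality_right_symm (baseAdjunction adj) (𝟙 _) g).symm.trans
        (Eq.trans ?_ (Adjunction.homEquiv_naturality_left_symm (baseAdjunction adj) η ψ))
      exact congrArg _ ((Category.id_comp _).trans fac.symm))
  refine ⟨(baseAdjunction adj).homEquiv _ _ γ, ?_, ?_⟩
  · refine (Adjunction.homEquiv_naturality_left (baseAdjunction adj) η γ).symm.trans
      ((congrArg _ e₁).trans (Equiv.apply_symm_apply _ _))
  · refine (Adjunction.homEquiv_naturality_right (baseAdjunction adj) γ g).symm.trans
      ((congrArg _ e₂).trans (Equiv.apply_symm_apply _ _))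

end BasedAdjunction

section
variable {M : Type u} [Category.{v} M] {k : FactorizationKind} {S : MapClasses M}

/-- An adjunction over `M` is a morphism of model fibrations as soon as its left adjoint preserves
cofibrations and trivial cofibrations. -/
lemma isModelFibrationMorphism_of_left (hS : S.IsPreModel) {X Y : BasedCategory.{v, u} M}
    {Φ : X ⟶ Y} {Ψ : Y ⟶ X} (adj : Bicategory.Adjunction Φ Ψ) {T : MapClasses X.obj}
    {U : MapClasses Y.obj} (hX : IsModelFibration k S T X.p) (hY : IsModelFibration k S U Y.p)
    (h₁ : T.cof ≤ U.cof.inverseImage Φ.toFunctor)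
    (h₂ : T.trivCof ≤ U.trivCof.inverseImage Φ.toFunctor) : IsModelFibrationMorphism T U Φ Ψ := by
  have _ := hS.cof
  have _ := hS.W
  exact ⟨⟨h₁, h₂,
      right_le_of_left_le adj hX.wfs_trivCof hY.wfs_trivCof
        (fun A => ⟨S.cof.id_mem A, S.W.id_mem A⟩) h₂,
      right_le_of_left_le adj hX.wfs_trivFib hY.wfs_trivFib (fun A => S.cof.id_mem A) h₁⟩,
    fun _ _ φ hφ => isCocartesianMap_of_isStronglyCocartesian _
      (isStronglyCocartesian_map adj φ hφ),
    fun _ _ φ hφ => isCartesianMap_of_isStronglyCartesian _ (isStronglyCartesian_map adj φ hφ)⟩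

namespace Diagram

lemma trivCof_total_iff (hS : S.IsPreModel) (F : FunPR.{v, u} S k) {X Y : F.1.Total} (g : X ⟶ Y) :
    (F.1.totalClasses S).trivCof g ↔
      S.trivCof g.base ∧ (F.1.at' Y.base).classes.trivCof g.fiber := by
  have h := (isModelCleavage hS F.2.1 F.2.2).trivCof g.base (x := X.fiber) (y := Y.fiber) g.fiber
  have e : F.1.cleavage.co g.base X.fiber ≫ (F.1.cleavage.ι Y.base).map g.fiber = g :=
    (eq_coLift_vert (P := F.1.leftDiagram) g).symm
  exact (mem_congr (F.1.totalClasses S).trivCof e.symm).trans h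

lemma totalLeft_map_fiber {F G : Diagram.{v, u} M k} (α : F ⟶ G) {X Y : F.Total} (g : X ⟶ Y) :
    ∃ e : (G.push g.base).obj ((ModCat.left (α.app ⟨X.base⟩)).obj X.fiber) ⟶
        (ModCat.left (α.app ⟨Y.base⟩)).obj ((F.push g.base).obj X.fiber), IsIso e ∧
      ((totalLeft (leftTrans α)).map g).fiber =
        e ≫ (ModCat.left (α.app ⟨Y.base⟩)).map g.fiber :=
  ⟨(Cat.Hom.toNatIso ((leftTrans α).naturality g.base.toLoc)).inv.app X.fiber,
    inferInstanceAs (IsIso ((Cat.Hom.toNatIso ((leftTrans α).naturality g.base.toLoc)).app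
      X.fiber).inv), rfl⟩

theorem isModelFibrationMorphism_totalAdj (hS : S.IsPreModel) {F G : FunPR.{v, u} S k}
    (α : F ⟶ G) : IsModelFibrationMorphism (F.1.totalClasses S) (G.1.totalClasses S)
      (Diagram.totalAdj α.hom).l (Diagram.totalAdj α.hom).r := by
  refine isModelFibrationMorphism_of_left hS (Diagram.totalAdj α.hom).adj
    (isModelFibration_total hS F) (isModelFibration_total hS G) ?_ ?_
  · rintro X Y g ⟨h₁, h₂⟩
    obtain ⟨e, hi, he⟩ := totalLeft_map_fiber α.hom g
    have hm := (G.1.at' Y.base).isModel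
    refine ⟨h₁, (mem_congr (G.1.at' Y.base).classes.cof he).mpr ?_⟩
    exact hm.cof_comp (hm.iso_cof _ hi) ((α.hom.app ⟨Y.base⟩).mem.cof _ h₂)
  · intro X Y g hg
    obtain ⟨h₁, h₂⟩ := (trivCof_total_iff hS F g).1 hg
    obtain ⟨e, hi, he⟩ := totalLeft_map_fiber α.hom g
    have hm := (G.1.at' Y.base).isModel
    refine (trivCof_total_iff hS G _).2 ⟨h₁, (mem_congr (G.1.at' Y.base).classes.trivCof he).mpr ?_⟩
    exact hm.trivCof_comp ⟨hm.iso_cof _ hi, hm.iso_W _ hi⟩ ((α.hom.app ⟨Y.base⟩).mem.trivCof _ h₂)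

end Diagram
end

section TotalMaps
universe v₂ u₂
variable {M : Type u} [Category.{v} M] {P Q : LocallyDiscrete M ⥤ᵖ Cat.{v₂, u₂}}

lemma totalLeft_coLift (θ : P ⟶ Q) {A B : M} (f : A ⟶ B) (x : P.obj ⟨A⟩) :
    (totalLeft θ).map (coLift P f x) = coLift Q f ((θ.app ⟨A⟩).toFunctor.obj x) ≫
      vert Q ((Cat.Hom.toNatIso (θ.naturality f.toLoc)).inv.app x) := by
  refine Eq.trans ?_ (coLift_vert (P := Q) (x := (θ.app ⟨A⟩).toFunctor.obj x) _).symm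
  refine congrArg (Pseudofunctor.Grothendieck.Hom.mk (X := (⟨A, _⟩ : Q.Grothendieck))
    (Y := ⟨B, _⟩) f) ?_
  refine (congrArg (_ ≫ ·) (CategoryTheory.Functor.map_id (θ.app ⟨B⟩).toFunctor _)).trans ?_
  exact Category.comp_id _

/-- A natural isomorphism between functors induced on Grothendieck constructions which lies over
identities comes from an invertible modification. -/
lemma exists_iso_of_totalIso {θ θ' : P ⟶ Q} (a : totalLeft θ ≅ totalLeft θ')
    (ha : ∀ x, (a.hom.app x).base = 𝟙 _) :
    ∃ γ : ∀ A, (θ.app A).toFunctor ≅ (θ'.app A).toFunctor,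
      (∀ (A : M) (x : P.obj ⟨A⟩), vert Q ((γ ⟨A⟩).hom.app x) = a.hom.app ⟨A, x⟩) ∧
      ∀ {A B : LocallyDiscrete M} (f : A ⟶ B) (x : P.obj A),
        (γ B).hom.app ((P.map f).toFunctor.obj x) ≫
          (Cat.Hom.toNatIso (θ'.naturality f)).hom.app x =
        (Cat.Hom.toNatIso (θ.naturality f)).hom.app x ≫
          (Q.map f).toFunctor.map ((γ A).hom.app x) := by
  have ha' (x) : (a.inv.app x).base = 𝟙 _ := by
    have h₁ : (a.hom.app x).base ≫ (a.inv.app x).base = 𝟙 _ :=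
      congrArg Pseudofunctor.Grothendieck.Hom.base (a.hom_inv_id_app x)
    rw [ha] at h₁
    exact (Category.id_comp _).symm.trans h₁
  choose φ hφ using fun (A : M) (x : P.obj ⟨A⟩) =>
    exists_vert (x := (θ.app ⟨A⟩).toFunctor.obj x) (y := (θ'.app ⟨A⟩).toFunctor.obj x)
      (a.hom.app ⟨A, x⟩) (ha _)
  choose ψ hψ using fun (A : M) (x : P.obj ⟨A⟩) =>
    exists_vert (x := (θ'.app ⟨A⟩).toFunctor.obj x) (y := (θ.app ⟨A⟩).toFunctor.obj x)
      (a.inv.app ⟨A, x⟩) (ha' _)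
  let e (A : LocallyDiscrete M) : (θ.app A).toFunctor ≅ (θ'.app A).toFunctor :=
    NatIso.ofComponents (fun x =>
      { hom := φ A.as x
        inv := ψ A.as x
        hom_inv_id := vert_injective ((vert_vert _ _).symm.trans (Eq.trans (by
          rw [hφ, hψ]; exact a.hom_inv_id_app _) (vert_id _).symm))
        inv_hom_id := vert_injective ((vert_vert _ _).symm.trans (Eq.trans (by
          rw [hφ, hψ]; exact a.inv_hom_id_app _) (vert_id _).symm)) })
      (fun {x y} g => vert_injective (by
        refine (vert_vert _ _).symm.trans (Eq.trans ?_ (vert_vert _ _))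
        have h := a.hom.naturality (vert P g)
        rw [hφ, hφ]
        exact (congrArg (· ≫ _) (map_vert θ g).symm).trans
          (h.trans (congrArg (_ ≫ ·) (map_vert θ' g)))))
  refine ⟨e, hφ, fun {A B} f x => ?_⟩
  have h := a.hom.naturality (coLift P f.as x)
  have h₁ : (coLift Q f.as ((θ.app A).toFunctor.obj x) ≫
      vert Q ((Cat.Hom.toNatIso (θ.naturality f)).inv.app x)) ≫ vert Q (φ B.as _) =
      vert Q (φ A.as x) ≫ coLift Q f.as ((θ'.app A).toFunctor.obj x) ≫
        vert Q ((Cat.Hom.toNatIso (θ'.naturality f)).inv.app x) := by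
    rw [hφ, hφ]
    exact (congrArg (· ≫ _) (totalLeft_coLift θ f.as x).symm).trans
      (h.trans (congrArg (_ ≫ ·) (totalLeft_coLift θ' f.as x)))
  have h₂ : (Cat.Hom.toNatIso (θ.naturality f)).inv.app x ≫ φ B.as _ =
      (Q.map f).toFunctor.map (φ A.as x) ≫ (Cat.Hom.toNatIso (θ'.naturality f)).inv.app x := by
    apply coLift_vert_cancel (f := f.as)
    refine (congrArg (_ ≫ ·) (vert_vert _ _)).symm.trans ((Category.assoc _ _ _).symm.trans
      (h₁.trans ((Category.assoc _ _ _).symm.trans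
        ((congrArg (· ≫ _) (vert_coLift f.as (φ A.as x))).trans ((Category.assoc _ _ _).trans
          (congrArg (_ ≫ ·) (vert_vert _ _)))))))
  have h₃ : φ B.as _ = (Cat.Hom.toNatIso (θ.naturality f)).hom.app x ≫
      (Q.map f).toFunctor.map (φ A.as x) ≫ (Cat.Hom.toNatIso (θ'.naturality f)).inv.app x := by
    rw [← h₂]
    exact ((Cat.Hom.toNatIso (θ.naturality f)).hom_inv_id_app_assoc x _).symm
  refine (congrArg (· ≫ _) h₃).trans ?_
  refine (Category.assoc _ _ _).trans (congrArg (_ ≫ ·) ((Category.assoc _ _ _).trans ?_))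
  exact (congrArg (_ ≫ ·) ((Cat.Hom.toNatIso (θ'.naturality f)).inv_hom_id_app x)).trans
    (Category.comp_id _)

end TotalMaps

section ModCat
variable {k : FactorizationKind} {X Y : ModCat.{v, u} k}

/-- An isomorphism of left Quillen functors as a 2-cell. -/
def ModCat.isoMk {f g : X ⟶ Y} (e : ModCat.left f ≅ ModCat.left g) : f ≅ g :=
  SubTwoOne.isoMk (Diagram.adjIso (Cat.Hom.isoMk e))

lemma ModCat.hom₂_ext {f g : X ⟶ Y} {a b : f ⟶ g}
    (h : ∀ x, (ModCat.leftHom a).toNatTrans.app x = (ModCat.leftHom b).toNatTrans.app x) :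
    a = b :=
  SubTwoOne.hom₂_ext (Adj.hom₂_ext (Cat.Hom₂.ext (NatTrans.ext (funext h))))

end ModCat

section TwoCells
variable {k : FactorizationKind} {M : Type u} [Category.{v} M] {S : MapClasses M}

lemma faithful_mapFunctor_integral
    (hobj : ∀ F : FunPR.{v, u} S k, IsModelFibration k S (F.1.totalClasses S) F.1.totalBased.p)
    (hmap : ∀ {F G : FunPR.{v, u} S k} (α : F ⟶ G),
      IsModelFibrationMorphism (F.1.totalClasses S) (G.1.totalClasses S)
        (Diagram.totalAdj α.hom).l (Diagram.totalAdj α.hom).r) (F G : FunPR.{v, u} S k) :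
    ((integral k S hobj hmap).toPrelaxFunctor.mapFunctor F G).Faithful where
  map_injective {α β Γ Γ'} h := by
    refine InducedBicategory.hom₂_ext (Pseudofunctor.StrongTrans.homCategory.ext fun A => ?_)
    refine ModCat.hom₂_ext fun x => ?_
    have hc : component ((integral k S hobj hmap).map₂ Γ) ⟨A.as, x⟩ =
      component ((integral k S hobj hmap).map₂ Γ') ⟨A.as, x⟩ := congrArg (component · _) h
    exact vert_injective (P := G.1.leftDiagram) (A := A.as) hc

lemma full_mapFunctor_integral
    (hobj : ∀ F : FunPR.{v, u} S k, IsModelFibration k S (F.1.totalClasses S) F.1.totalBased.p)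
    (hmap : ∀ {F G : FunPR.{v, u} S k} (α : F ⟶ G),
      IsModelFibrationMorphism (F.1.totalClasses S) (G.1.totalClasses S)
        (Diagram.totalAdj α.hom).l (Diagram.totalAdj α.hom).r) (F G : FunPR.{v, u} S k) :
    ((integral k S hobj hmap).toPrelaxFunctor.mapFunctor F G).Full where
  map_surjective {α β} a := by
    let a' : totalLeft (Diagram.leftTrans α.hom) ≅ totalLeft (Diagram.leftTrans β.hom) :=
      NatIso.ofComponents (fun x =>
        { hom := (SubTwoOne.Hom₂.iso a).hom.τl.app x
          inv := (SubTwoOne.Hom₂.iso a).inv.τl.app x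
          hom_inv_id := congrArg (fun t => t.τl.app x) (SubTwoOne.Hom₂.iso a).hom_inv_id
          inv_hom_id := congrArg (fun t => t.τl.app x) (SubTwoOne.Hom₂.iso a).inv_hom_id })
        (fun g => (SubTwoOne.Hom₂.iso a).hom.τl.naturality g)
    have ha (x) : (a'.hom.app x).base = 𝟙 _ :=
      base_eq_of_isHomLift _ _ ((SubTwoOne.Hom₂.iso a).hom.τl.isHomLift' x)
    obtain ⟨γ, h₁, h₂⟩ := exists_iso_of_totalIso a' ha
    let Γ : α.hom ⟶ β.hom := .of
      { app := fun A => (ModCat.isoMk (γ A)).hom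
        naturality := fun f => ModCat.hom₂_ext fun x => h₂ f x }
    exact ⟨InducedBicategory.Hom₂.mk Γ, ext_component fun x => h₁ x.base x.fiber⟩

end TwoCells
namespace BiCleavage
universe v₁ u₁ u' w w'
variable {M : Type u₁} [Category.{v₁} M] {N : Type u} [Category.{v} N] {N' : Type w} [Category.{v} N']
  {π : N ⥤ M} {E : M → Type u'} [∀ A, Category.{v} (E A)] (c : BiCleavage π E)
  {π' : N' ⥤ M} {E' : M → Type w'} [∀ A, Category.{v} (E' A)] (c' : BiCleavage π' E')
  (L : N ⥤ N') (R : N' ⥤ N)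

/-- The map of a fibre with given image in the total category. -/
noncomputable def preimage {A : M} {x y : E A} (g : (c.ι A).obj x ⟶ (c.ι A).obj y)
    (hg : π.IsHomLift (𝟙 A) g) : x ⟶ y :=
  (c.exists_map g).choose

@[simp] lemma map_preimage {A : M} {x y : E A} (g : (c.ι A).obj x ⟶ (c.ι A).obj y)
    (hg : π.IsHomLift (𝟙 A) g) : (c.ι A).map (c.preimage g hg) = g :=
  (c.exists_map g).choose_spec

/-- A functor between the fibres over `A` isomorphic to the restriction of `L`. -/
structure FiberFunctor (A : M) where
  H : E A ⥤ E' A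
  σ (x : E A) : (c'.ι A).obj (H.obj x) ≅ L.obj ((c.ι A).obj x)
  isHomLift_hom (x : E A) : π'.IsHomLift (𝟙 A) (σ x).hom
  isHomLift_inv (x : E A) : π'.IsHomLift (𝟙 A) (σ x).inv
  nat {x y : E A} (φ : x ⟶ y) :
    (c'.ι A).map (H.map φ) ≫ (σ y).hom = (σ x).hom ≫ L.map ((c.ι A).map φ)

namespace FiberFunctor
attribute [instance] isHomLift_hom isHomLift_inv
variable {c c' L R} {A : M} (h : FiberFunctor c c' L A) (h' : FiberFunctor c' c R A)

lemma inv_nat {x y : E A} (φ : x ⟶ y) :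
    (h.σ x).inv ≫ (c'.ι A).map (h.H.map φ) = L.map ((c.ι A).map φ) ≫ (h.σ y).inv := by
  rw [Iso.inv_comp_eq, ← Category.assoc, Iso.eq_comp_inv, h.nat]

variable (adj : L ⊣ R)
  (h₁ : ∀ ⦃A B : M⦄ (f : A ⟶ B) ⦃x : N⦄ ⦃y : N'⦄ (g : L.obj x ⟶ y), π'.IsHomLift f g →
    π.IsHomLift f (adj.homEquiv x y g))
  (h₂ : ∀ ⦃A B : M⦄ (f : A ⟶ B) ⦃x : N⦄ ⦃y : N'⦄ (g : x ⟶ R.obj y), π.IsHomLift f g →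
    π'.IsHomLift f ((adj.homEquiv x y).symm g))

include h₁ in
lemma isHomLift_aux {x : E A} {y : E' A} (φ : h.H.obj x ⟶ y) : π.IsHomLift (𝟙 A)
    (adj.homEquiv _ _ ((h.σ x).inv ≫ (c'.ι A).map φ) ≫ (h'.σ y).inv) := by
  have := h₁ (𝟙 A) ((h.σ x).inv ≫ (c'.ι A).map φ) inferInstance
  infer_instance

include h₂ in
lemma isHomLift_aux' {x : E A} {y : E' A} (ψ : x ⟶ h'.H.obj y) : π'.IsHomLift (𝟙 A)
    ((h.σ x).hom ≫ (adj.homEquiv _ _).symm ((c.ι A).map ψ ≫ (h'.σ y).hom)) := by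
  have := h₂ (𝟙 A) ((c.ι A).map ψ ≫ (h'.σ y).hom) inferInstance
  infer_instance

/-- The adjunction between fibres induced by an adjunction over the base. -/
noncomputable def adjunction : h.H ⊣ h'.H :=
  Adjunction.mkOfHomEquiv
    { homEquiv x y :=
        { toFun φ := c.preimage _ (h.isHomLift_aux h' adj h₁ φ)
          invFun ψ := c'.preimage _ (h.isHomLift_aux' h' adj h₂ ψ)
          left_inv φ := c'.map_injective (by simp)
          right_inv ψ := c.map_injective (by simp) }
      homEquiv_naturality_left_symm f g := c'.map_injective (by
        simp [adj.homEquiv_naturality_left_symm, reassoc_of% h.nat])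
      homEquiv_naturality_right f g := c.map_injective (by
        have := h'.inv_nat g
        simp [this, adj.homEquiv_naturality_right]) }

end FiberFunctor

lemma exists_fiberFunctor (hL : ∀ ⦃A B : M⦄ (f : A ⟶ B) ⦃x y : N⦄ (g : x ⟶ y), π.IsHomLift f g →
    π'.IsHomLift f (L.map g)) (A : M) : Nonempty (FiberFunctor c c' L A) := by
  have hex (x : E A) : ∃ y, (c'.ι A).obj y = L.obj ((c.ι A).obj x) := by
    have := hL (𝟙 A) ((c.ι A).map (𝟙 x)) inferInstance
    exact c'.exists_obj _ (IsHomLift.domain_eq π' (𝟙 A) (L.map ((c.ι A).map (𝟙 x))))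
  choose H hH using hex
  have hσ (x : E A) : π'.IsHomLift (𝟙 A) (eqToHom (hH x)) :=
    IsHomLift.eqToHom_domain_lift_id (hH x) (c'.obj_ι _)
  have hσ' (x : E A) : π'.IsHomLift (𝟙 A) (eqToHom (hH x).symm) :=
    IsHomLift.eqToHom_codomain_lift_id (hH x).symm (c'.obj_ι _)
  have hm {x y : E A} (φ : x ⟶ y) : π'.IsHomLift (𝟙 A)
      (eqToHom (hH x) ≫ L.map ((c.ι A).map φ) ≫ eqToHom (hH y).symm) := by
    have := hL (𝟙 A) ((c.ι A).map φ) inferInstance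
    infer_instance
  exact ⟨{
    H :=
      { obj := H
        map := fun φ => c'.preimage _ (hm φ)
        map_id := fun x => c'.map_injective (by simp)
        map_comp := fun φ ψ => c'.map_injective (by simp) }
    σ := fun x => eqToIso (hH x)
    isHomLift_hom := hσ
    isHomLift_inv := hσ'
    nat := fun φ => by simp }⟩

variable {c c' L} (h : ∀ A, FiberFunctor c c' L A)
  (hL : ∀ ⦃A B : M⦄ (f : A ⟶ B) ⦃x y : N⦄ (g : x ⟶ y), π.IsStronglyCocartesian f g →
    π'.IsStronglyCocartesian f (L.map g))

include hL in
lemma exists_pushIso {A B : M} (f : A ⟶ B) :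
    ∃ n : c.push f ⋙ (h B).H ≅ (h A).H ⋙ c'.push f, ∀ x,
      c'.co f ((h A).H.obj x) ≫ (c'.ι B).map (n.inv.app x) ≫ ((h B).σ _).hom =
        ((h A).σ x).hom ≫ L.map (c.co f x) := by
  have hκ (x : E A) : π'.IsStronglyCocartesian f
      (((h A).σ x).hom ≫ L.map (c.co f x) ≫ ((h B).σ _).inv) := by
    have := hL f (c.co f x) inferInstance
    have := Functor.IsStronglyCocartesian.of_iso π' (𝟙 A) ((h A).σ x)
    have : π'.IsHomLift (𝟙 B) ((h B).σ ((c.push f).obj x)).symm.hom := (h B).isHomLift_inv _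
    have := Functor.IsStronglyCocartesian.of_iso π' (𝟙 B) ((h B).σ ((c.push f).obj x)).symm
    have : π'.IsStronglyCocartesian (𝟙 A ≫ f ≫ 𝟙 B)
      (((h A).σ x).hom ≫ L.map (c.co f x) ≫ ((h B).σ _).symm.hom) := inferInstance
    rwa [Category.comp_id, Category.id_comp] at this
  choose e he using fun x => @exists_iso_co _ _ _ _ _ _ _ c' _ _ f _ _ _ (hκ x)
  refine ⟨(NatIso.ofComponents (fun x => e x) fun {x y} φ => ?_).symm, fun x => ?_⟩
  · apply c'.co_map_cancel
    have h₁ := (h A).nat φ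
    have h₂ := (h B).inv_nat ((c.push f).map φ)
    have h₃ := congrArg L.map (c.map_co f φ)
    rw [Functor.map_comp, Functor.map_comp] at h₃
    simp only [Functor.map_comp, Functor.comp_map]
    rw [← reassoc_of% c'.map_co, he, reassoc_of% he, h₂, reassoc_of% h₁, reassoc_of% h₃]
  · have := he x
    rw [← Category.assoc, Iso.eq_comp_inv, Category.assoc] at this
    exact this

variable {h}

lemma pushIso_id {A : M} {x : E A}
    {n : (h A).H.obj ((c.push (𝟙 A)).obj x) ≅ (c'.push (𝟙 A)).obj ((h A).H.obj x)}
    (hn : c'.co (𝟙 A) ((h A).H.obj x) ≫ (c'.ι A).map n.inv ≫ ((h A).σ _).hom =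
        ((h A).σ x).hom ≫ L.map (c.co (𝟙 A) x)) {i : (c.push (𝟙 A)).obj x ⟶ x}
    {i' : (c'.push (𝟙 A)).obj ((h A).H.obj x) ⟶ (h A).H.obj x}
    (hi : c.co (𝟙 A) x ≫ (c.ι A).map i = 𝟙 _) (hi' : c'.co (𝟙 A) _ ≫ (c'.ι A).map i' = 𝟙 _) :
    n.hom ≫ i' = (h A).H.map i := by
  rw [← Iso.eq_inv_comp]
  apply c'.co_map_cancel
  rw [hi', ← cancel_mono ((h A).σ x).hom, Functor.map_comp, Category.assoc, Category.assoc,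
    (h A).nat, reassoc_of% hn, ← L.map_comp, hi]
  simp

lemma pushIso_comp {A B C : M} {f : A ⟶ B} {g : B ⟶ C} {x : E A}
    {n : (h B).H.obj ((c.push f).obj x) ≅ (c'.push f).obj ((h A).H.obj x)}
    {n' : (h C).H.obj ((c.push g).obj ((c.push f).obj x)) ≅
      (c'.push g).obj ((h B).H.obj ((c.push f).obj x))}
    {n'' : (h C).H.obj ((c.push (f ≫ g)).obj x) ≅ (c'.push (f ≫ g)).obj ((h A).H.obj x)}
    (hn : c'.co f ((h A).H.obj x) ≫ (c'.ι B).map n.inv ≫ ((h B).σ _).hom =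
        ((h A).σ x).hom ≫ L.map (c.co f x))
    (hn' : c'.co g _ ≫ (c'.ι C).map n'.inv ≫ ((h C).σ _).hom =
        ((h B).σ _).hom ≫ L.map (c.co g _))
    (hn'' : c'.co (f ≫ g) ((h A).H.obj x) ≫ (c'.ι C).map n''.inv ≫ ((h C).σ _).hom =
        ((h A).σ x).hom ≫ L.map (c.co (f ≫ g) x))
    {m : (c.push (f ≫ g)).obj x ⟶ (c.push g).obj ((c.push f).obj x)}
    {m' : (c'.push (f ≫ g)).obj ((h A).H.obj x) ⟶ (c'.push g).obj ((c'.push f).obj ((h A).H.obj x))}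
    (hm : c.co (f ≫ g) x ≫ (c.ι C).map m = c.co f x ≫ c.co g _)
    (hm' : c'.co (f ≫ g) _ ≫ (c'.ι C).map m' = c'.co f _ ≫ c'.co g _) :
    n''.hom ≫ m' = (h C).H.map m ≫ n'.hom ≫ (c'.push g).map n.hom := by
  have key : m' ≫ (c'.push g).map n.inv ≫ n'.inv = n''.inv ≫ (h C).H.map m := by
    apply c'.co_map_cancel
    rw [← cancel_mono ((h C).σ _).hom]
    simp only [Functor.map_comp, Category.assoc]
    rw [(h C).nat, reassoc_of% hn'', ← L.map_comp, hm, reassoc_of% hm', ← reassoc_of% c'.map_co,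
      hn', reassoc_of% hn, ← L.map_comp]
  rw [Iso.eq_inv_comp] at key
  rw [← key]
  simp [← Functor.map_comp]

end BiCleavage
/-- An isomorphism of arrows exhibits a retract. -/
lemma nonempty_retractArrow_of_iso {C : Type*} [Category C] {X Y X' Y' : C} {f : X ⟶ Y} {g : X' ⟶ Y'}
    (e₁ : X ≅ X') (e₂ : Y ≅ Y') (h : f ≫ e₂.hom = e₁.hom ≫ g) : Nonempty (RetractArrow f g) :=
  ⟨{ i := Arrow.homMk e₁.hom e₂.hom h.symm
     r := Arrow.homMk e₁.inv e₂.inv (by simp [Iso.inv_comp_eq, ← reassoc_of% h])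
     retract := by ext <;> simp }⟩

section
universe v₁ u₁ u' w w'
variable {M : Type u₁} [Category.{v₁} M] {N : Type u} [Category.{v} N] {N' : Type w} [Category.{v} N']
  {π : N ⥤ M} {E : M → Type u'} [∀ A, Category.{v} (E A)] {c : BiCleavage π E}
  {π' : N' ⥤ M} {E' : M → Type w'} [∀ A, Category.{v} (E' A)] {c' : BiCleavage π' E'}
  {L : N ⥤ N'} {k : FactorizationKind} {S : MapClasses M} {Sf : ∀ A, MapClasses (E A)}
  {T : MapClasses N} {Sf' : ∀ A, MapClasses (E' A)} {T' : MapClasses N'}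

lemma BiCleavage.FiberFunctor.isQuillenPair (hc : c.IsModelCleavage k S Sf T)
    (hc' : c'.IsModelCleavage k S Sf' T') (h₁ : T.cof ≤ T'.cof.inverseImage L)
    (h₂ : T.trivCof ≤ T'.trivCof.inverseImage L) {A : M} (h : FiberFunctor c c' L A)
    {G : E' A ⥤ E A} (adj : h.H ⊣ G) : IsQuillenPair (Sf A) (Sf' A) h.H G := by
  have _ := hc.base.cof
  have _ := hc.base.W
  refine isQuillenPair_of_left (hc.model A) adj (fun x y φ hφ => ?_) (fun x y φ hφ => ?_) (hc'.model A)
  · have hφ' := h₁ _ ((hc.cof_map_iff φ).2 hφ)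
    exact (hc'.cof_map_iff _).1 (hc'.wfs_trivFib.retract_left _ _
      (nonempty_retractArrow_of_iso (h.σ x) (h.σ y) (h.nat φ)) hφ'
      ((mem_map_iff_of_isHomLift _ (𝟙 A) _).2 (S.cof.id_mem A)))
  · have hφ' := h₂ _ ⟨(hc.cof_map_iff φ).2 hφ.1, (hc.W_map_iff φ).2 hφ.2⟩
    have := hc'.wfs_trivCof.retract_left _ _
      (nonempty_retractArrow_of_iso (h.σ x) (h.σ y) (h.nat φ)) hφ'
      ((mem_map_iff_of_isHomLift _ (𝟙 A) _).2 ⟨S.cof.id_mem A, S.W.id_mem A⟩)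
    exact ⟨(hc'.cof_map_iff _).1 this.1, (hc'.W_map_iff _).1 this.2⟩

end

section OneCells
variable {k : FactorizationKind} {M : Type u} [Category.{v} M] {S : MapClasses M}

/-- A Quillen adjunction as a 1-cell. -/
def ModCat.homMk {X Y : ModCat.{v, u} k} (L : X.cat ⥤ Y.cat) (R : Y.cat ⥤ X.cat) (adj : L ⊣ R)
    (h : IsQuillenPair X.classes Y.classes L R) : X ⟶ Y :=
  SubTwoOne.Hom.mk (Adj.Hom.mk (l := L.toCatHom) (r := R.toCatHom) adj.toCat) h

namespace Diagram

lemma coLift_mapId {F : Diagram.{v, u} M k} (A : M) (x : (F.at' A).cat) :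
    F.cleavage.co (𝟙 A) x ≫ (F.cleavage.ι A).map
      ((ModCat.leftHom (F.mapId ⟨A⟩).hom).toNatTrans.app x) = 𝟙 _ := by
  refine (coLift_vert (P := F.leftDiagram) (x := x) (y := x) _).trans (Eq.trans ?_
    (vert_id (P := F.leftDiagram) x))
  exact congrArg (Pseudofunctor.Grothendieck.Hom.mk _) (Category.comp_id _).symm

lemma coLift_mapComp {F : Diagram.{v, u} M k} {A B C : M} (f : A ⟶ B) (g : B ⟶ C)
    (x : (F.at' A).cat) :
    F.cleavage.co (f ≫ g) x ≫ (F.cleavage.ι C).map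
      ((ModCat.leftHom (F.mapComp f.toLoc g.toLoc).hom).toNatTrans.app x) =
    F.cleavage.co f x ≫ F.cleavage.co g _ := by
  refine (coLift_vert (P := F.leftDiagram) (x := x) _).trans (Eq.trans ?_
    (coLift_mkHom (P := F.leftDiagram) f x (Z := ⟨C, (F.push g).obj ((F.push f).obj x)⟩) g
      (𝟙 ((F.push g).obj ((F.push f).obj x)))).symm)
  exact congrArg (Pseudofunctor.Grothendieck.Hom.mk _) (Category.comp_id _).symm

/-- A pseudonatural transformation from adjunctions between the fibres. -/
lemma exists_trans {F G : Diagram.{v, u} M k} {L : F.Total ⥤ G.Total}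
    (h : ∀ A, BiCleavage.FiberFunctor F.cleavage G.cleavage L A)
    (hL : ∀ ⦃A B : M⦄ (f : A ⟶ B) ⦃x y : F.Total⦄ (g : x ⟶ y),
      F.totalBased.p.IsStronglyCocartesian f g → G.totalBased.p.IsStronglyCocartesian f (L.map g))
    (R : ∀ A, (G.at' A).cat ⥤ (F.at' A).cat) (adj : ∀ A, (h A).H ⊣ R A)
    (hQ : ∀ A, IsQuillenPair (F.at' A).classes (G.at' A).classes (h A).H (R A)) :
    ∃ α : F ⟶ G, Nonempty { e : totalLeft (leftTrans α) ≅ L //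
      ∀ x, G.totalBased.p.IsHomLift (𝟙 (F.totalBased.p.obj x)) (e.hom.app x) } := by
  choose n hn using fun (A B : M) (f : A ⟶ B) => BiCleavage.exists_pushIso h hL f
  let α : F ⟶ G :=
    { app := fun A => ModCat.homMk (h A.as).H (R A.as) (adj A.as) (hQ A.as)
      naturality := fun {A B} f => ModCat.isoMk (n A.as B.as f.as)
      naturality_naturality := fun {A B f g} η => by
        obtain rfl := LocallyDiscrete.eq_of_hom η
        obtain rfl : η = 𝟙 f := Subsingleton.elim _ _
        simp
      naturality_id := fun A => ModCat.hom₂_ext fun x => by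
        refine Eq.trans ?_ (congrArg (_ ≫ ·) (Category.comp_id (𝟙 _))).symm
        refine Eq.trans ?_ (Category.comp_id _).symm
        exact BiCleavage.pushIso_id (h := h) (n := (n A.as A.as (𝟙 _)).app x) (hn _ _ _ x)
          (coLift_mapId _ x) (coLift_mapId _ _)
      naturality_comp := fun {A B C} f g => ModCat.hom₂_ext fun x => by
        refine (BiCleavage.pushIso_comp (h := h) (n := (n A.as B.as f.as).app x)
          (n' := (n B.as C.as g.as).app ((F.push f.as).obj x))
          (n'' := (n A.as C.as (f.as ≫ g.as)).app x) (hn _ _ _ x) (hn _ _ _ _) (hn _ _ _ x)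
          (coLift_mapComp f.as g.as x) (coLift_mapComp f.as g.as _)).trans ?_
        refine congrArg (_ ≫ ·) ?_
        refine Eq.trans ?_ (Category.id_comp _).symm
        refine congrArg (_ ≫ ·) ?_
        refine Eq.trans ?_ (Category.id_comp _).symm
        exact (Category.comp_id _).symm }
  refine ⟨α, ⟨⟨NatIso.ofComponents (fun x => (h x.base).σ x.fiber) fun {x y} g => ?_,
    fun x => (h x.base).isHomLift_hom x.fiber⟩⟩⟩
  have hg := eq_coLift_vert (P := F.leftDiagram) g
  have h₁ : (totalLeft (leftTrans α)).map (coLift F.leftDiagram g.base x.fiber) ≫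
      ((h y.base).σ ((F.push g.base).obj x.fiber)).hom =
      ((h x.base).σ x.fiber).hom ≫ L.map (coLift F.leftDiagram g.base x.fiber) := by
    refine (congrArg (· ≫ _) (totalLeft_coLift (leftTrans α) g.base x.fiber)).trans ?_
    exact (Category.assoc _ _ _).trans (hn _ _ g.base x.fiber)
  have h₂ : (totalLeft (leftTrans α)).map (vert F.leftDiagram g.fiber) ≫
      ((h y.base).σ y.fiber).hom =
      ((h y.base).σ ((F.push g.base).obj x.fiber)).hom ≫ L.map (vert F.leftDiagram g.fiber) := by
    refine (congrArg (· ≫ _) (map_vert (leftTrans α) g.fiber)).trans ?_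
    exact (h y.base).nat g.fiber
  rw [hg]
  refine (congrArg (· ≫ _) ((totalLeft (leftTrans α)).map_comp _ _)).trans
    ((Category.assoc _ _ _).trans ((congrArg (_ ≫ ·) h₂).trans ((Category.assoc _ _ _).symm.trans
      ((congrArg (· ≫ _) h₁).trans ((Category.assoc _ _ _).trans
        (congrArg (_ ≫ ·) (L.map_comp _ _).symm))))))

end Diagram

lemma essSurj_mapFunctor_integral (hS : S.IsPreModel)
    (hobj : ∀ F : FunPR.{v, u} S k, IsModelFibration k S (F.1.totalClasses S) F.1.totalBased.p)
    (hmap : ∀ {F G : FunPR.{v, u} S k} (α : F ⟶ G),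
      IsModelFibrationMorphism (F.1.totalClasses S) (G.1.totalClasses S)
        (Diagram.totalAdj α.hom).l (Diagram.totalAdj α.hom).r) (F G : FunPR.{v, u} S k) :
    ((integral k S hobj hmap).toPrelaxFunctor.mapFunctor F G).EssSurj where
  mem_essImage Φ := by
    have adj := (SubTwoOne.Hom.cell Φ).adj
    have hΦ : IsModelFibrationMorphism (F.1.totalClasses S) (G.1.totalClasses S)
      (SubTwoOne.Hom.cell Φ).l (SubTwoOne.Hom.cell Φ).r := Φ.mem
    have h (A : M) : BiCleavage.FiberFunctor F.1.cleavage G.1.cleavage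
        (SubTwoOne.Hom.cell Φ).l.toFunctor A :=
      (BiCleavage.exists_fiberFunctor _ _ _
        (fun _ _ _ _ _ g hg => isHomLift_map (Φ := (SubTwoOne.Hom.cell Φ).l) g hg) A).some
    have h' (A : M) : BiCleavage.FiberFunctor G.1.cleavage F.1.cleavage
        (SubTwoOne.Hom.cell Φ).r.toFunctor A :=
      (BiCleavage.exists_fiberFunctor _ _ _
        (fun _ _ _ _ _ g hg => isHomLift_map (Φ := (SubTwoOne.Hom.cell Φ).r) g hg) A).some
    have hadj (A : M) : (h A).H ⊣ (h' A).H := (h A).adjunction (h' A) (baseAdjunction adj)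
      (fun _ _ _ _ _ g hg => isHomLift_homEquiv adj g hg)
      (fun _ _ _ _ _ g hg => isHomLift_homEquiv_symm adj g hg)
    obtain ⟨α, ⟨e, he⟩⟩ := Diagram.exists_trans h
      (fun _ _ _ _ _ g hg => isStronglyCocartesian_map adj g hg) (fun A => (h' A).H) hadj
      (fun A => (h A).isQuillenPair (Diagram.isModelCleavage hS F.2.1 F.2.2)
        (Diagram.isModelCleavage hS G.2.1 G.2.2) hΦ.quillen.cof hΦ.quillen.trivCof (hadj A))
    exact ⟨InducedBicategory.mkHom α, ⟨SubTwoOne.isoMk (Diagram.adjIso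
      (BasedNatIso.mkNatIso e he))⟩⟩

end OneCells
namespace BiCleavage

section
universe v₁ u₁ u'
variable {M : Type u₁} [Category.{v₁} M] {N : Type u} [Category.{v} N]
  {π : N ⥤ M} {E : M → Type u'} [∀ A, Category.{v} (E A)] (c : BiCleavage π E)

lemma exists_pushId (A : M) : ∃ i : c.push (𝟙 A) ≅ 𝟭 (E A),
    ∀ x, c.co (𝟙 A) x ≫ (c.ι A).map (i.hom.app x) = 𝟙 _ := by
  choose e he using c.exists_iso_id A
  exact ⟨NatIso.ofComponents e fun {x y} φ => c.co_map_cancel (by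
    simp only [Functor.map_comp, Functor.id_map]
    rw [← reassoc_of% c.map_co, he, reassoc_of% he, Category.comp_id]), he⟩

lemma exists_pushComp {A B C : M} (f : A ⟶ B) (g : B ⟶ C) :
    ∃ i : c.push (f ≫ g) ≅ c.push f ⋙ c.push g,
      ∀ x, c.co (f ≫ g) x ≫ (c.ι C).map (i.hom.app x) = c.co f x ≫ c.co g _ := by
  choose e he using c.exists_iso_comp f g
  exact ⟨NatIso.ofComponents e fun {x y} φ => c.co_map_cancel (by
    simp only [Functor.map_comp, Functor.comp_map]
    rw [← reassoc_of% c.map_co, he, reassoc_of% he, ← c.map_co, reassoc_of% c.map_co]), he⟩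

/-- The comparison of `push (𝟙 A)` with the identity. -/
noncomputable def pushId (A : M) : c.push (𝟙 A) ≅ 𝟭 (E A) := (c.exists_pushId A).choose

lemma co_pushId (A : M) (x : E A) : c.co (𝟙 A) x ≫ (c.ι A).map ((c.pushId A).hom.app x) = 𝟙 _ :=
  (c.exists_pushId A).choose_spec x

/-- The comparison of `push (f ≫ g)` with a composition. -/
noncomputable def pushComp {A B C : M} (f : A ⟶ B) (g : B ⟶ C) :
    c.push (f ≫ g) ≅ c.push f ⋙ c.push g := (c.exists_pushComp f g).choose

lemma co_pushComp {A B C : M} (f : A ⟶ B) (g : B ⟶ C) (x : E A) :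
    c.co (f ≫ g) x ≫ (c.ι C).map ((c.pushComp f g).hom.app x) = c.co f x ≫ c.co g _ :=
  (c.exists_pushComp f g).choose_spec x

lemma co_pushComp_inv {A B C : M} (f : A ⟶ B) (g : B ⟶ C) (x : E A) :
    c.co f x ≫ c.co g _ ≫ (c.ι C).map ((c.pushComp f g).inv.app x) = c.co (f ≫ g) x := by
  rw [← Category.assoc, ← c.co_pushComp, Category.assoc, ← Functor.map_comp, Iso.hom_inv_id_app,
    CategoryTheory.Functor.map_id, Category.comp_id]

lemma pushComp_assoc {A B C D : M} (f : A ⟶ B) (g : B ⟶ C) (h : C ⟶ D) (x : E A)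
    (e : (c.push ((f ≫ g) ≫ h)).obj x ⟶ (c.push (f ≫ g ≫ h)).obj x)
    (he : c.co ((f ≫ g) ≫ h) x ≫ (c.ι D).map e = c.co (f ≫ g ≫ h) x) :
    (c.pushComp (f ≫ g) h).hom.app x ≫ (c.push h).map ((c.pushComp f g).hom.app x) ≫
      (c.pushComp g h).inv.app ((c.push f).obj x) ≫ (c.pushComp f (g ≫ h)).inv.app x = e := by
  apply c.co_map_cancel
  simp only [Functor.map_comp]
  rw [he, reassoc_of% c.co_pushComp, ← reassoc_of% c.map_co, reassoc_of% c.co_pushComp,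
    ← c.co_pushComp_inv f (g ≫ h), ← reassoc_of% c.co_pushComp_inv g h]
  rfl

lemma pushComp_id_left {A B : M} (f : A ⟶ B) (x : E A)
    (e : (c.push (𝟙 A ≫ f)).obj x ⟶ (c.push f).obj x)
    (he : c.co (𝟙 A ≫ f) x ≫ (c.ι B).map e = c.co f x) :
    (c.pushComp (𝟙 A) f).hom.app x ≫ (c.push f).map ((c.pushId A).hom.app x) = e := by
  apply c.co_map_cancel
  simp only [Functor.map_comp]
  rw [he, reassoc_of% c.co_pushComp, ← c.map_co, reassoc_of% c.co_pushId]
  rfl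

lemma pushComp_id_right {A B : M} (f : A ⟶ B) (x : E A)
    (e : (c.push (f ≫ 𝟙 B)).obj x ⟶ (c.push f).obj x)
    (he : c.co (f ≫ 𝟙 B) x ≫ (c.ι B).map e = c.co f x) :
    (c.pushComp f (𝟙 B)).hom.app x ≫ (c.pushId B).hom.app ((c.push f).obj x) = e := by
  apply c.co_map_cancel
  simp only [Functor.map_comp]
  rw [he, reassoc_of% c.co_pushComp, c.co_pushId, Category.comp_id]

lemma isHomLift_co_map {A B : M} (f : A ⟶ B) {x : E A} {y : E B} (φ : (c.push f).obj x ⟶ y) :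
    π.IsHomLift f (c.co f x ≫ (c.ι B).map φ) :=
  inferInstance

lemma co_map_comp {A B C : M} (f : A ⟶ B) (g : B ⟶ C) {x : E A} {y : E B} {z : E C}
    (φ : (c.push f).obj x ⟶ y) (ψ : (c.push g).obj y ⟶ z) :
    c.co (f ≫ g) x ≫ (c.ι C).map ((c.pushComp f g).hom.app x ≫ (c.push g).map φ ≫ ψ) =
      (c.co f x ≫ (c.ι B).map φ) ≫ c.co g y ≫ (c.ι C).map ψ := by
  simp only [Functor.map_comp, Category.assoc]
  rw [reassoc_of% c.co_pushComp, reassoc_of% c.map_co]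

end

section Diagram
variable {M : Type u} [Category.{v} M] {N : Type u} [Category.{v} N] {π : N ⥤ M} {E : M → Type u}
  [∀ A, Category.{v} (E A)] (c : BiCleavage π E) {k : FactorizationKind}
  {Sf : ∀ A, MapClasses (E A)} (hm : ∀ A, IsModelCategory k (Sf A))
  (hQ : ∀ ⦃A B : M⦄ (f : A ⟶ B), IsQuillenPair (Sf A) (Sf B) (c.push f) (c.pull f))

/-- The fibre over `A` as an object of `ModCat`. -/
abbrev modCat (hm : ∀ A, IsModelCategory k (Sf A)) (A : M) : ModCat.{v, u} k :=
  ModelCat.mk (Cat.of (E A)) (Sf A) (hm A)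

/-- The Quillen adjunction between fibres over `f`. -/
abbrev modMap {A B : M} (f : A ⟶ B) : modCat hm A ⟶ modCat hm B :=
  ModCat.homMk (X := modCat hm A) (Y := modCat hm B) (c.push f) (c.pull f) (c.adj f) (hQ f)

lemma co_eqToHom {A B : M} {f f' : A ⟶ B} (h : f = f')
    (h' : c.modMap hm hQ f = c.modMap hm hQ f') (x : E A) :
    c.co f x ≫ (c.ι B).map ((ModCat.leftHom (eqToHom h')).toNatTrans.app x) = c.co f' x := by
  subst h
  exact (congrArg (_ ≫ ·) ((c.ι B).map_id _)).trans (Category.comp_id _)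

/-- The diagram of model categories determined by a cleavage. -/
noncomputable def diagram : Diagram.{v, u} M k :=
  LocallyDiscrete.mkPseudofunctor (modCat hm) (c.modMap hm hQ)
    (fun A => ModCat.isoMk (c.pushId A)) (fun f g => ModCat.isoMk (c.pushComp f g))
    (fun f g h => ModCat.hom₂_ext fun x => by
      refine Eq.trans ?_ (c.pushComp_assoc f g h x _ (c.co_eqToHom hm hQ (Category.assoc f g h) _ x))
      exact congrArg (_ ≫ ·) (congrArg (_ ≫ ·) (Category.id_comp _)))
    (fun f => ModCat.hom₂_ext fun x => by
      refine Eq.trans ?_ (c.pushComp_id_left f x _ (c.co_eqToHom hm hQ (Category.id_comp f) _ x))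
      exact congrArg (_ ≫ ·) (Category.comp_id _))
    (fun f => ModCat.hom₂_ext fun x => by
      refine Eq.trans ?_ (c.pushComp_id_right f x _ (c.co_eqToHom hm hQ (Category.comp_id f) _ x))
      exact congrArg (_ ≫ ·) (Category.comp_id _))

/-- The comparison of the Grothendieck construction with the total category. -/
noncomputable def totalFunctor : (c.diagram hm hQ).Total ⥤ N where
  obj X := (c.ι X.base).obj X.fiber
  map {X Y} g := c.co g.base X.fiber ≫ (c.ι Y.base).map g.fiber
  map_id X := c.co_pushId X.base X.fiber
  map_comp f g := c.co_map_comp f.base g.base f.fiber g.fiber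

instance isHomLift_totalFunctor_map {X Y : (c.diagram hm hQ).Total} (g : X ⟶ Y) :
    π.IsHomLift g.base ((c.totalFunctor hm hQ).map g) :=
  c.isHomLift_co_map g.base (x := X.fiber) (y := Y.fiber) g.fiber

lemma totalFunctor_map_injective {X Y : (c.diagram hm hQ).Total} {g g' : X ⟶ Y}
    (h : (c.totalFunctor hm hQ).map g = (c.totalFunctor hm hQ).map g') : g = g' := by
  have hb : g.base = g'.base := isHomLift_unique π ((c.totalFunctor hm hQ).map g) inferInstance
    (by rw [h]; infer_instance)
  obtain ⟨b, φ⟩ := g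
  obtain ⟨b', φ'⟩ := g'
  obtain rfl : b = b' := hb
  exact congrArg (Pseudofunctor.Grothendieck.Hom.mk b) (c.co_map_cancel h)

lemma totalFunctor_map_surjective {X Y : (c.diagram hm hQ).Total}
    (g : (c.totalFunctor hm hQ).obj X ⟶ (c.totalFunctor hm hQ).obj Y) :
    ∃ g', (c.totalFunctor hm hQ).map g' = g := by
  obtain ⟨f, hf⟩ := c.exists_isHomLift (x := X.fiber) (y := Y.fiber) g
  obtain ⟨φ, hφ⟩ := c.exists_co_map (x := X.fiber) (y := Y.fiber) f g
  exact ⟨mkHom f φ, hφ⟩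

lemma totalFunctor_obj_surjective (Z : N) : ∃ X, (c.totalFunctor hm hQ).obj X = Z := by
  obtain ⟨A, x, rfl⟩ := c.exists_eq Z
  exact ⟨⟨A, x⟩, rfl⟩

end Diagram
end BiCleavage
section
universe v₁ u₁ u'
variable {M : Type u₁} [Category.{v₁} M] {N : Type u} [Category.{v} N] {π : N ⥤ M}

/-- Cleavages of biCartesian fibrations exist. -/
lemma exists_biCleavage {E : M → Type u'} [∀ A, Category.{v} (E A)] (ι : ∀ A, E A ⥤ N)
    (hι : ∀ {A : M} {x y : E A} (φ : x ⟶ y), π.IsHomLift (𝟙 A) ((ι A).map φ))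
    (exists_obj : ∀ {A : M} (X : N), π.obj X = A → ∃ x, (ι A).obj x = X)
    (exists_map : ∀ {A : M} {x y : E A} (g : (ι A).obj x ⟶ (ι A).obj y), π.IsHomLift (𝟙 A) g →
      ∃ φ, (ι A).map φ = g)
    (map_injective : ∀ {A : M} {x y : E A} {φ ψ : x ⟶ y}, (ι A).map φ = (ι A).map ψ → φ = ψ)
    (hπ : IsBicartesianFibration π) : ∃ c : BiCleavage π E, c.ι = ι := by
  have obj_ι {A : M} (x : E A) : π.obj ((ι A).obj x) = A :=
    have := hι (𝟙 x)
    IsHomLift.domain_eq π (𝟙 A) ((ι A).map (𝟙 x))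
  have exists_co : ∀ (A B : M) (f : A ⟶ B) (x : E A), ∃ (y : E B)
      (κ : (ι A).obj x ⟶ (ι B).obj y), π.IsStronglyCocartesian f κ := by
    intro A B f x
    have key : ∀ (X : N) (hX : π.obj X = A), ∃ (Y : N) (κ : X ⟶ Y),
        π.IsStronglyCocartesian f κ := by
      rintro X rfl
      exact hπ.cocartesian X f
    obtain ⟨Y, κ, hκ⟩ := key _ (obj_ι x)
    obtain ⟨y, rfl⟩ := exists_obj Y (IsHomLift.codomain_eq π f κ)
    exact ⟨y, κ, hκ⟩
  have exists_cart : ∀ (A B : M) (f : A ⟶ B) (y : E B), ∃ (x : E A)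
      (κ : (ι A).obj x ⟶ (ι B).obj y), π.IsStronglyCartesian f κ := by
    intro A B f y
    have key : ∀ (Y : N) (hY : π.obj Y = B), ∃ (X : N) (κ : X ⟶ Y),
        π.IsStronglyCartesian f κ := by
      rintro Y rfl
      exact hπ.cartesian Y f
    obtain ⟨X, κ, hκ⟩ := key _ (obj_ι y)
    obtain ⟨x, rfl⟩ := exists_obj X (IsHomLift.domain_eq π f κ)
    exact ⟨x, κ, hκ⟩
  choose po co hco using exists_co
  choose pl cart hcart using exists_cart
  have exists_po : ∀ (A B : M) (f : A ⟶ B) (x : E A) (y : E B) (g : (ι A).obj x ⟶ (ι B).obj y),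
      π.IsHomLift f g → ∃ φ : po A B f x ⟶ y, co A B f x ≫ (ι B).map φ = g := by
    intro A B f x y g _
    obtain ⟨φ, hφ⟩ := exists_map (Functor.IsStronglyCocartesian.map π f (co A B f x) (g := 𝟙 B)
      (Category.comp_id f).symm g) inferInstance
    exact ⟨φ, by rw [hφ, Functor.IsStronglyCocartesian.fac]⟩
  have po_ext : ∀ {A B : M} {f : A ⟶ B} {x : E A} {y : E B} {φ ψ : po A B f x ⟶ y},
      co A B f x ≫ (ι B).map φ = co A B f x ≫ (ι B).map ψ → φ = ψ := by
    intro A B f x y φ ψ h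
    have := hι φ
    have := hι ψ
    exact map_injective (Functor.IsStronglyCocartesian.ext π f (co A B f x) (𝟙 B) h)
  have exists_pl : ∀ (A B : M) (f : A ⟶ B) (x : E A) (y : E B) (g : (ι A).obj x ⟶ (ι B).obj y),
      π.IsHomLift f g → ∃ φ : x ⟶ pl A B f y, (ι A).map φ ≫ cart A B f y = g := by
    intro A B f x y g _
    obtain ⟨φ, hφ⟩ := exists_map (Functor.IsStronglyCartesian.map π f (cart A B f y) (g := 𝟙 A)
      (Category.id_comp f).symm g) inferInstance
    exact ⟨φ, by rw [hφ, Functor.IsStronglyCartesian.fac]⟩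
  have pl_ext : ∀ {A B : M} {f : A ⟶ B} {x : E A} {y : E B} {φ ψ : x ⟶ pl A B f y},
      (ι A).map φ ≫ cart A B f y = (ι A).map ψ ≫ cart A B f y → φ = ψ := by
    intro A B f x y φ ψ h
    have := hι φ
    have := hι ψ
    exact map_injective (Functor.IsStronglyCartesian.ext π f (cart A B f y) (𝟙 A) h)
  have lift_po {A B : M} (f : A ⟶ B) {x : E A} {y : E B} (φ : po A B f x ⟶ y) :
      π.IsHomLift f (co A B f x ≫ (ι B).map φ) := by
    have := hι φ
    infer_instance
  have lift_pl {A B : M} (f : A ⟶ B) {x : E A} {y : E B} (φ : x ⟶ pl A B f y) :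
      π.IsHomLift f ((ι A).map φ ≫ cart A B f y) := by
    have := hι φ
    infer_instance
  have lift_co {A B : M} (f : A ⟶ B) {x y : E A} (φ : x ⟶ y) :
      π.IsHomLift f ((ι A).map φ ≫ co A B f y) := by
    have := hι φ
    infer_instance
  have lift_cart {A B : M} (f : A ⟶ B) {x y : E B} (φ : x ⟶ y) :
      π.IsHomLift f (cart A B f x ≫ (ι B).map φ) := by
    have := hι φ
    infer_instance
  choose desc desc_spec using exists_po
  choose lift lift_spec using exists_pl
  let push {A B : M} (f : A ⟶ B) : E A ⥤ E B :=
    { obj := po A B f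
      map := fun φ => desc A B f _ _ _ (lift_co f φ)
      map_id := fun x => po_ext (by
        rw [desc_spec, CategoryTheory.Functor.map_id, CategoryTheory.Functor.map_id,
          Category.id_comp, Category.comp_id])
      map_comp := fun φ ψ => po_ext (by
        rw [desc_spec, Functor.map_comp, Functor.map_comp, ← Category.assoc (co A B f _), desc_spec,
          Category.assoc, Category.assoc, desc_spec]) }
  let pull {A B : M} (f : A ⟶ B) : E B ⥤ E A :=
    { obj := pl A B f
      map := fun φ => lift A B f _ _ _ (lift_cart f φ)
      map_id := fun x => pl_ext (by
        rw [lift_spec, CategoryTheory.Functor.map_id, CategoryTheory.Functor.map_id,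
          Category.id_comp, Category.comp_id])
      map_comp := fun φ ψ => pl_ext (by
        rw [lift_spec, Functor.map_comp, Functor.map_comp, Category.assoc, lift_spec,
          ← Category.assoc, ← Category.assoc, lift_spec]) }
  have push_spec {A B : M} (f : A ⟶ B) {x y : E A} (φ : x ⟶ y) :
      (ι A).map φ ≫ co A B f y = co A B f x ≫ (ι B).map ((push f).map φ) :=
    (desc_spec A B f _ _ _ (lift_co f φ)).symm
  have pull_spec {A B : M} (f : A ⟶ B) {x y : E B} (φ : x ⟶ y) :
      cart A B f x ≫ (ι B).map φ = (ι A).map ((pull f).map φ) ≫ cart A B f y :=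
    (lift_spec A B f _ _ _ (lift_cart f φ)).symm
  let e {A B : M} (f : A ⟶ B) (x : E A) (y : E B) : ((push f).obj x ⟶ y) ≃ (x ⟶ (pull f).obj y) :=
    { toFun := fun φ => lift A B f x y _ (lift_po f φ)
      invFun := fun φ => desc A B f x y _ (lift_pl f φ)
      left_inv := fun φ => po_ext (by rw [desc_spec, lift_spec])
      right_inv := fun φ => pl_ext (by rw [lift_spec, desc_spec]) }
  have e_spec {A B : M} (f : A ⟶ B) {x : E A} {y : E B} (φ : (push f).obj x ⟶ y) :
      (ι A).map (e f x y φ) ≫ cart A B f y = co A B f x ≫ (ι B).map φ :=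
    lift_spec A B f x y _ (lift_po f φ)
  have e_symm_spec {A B : M} (f : A ⟶ B) {x : E A} {y : E B} (φ : x ⟶ (pull f).obj y) :
      co A B f x ≫ (ι B).map ((e f x y).symm φ) = (ι A).map φ ≫ cart A B f y :=
    desc_spec A B f x y _ (lift_pl f φ)
  let adj {A B : M} (f : A ⟶ B) : push f ⊣ pull f := Adjunction.mkOfHomEquiv
    { homEquiv := e f
      homEquiv_naturality_left_symm := fun φ ψ => po_ext (by
        rw [e_symm_spec, Functor.map_comp, Functor.map_comp, ← reassoc_of% push_spec, e_symm_spec,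
          Category.assoc])
      homEquiv_naturality_right := fun φ ψ => pl_ext (by
        rw [e_spec, Functor.map_comp, Functor.map_comp, Category.assoc, ← pull_spec,
          ← Category.assoc, ← Category.assoc, e_spec]) }
  exact ⟨{
    ι := ι
    isHomLift_map := hι
    exists_obj := exists_obj
    exists_map := fun g _ => exists_map g ‹_›
    map_injective := map_injective
    push := push
    pull := pull
    adj := adj
    co := fun f => co _ _ f
    cart := fun f => cart _ _ f
    isStronglyCocartesian_co := fun f x => hco _ _ f x
    isStronglyCartesian_cart := fun f y => hcart _ _ f y
    map_co := push_spec
    cart_map := pull_spec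
    co_map := fun {A B} f {x y} φ => by
      rw [Adjunction.mkOfHomEquiv_homEquiv]
      exact (e_spec f φ).symm }, rfl⟩

lemma exists_biCleavage_fiber (hπ : IsBicartesianFibration π) :
    ∃ c : BiCleavage π π.Fiber, c.ι = fun _ => Functor.Fiber.fiberInclusion :=
  exists_biCleavage _ (fun φ => φ.2) (fun X hX => ⟨⟨X, hX⟩, rfl⟩) (fun g hg => ⟨⟨g, hg⟩, rfl⟩)
    Functor.Fiber.hom_ext hπ

end

namespace BiCleavage
universe v₁ u₁ u'
variable {M : Type u₁} [Category.{v₁} M] {N : Type u} [Category.{v} N]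
  {π : N ⥤ M} {E : M → Type u'} [∀ A, Category.{v} (E A)] (c : BiCleavage π E)
  {L R : MorphismProperty N} {L' R' : MorphismProperty M}

lemma map_map_mem (P : MorphismProperty M) (hP : ∀ A, P (𝟙 A)) {A : M} {x y : E A} (φ : x ⟶ y) :
    P (π.map ((c.ι A).map φ)) :=
  (mem_map_iff_of_isHomLift P (𝟙 A) _).2 (hP A)

lemma hasLiftingProperty_fiber (h : IsRelativeWFS π L R L' R') {A : M} {x y z w : E A} (i : x ⟶ y)
    (p : z ⟶ w) (hi : L ((c.ι A).map i)) (hp : R ((c.ι A).map p)) : HasLiftingProperty i p where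
  sq_hasLift {a b} sq := by
    have h₁ : π.IsHomLift (𝟙 A ≫ 𝟙 A) ((c.ι A).map a) := inferInstance
    have h₂ : π.IsHomLift (𝟙 A ≫ 𝟙 A) ((c.ι A).map b) := inferInstance
    obtain ⟨γ, e₁, e₂, _⟩ := h.exists_lift (𝟙 A) (i := 𝟙 A) (p := 𝟙 A) hi hp
      (a := (c.ι A).map a) (b := (c.ι A).map b) (by rw [← Functor.map_comp, sq.w, Functor.map_comp])
    obtain ⟨l, rfl⟩ := c.exists_map γ
    exact ⟨⟨{
      l := l
      fac_left := c.map_injective (by rw [Functor.map_comp, e₁])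
      fac_right := c.map_injective (by rw [Functor.map_comp, e₂]) }⟩⟩

lemma exists_factor_fiber (h : IsRelativeWFS π L R L' R') (hL : ∀ A, L' (𝟙 A))
    (hR : ∀ A, R' (𝟙 A)) {A : M} {x y : E A} (φ : x ⟶ y) : ∃ (z : E A) (i : x ⟶ z) (p : z ⟶ y),
      i ≫ p = φ ∧ L ((c.ι A).map i) ∧ R ((c.ι A).map p) := by
  have h₁ : π.IsHomLift (𝟙 A ≫ 𝟙 A) ((c.ι A).map φ) := inferInstance
  obtain ⟨Z, η, ψ, fac, hη, hψ, _, _⟩ := h.exists_factor (𝟙 A) (𝟙 A) ((c.ι A).map φ) (hL A) (hR A)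
  obtain ⟨z, rfl⟩ := c.exists_obj Z (IsHomLift.codomain_eq π (𝟙 A) η)
  obtain ⟨i, rfl⟩ := c.exists_map η
  obtain ⟨p, rfl⟩ := c.exists_map ψ
  exact ⟨z, i, p, c.map_injective (by rw [Functor.map_comp, fac]), hη, hψ⟩

lemma isLeftClass_of_isRelativeWFS (h : IsRelativeWFS π L R L' R') (hL : ∀ A, L' (𝟙 A))
    (hR : ∀ A, R' (𝟙 A)) : c.IsLeftClass L L' fun A => L.inverseImage (c.ι A) := by
  intro A B f x y φ
  have hid : π.IsHomLift (𝟙 B ≫ 𝟙 B) (𝟙 ((c.ι B).obj y)) := by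
    rw [Category.comp_id]
    exact IsHomLift.id (c.obj_ι y)
  constructor
  · intro hφ
    refine ⟨(mem_map_iff_of_isHomLift L' f _).1 (h.map_left _ hφ),
      h.left_of_lift hR (f := 𝟙 B) _ (hL B) fun V η ψ hψ _ _ fac => ?_⟩
    have : π.IsHomLift (f ≫ 𝟙 B) (c.co f x ≫ η) := inferInstance
    obtain ⟨γ, e₁, e₂, _⟩ := h.exists_lift (𝟙 B) (i := f) (p := 𝟙 B) (a := c.co f x ≫ η)
      (b := 𝟙 _) hφ hψ (by rw [Category.assoc, fac, Category.comp_id])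
    exact ⟨γ, c.co_cancel (𝟙 B ≫ 𝟙 B) (by rw [← e₁, Category.assoc]), e₂⟩
  · rintro ⟨hf, hφ⟩
    refine h.left_of_lift hR (f := f) _ hf fun V η ψ hψ _ _ fac => ?_
    have : π.IsHomLift (f ≫ 𝟙 B) η := inferInstance
    obtain ⟨η', _, rfl⟩ := c.exists_co f (𝟙 B) η
    have : π.IsHomLift (𝟙 B ≫ 𝟙 B) η' := inferInstance
    have fac' : η' ≫ ψ = (c.ι B).map φ := by
      have : π.IsHomLift (𝟙 B ≫ 𝟙 B) ((c.ι B).map φ) := inferInstance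
      exact c.co_cancel (𝟙 B ≫ 𝟙 B) (by rw [← fac, Category.assoc])
    obtain ⟨γ, e₁, e₂, _⟩ := h.exists_lift (𝟙 B) (i := 𝟙 B) (p := 𝟙 B) (a := η') (b := 𝟙 _) hφ hψ
      (by rw [fac', Category.comp_id])
    exact ⟨γ, by rw [Category.assoc, e₁], e₂⟩

lemma map_cart_mem (h : IsRelativeWFS π L R L' R') (hL : ∀ A, L' (𝟙 A)) {A B : M} (f : A ⟶ B) {x : E A} {y : E B} (φ : x ⟶ (c.pull f).obj y)
    (hf : R' f) (hφ : R ((c.ι A).map φ)) : R ((c.ι A).map φ ≫ c.cart f y) := by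
  have hid : π.IsHomLift (𝟙 A ≫ 𝟙 A) (𝟙 ((c.ι A).obj x)) := by
    rw [Category.comp_id]
    exact IsHomLift.id (c.obj_ι x)
  refine h.right_of_lift hL (f := f) _ hf fun V η ψ hη _ _ fac => ?_
  have : π.IsHomLift (𝟙 A ≫ f) ψ := inferInstance
  obtain ⟨ψ', _, rfl⟩ := c.exists_cart f (𝟙 A) ψ
  have : π.IsHomLift (𝟙 A ≫ 𝟙 A) ψ' := inferInstance
  have fac' : η ≫ ψ' = (c.ι A).map φ := by
    have : π.IsHomLift (𝟙 A ≫ 𝟙 A) ((c.ι A).map φ) := inferInstance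
    exact c.cart_cancel (𝟙 A ≫ 𝟙 A) (by rw [← fac, Category.assoc])
  obtain ⟨γ, e₁, e₂, _⟩ := h.exists_lift (𝟙 A) (i := 𝟙 A) (p := 𝟙 A) (a := 𝟙 _) (b := ψ') hη hφ
    (by rw [fac', Category.id_comp])
  exact ⟨γ, e₁, by rw [← Category.assoc, e₂]⟩

lemma map_push_mem (h : IsRelativeWFS π L R L' R') (hL : ∀ A, L' (𝟙 A)) (hR : ∀ A, R' (𝟙 A))
    {A B : M} (f : A ⟶ B) {x y : E A} (φ : x ⟶ y) (hφ : L ((c.ι A).map φ)) :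
    L ((c.ι B).map ((c.push f).map φ)) := by
  refine h.left_of_lift hR (f := 𝟙 B) _ (hL B) fun V η ψ hψ _ _ fac => ?_
  obtain ⟨γ, e₁, e₂, _⟩ := h.exists_lift f (i := 𝟙 A) (p := 𝟙 B) (a := c.co f x ≫ η)
    (b := c.co f y) hφ hψ (by rw [Category.assoc, fac, c.map_co])
  have : π.IsHomLift (f ≫ 𝟙 B) γ := inferInstance
  obtain ⟨γ, _, rfl⟩ := c.exists_co f (𝟙 B) γ
  refine ⟨γ, ?_, ?_⟩
  · have : π.IsHomLift (𝟙 B ≫ 𝟙 B) η := inferInstance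
    exact c.co_cancel (𝟙 B ≫ 𝟙 B) (by rw [← reassoc_of% c.map_co, e₁])
  · have : π.IsHomLift (𝟙 B ≫ 𝟙 B) (𝟙 ((c.ι B).obj ((c.push f).obj y))) := by
      rw [Category.comp_id]
      exact IsHomLift.id (c.obj_ι _)
    exact c.co_cancel (𝟙 B ≫ 𝟙 B) (by rw [← Category.assoc, e₂, Category.comp_id])

section Limits
open Limits

include c

lemma hasLimits_fiber (h : IsBicomplete π) (A : M) : HasLimits (E A) where
  has_limits_of_shape J _ :=
    { has_limit := fun δ => by
        have hpt (j : J) : A = π.obj ((c.ι A).obj (δ.obj j)) := (c.obj_ι _).symm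
        let t : Cone ((δ ⋙ c.ι A) ⋙ π) :=
          { pt := A
            π :=
              { app := fun j => eqToHom (hpt j)
                naturality := fun i j f => by
                  have := IsHomLift.fac' π (𝟙 A) ((c.ι A).map (δ.map f))
                  simp [this] } }
        have lift_iff {X : N} {j : J} (g : X ⟶ (c.ι A).obj (δ.obj j)) :
            π.IsHomLift (t.π.app j) g ↔ π.IsHomLift (𝟙 A) g := by
          have := IsHomLift.lift_comp_eqToHom_iff π (𝟙 A) g (hpt j)
          rwa [Category.id_comp] at this
        obtain ⟨⟨pt, s⟩, ⟨hpt', hs⟩, hu⟩ := h.limits J (δ ⋙ c.ι A) t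
        obtain ⟨x, rfl⟩ := c.exists_obj pt hpt'
        have exists_l (j : J) : ∃ l : x ⟶ δ.obj j, (c.ι A).map l = s.app j :=
          have := (lift_iff _).1 (hs j)
          c.exists_map (s.app j)
        choose l hl using exists_l
        let lim : Cone δ :=
          { pt := x
            π :=
              { app := l
                naturality := fun i j f => c.map_injective (by
                  have := s.naturality f
                  simp only [Functor.map_comp, hl]
                  simpa using this) } }
        have key (s' : Cone δ) : ∃ m : s'.pt ⟶ x, (∀ j, m ≫ l j = s'.π.app j) ∧
            ∀ m' : s'.pt ⟶ x, (∀ j, m' ≫ l j = s'.π.app j) → m' = m := by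
          obtain ⟨m, ⟨hm, hm'⟩, hmu⟩ := hu ((c.ι A).mapCone s')
            ⟨c.obj_ι _, fun j => (lift_iff _).2 (c.isHomLift_map _)⟩
          obtain ⟨m, rfl⟩ := c.exists_map (A := A) (x := s'.pt) (y := x) m
          refine ⟨m, fun j => c.map_injective ?_, fun m' hm'' => c.map_injective (hmu _
            ⟨c.isHomLift_map m', fun j => ?_⟩)⟩
          · rw [Functor.map_comp, hl]; exact hm' j
          · refine (congrArg (_ ≫ ·) (hl j).symm).trans (((c.ι A).map_comp _ _).symm.trans ?_)
            exact congrArg (c.ι A).map (hm'' j)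
        choose m hm hmu using key
        exact ⟨⟨⟨lim, { lift := m, fac := hm, uniq := hmu }⟩⟩⟩ }

lemma hasColimits_fiber (h : IsBicomplete π) (A : M) : HasColimits (E A) where
  has_colimits_of_shape J _ :=
    { has_colimit := fun δ => by
        have hpt (j : J) : π.obj ((c.ι A).obj (δ.obj j)) = A := c.obj_ι _
        let t : Cocone ((δ ⋙ c.ι A) ⋙ π) :=
          { pt := A
            ι :=
              { app := fun j => eqToHom (hpt j)
                naturality := fun i j f => by
                  have := IsHomLift.fac' π (𝟙 A) ((c.ι A).map (δ.map f))
                  simp [this] } }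
        have lift_iff {X : N} {j : J} (g : (c.ι A).obj (δ.obj j) ⟶ X) :
            π.IsHomLift (t.ι.app j) g ↔ π.IsHomLift (𝟙 A) g := by
          have := IsHomLift.lift_eqToHom_comp_iff π (𝟙 A) g (hpt j)
          rwa [Category.comp_id] at this
        obtain ⟨⟨pt, s⟩, ⟨hpt', hs⟩, hu⟩ := h.colimits J (δ ⋙ c.ι A) t
        obtain ⟨x, rfl⟩ := c.exists_obj pt hpt'
        have exists_l (j : J) : ∃ l : δ.obj j ⟶ x, (c.ι A).map l = s.app j :=
          have := (lift_iff _).1 (hs j)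
          c.exists_map (s.app j)
        choose l hl using exists_l
        let colim : Cocone δ :=
          { pt := x
            ι :=
              { app := l
                naturality := fun i j f => c.map_injective (by
                  have := s.naturality f
                  simp only [Functor.map_comp, hl]
                  simpa using this) } }
        have key (s' : Cocone δ) : ∃ m : x ⟶ s'.pt, (∀ j, l j ≫ m = s'.ι.app j) ∧
            ∀ m' : x ⟶ s'.pt, (∀ j, l j ≫ m' = s'.ι.app j) → m' = m := by
          obtain ⟨m, ⟨hm, hm'⟩, hmu⟩ := hu ((c.ι A).mapCocone s')
            ⟨c.obj_ι _, fun j => (lift_iff _).2 (c.isHomLift_map _)⟩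
          obtain ⟨m, rfl⟩ := c.exists_map (A := A) (x := x) (y := s'.pt) m
          refine ⟨m, fun j => c.map_injective ?_, fun m' hm'' => c.map_injective (hmu _
            ⟨c.isHomLift_map m', fun j => ?_⟩)⟩
          · rw [Functor.map_comp, hl]; exact hm' j
          · refine (congrArg (· ≫ _) (hl j).symm).trans (((c.ι A).map_comp _ _).symm.trans ?_)
            exact congrArg (c.ι A).map (hm'' j)
        choose m hm hmu using key
        exact ⟨⟨⟨colim, { desc := m, fac := hm, uniq := hmu }⟩⟩⟩ }

end Limits

end BiCleavage
lemma isStableUnderRetracts_inverseImage {C D : Type*} [Category C] [Category D] (F : C ⥤ D)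
    {P : MorphismProperty D}
    (h : ∀ ⦃X Y X' Y' : C⦄ (f : X ⟶ Y) (g : X' ⟶ Y'), Nonempty (RetractArrow (F.map f) (F.map g)) →
      P (F.map g) → P (F.map f)) : (P.inverseImage F).IsStableUnderRetracts where
  of_retract r hg := h _ _ ⟨r.map F⟩ hg

namespace BiCleavage
universe v₁ u₁ u'
variable {M : Type u₁} [Category.{v₁} M] {N : Type u} [Category.{v} N]
  {π : N ⥤ M} {E : M → Type u'} [∀ A, Category.{v} (E A)] (c : BiCleavage π E)
  {k : FactorizationKind} {S : MapClasses M} {T : MapClasses N}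

/-- The classes `T` on the fibre over `A`. -/
abbrev classes (T : MapClasses N) (A : M) : MapClasses (E A) := T.pullback (c.ι A)

variable (hS : S.IsPreModel) (hT : IsRelativeModelCategory k S T π)
include hS hT

lemma W_fiber_two_out_of_three (A : M) : (c.classes T A).W.HasTwoOutOfThreeProperty where
  comp_mem {x y z} f g hf hg := by
    refine (mem_congr T.W ((c.ι A).map_comp f g)).2 ((hT.two_out_of_three _ _).1 hf hg ?_)
    rw [← Functor.map_comp]
    exact c.map_map_mem S.W hS.W.id_mem _
  of_postcomp {x y z} f g hg hfg := (hT.two_out_of_three ((c.ι A).map f) ((c.ι A).map g)).2.2 hg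
    ((mem_congr T.W ((c.ι A).map_comp f g)).1 hfg) (c.map_map_mem S.W hS.W.id_mem _)
  of_precomp {x y z} f g hf hfg := (hT.two_out_of_three ((c.ι A).map f) ((c.ι A).map g)).2.1 hf
    ((mem_congr T.W ((c.ι A).map_comp f g)).1 hfg) (c.map_map_mem S.W hS.W.id_mem _)

/-- The fibres of a relative model category are model categories. -/
lemma isModelCategory_fiber (hfun : k = .functorial → ∀ A : M,
      (c.classes T A).trivCof.HasFunctorialFactorization (c.classes T A).fib ∧
      (c.classes T A).cof.HasFunctorialFactorization (c.classes T A).trivFib) (A : M) :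
    IsModelCategory k (c.classes T A) := by
  have hlim := c.hasLimits_fiber hT.bicomplete A
  have hcolim := c.hasColimits_fiber hT.bicomplete A
  have idW := hS.W.id_mem
  have idC := hS.cof.id_mem
  have idF := hS.fib.id_mem
  have idW' := hT.preModel.W.id_mem
  have idC' := hT.preModel.cof.id_mem
  have idF' := hT.preModel.fib.id_mem
  have hC : (c.classes T A).trivCof.IsStableUnderRetracts :=
    isStableUnderRetracts_inverseImage (c.ι A) (P := T.trivCof) fun _ _ _ _ f g r hg =>
      hT.wfs_trivCof.retract_left _ _ r hg (c.map_map_mem S.trivCof (fun A => ⟨idC A, idW A⟩) f)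
  have hF : (c.classes T A).trivFib.IsStableUnderRetracts :=
    isStableUnderRetracts_inverseImage (c.ι A) (P := T.trivFib) fun _ _ _ _ f g r hg =>
      hT.wfs_trivFib.retract_right _ _ r hg (c.map_map_mem S.trivFib (fun A => ⟨idF A, idW A⟩) f)
  have hC' : (c.classes T A).cof.IsStableUnderRetracts :=
    isStableUnderRetracts_inverseImage (c.ι A) (P := T.cof) fun _ _ _ _ f g r hg =>
      hT.wfs_trivFib.retract_left _ _ r hg (c.map_map_mem S.cof idC f)
  have hF' : (c.classes T A).fib.IsStableUnderRetracts :=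
    isStableUnderRetracts_inverseImage (c.ι A) (P := T.fib) fun _ _ _ _ f g r hg =>
      hT.wfs_trivCof.retract_right _ _ r hg (c.map_map_mem S.fib idF f)
  have iso_mem (P : MorphismProperty (E A)) [P.IsStableUnderRetracts] (hP : ∀ x, P (𝟙 x)) :
      MorphismProperty.isomorphisms (E A) ≤ P := fun x y f (hf : IsIso f) =>
    P.of_retract (nonempty_retractArrow_of_iso (asIso f) (Iso.refl y) (by simp)).some (hP y)
  have id_map {P : MorphismProperty N} (hP : ∀ X, P (𝟙 X)) (x : E A) : P ((c.ι A).map (𝟙 x)) := by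
    rw [CategoryTheory.Functor.map_id]
    exact hP _
  have hW := c.W_fiber_two_out_of_three hS hT A
  have lift ⦃x y z w : E A⦄ (i : x ⟶ y) (p : z ⟶ w) (hi : (c.classes T A).trivCof i)
      (hp : (c.classes T A).fib p) : HasLiftingProperty i p :=
    c.hasLiftingProperty_fiber hT.wfs_trivCof i p hi hp
  have fac ⦃x y : E A⦄ (f : x ⟶ y) : ∃ (z : E A) (i : x ⟶ z) (p : z ⟶ y), i ≫ p = f ∧
      (c.classes T A).trivCof i ∧ (c.classes T A).fib p :=
    c.exists_factor_fiber hT.wfs_trivCof (fun A => ⟨idC A, idW A⟩) idF f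
  have fac' ⦃x y : E A⦄ (f : x ⟶ y) : ∃ (z : E A) (i : x ⟶ z) (p : z ⟶ y), i ≫ p = f ∧
      (c.classes T A).cof i ∧ (c.classes T A).trivFib p :=
    c.exists_factor_fiber hT.wfs_trivFib idC (fun A => ⟨idF A, idW A⟩) f
  exact {
    hasLimits := hlim
    hasColimits := hcolim
    two_out_of_three := hW
    iso_W := (iso_mem (c.classes T A).trivCof (id_map (P := T.trivCof) fun X => ⟨idC' X, idW' X⟩)).trans inf_le_right
    iso_cof := iso_mem _ (id_map (P := T.cof) idC')
    iso_fib := iso_mem _ (id_map (P := T.fib) idF')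
    retract_W := isStableUnderRetracts_W hW hC hF lift fac
    retract_cof := hC'
    retract_fib := hF'
    lift_trivFib := fun _ _ _ _ i p hi hp => c.hasLiftingProperty_fiber hT.wfs_trivFib i p hi hp
    lift_trivCof := lift
    factor_trivFib := by
      cases k with
      | plain =>
        refine ⟨fun f => ?_⟩
        obtain ⟨z, i, p, h, hi, hp⟩ := fac' f
        exact ⟨{ Z := z, i := i, p := p, fac := h, hi := hi, hp := hp }⟩
      | functorial => exact (hfun rfl A).2
    factor_trivCof := by
      cases k with
      | plain =>
        refine ⟨fun f => ?_⟩
        obtain ⟨z, i, p, h, hi, hp⟩ := fac f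
        exact ⟨{ Z := z, i := i, p := p, fac := h, hi := hi, hp := hp }⟩
      | functorial => exact (hfun rfl A).1 }

lemma isLeftClass_cof : c.IsLeftClass T.cof S.cof fun A => (c.classes T A).cof :=
  c.isLeftClass_of_isRelativeWFS hT.wfs_trivFib hS.cof.id_mem
    fun A => ⟨hS.fib.id_mem A, hS.W.id_mem A⟩

lemma isLeftClass_trivCof : c.IsLeftClass T.trivCof S.trivCof fun A => (c.classes T A).trivCof :=
  c.isLeftClass_of_isRelativeWFS hT.wfs_trivCof (fun A => ⟨hS.cof.id_mem A, hS.W.id_mem A⟩)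
    hS.fib.id_mem

lemma isQuillenPair_fiber (hm : ∀ A, IsModelCategory k (c.classes T A)) {A B : M} (f : A ⟶ B) :
    IsQuillenPair (c.classes T A) (c.classes T B) (c.push f) (c.pull f) :=
  isQuillenPair_of_left (hm A) (c.adj f)
    (fun _ _ φ hφ => c.map_push_mem hT.wfs_trivFib hS.cof.id_mem
      (fun A => ⟨hS.fib.id_mem A, hS.W.id_mem A⟩) f φ hφ)
    (fun _ _ φ hφ => c.map_push_mem hT.wfs_trivCof (fun A => ⟨hS.cof.id_mem A, hS.W.id_mem A⟩)
      hS.fib.id_mem f φ hφ) (hm B)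

lemma W_map_push (hm : ∀ A, IsModelCategory k (c.classes T A)) {A B : M} (f : A ⟶ B)
    (hf : S.trivCof f) : (c.classes T A).W ≤ (c.classes T B).W.inverseImage (c.push f) := by
  intro x y φ hφ
  have hco (x : E A) : T.W (c.co f x) := by
    have := ((c.isLeftClass_trivCof hS hT f (𝟙 ((c.push f).obj x))).2
      ⟨hf, (hm B).trivCof_iso _⟩).2
    rwa [CategoryTheory.Functor.map_id, Category.comp_id] at this
  refine (hT.two_out_of_three (c.co f x) ((c.ι B).map ((c.push f).map φ))).2.1 (hco x) ?_
    (c.map_map_mem S.W hS.W.id_mem _)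
  rw [← c.map_co]
  exact (hT.two_out_of_three _ _).1 hφ (hco y) ((mem_map_iff_of_isHomLift S.W f _).2 hf.2)

lemma W_map_pull (hm : ∀ A, IsModelCategory k (c.classes T A)) {A B : M} (f : A ⟶ B)
    (hf : S.trivFib f) : (c.classes T B).W ≤ (c.classes T A).W.inverseImage (c.pull f) := by
  intro x y φ hφ
  have hcart (y : E B) : T.W (c.cart f y) := by
    have := (c.map_cart_mem hT.wfs_trivFib hS.cof.id_mem f (𝟙 ((c.pull f).obj y)) hf
      ((hm A).trivFib_iso (𝟙 _))).2
    rwa [CategoryTheory.Functor.map_id, Category.id_comp] at this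
  refine (hT.two_out_of_three ((c.ι A).map ((c.pull f).map φ)) (c.cart f y)).2.2 (hcart y) ?_
    (c.map_map_mem S.W hS.W.id_mem _)
  rw [← c.cart_map]
  exact (hT.two_out_of_three _ _).1 (hcart x) hφ ((mem_map_iff_of_isHomLift S.W f _).2 hf.2)

omit hS hT

lemma isCofibrantOver {A : M} {x : E A} (hx : (c.classes T A).IsCofibrant x) :
    IsCofibrantOver T π ((c.ι A).obj x) := by
  have key : ∀ (A : M) (X : N) (hA : π.obj X = A),
      (fiberClasses T π A).IsCofibrant ⟨X, hA⟩ → IsCofibrantOver T π X := by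
    rintro _ X rfl h
    exact h
  refine key A _ (c.obj_ι x) fun I hI => ?_
  obtain ⟨i, rfl⟩ := c.exists_toFiber I
  have hi := Limits.IsInitial.isInitialOfObj (c.toFiber A) i hI
  have h : T.cof ((c.ι A).map (hi.to x)) := hx hi
  exact (mem_congr (fiberClasses T π A).cof (hI.hom_ext (hI.to _) ((c.toFiber A).map (hi.to x)))).2 h

lemma isFibrantOver {A : M} {x : E A} (hx : (c.classes T A).IsFibrant x) :
    IsFibrantOver T π ((c.ι A).obj x) := by
  have key : ∀ (A : M) (X : N) (hA : π.obj X = A),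
      (fiberClasses T π A).IsFibrant ⟨X, hA⟩ → IsFibrantOver T π X := by
    rintro _ X rfl h
    exact h
  refine key A _ (c.obj_ι x) fun I hI => ?_
  obtain ⟨i, rfl⟩ := c.exists_toFiber I
  have hi := Limits.IsTerminal.isTerminalOfObj (c.toFiber A) i hI
  have h : T.fib ((c.ι A).map (hi.from x)) := hx hi
  exact (mem_congr (fiberClasses T π A).fib
    (hI.hom_ext (hI.from _) ((c.toFiber A).map (hi.from x)))).2 h

lemma isQuillenEquivalence_fiber (hS : S.IsPreModel) (hT : IsModelFibration k S T π) {A B : M}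
    (f : A ⟶ B) (hf : S.W f) :
    IsQuillenEquivalence (c.classes T A) (c.classes T B) (c.adj f) := by
  have hco {x : E A} (hx : (c.classes T A).IsCofibrant x) : T.W (c.co f x) :=
    hT.cocartesian_W _ (isCocartesianMap_of_isStronglyCocartesian f inferInstance)
      (c.isCofibrantOver hx) ((mem_map_iff_of_isHomLift S.W f _).2 hf)
  have hcart {y : E B} (hy : (c.classes T B).IsFibrant y) : T.W (c.cart f y) :=
    hT.cartesian_W _ (isCartesianMap_of_isStronglyCartesian f inferInstance)
      (c.isFibrantOver hy) ((mem_map_iff_of_isHomLift S.W f _).2 hf)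
  constructor
  · intro x y j hx hy hj
    refine (mem_congr (c.classes T A).W (Adjunction.homEquiv_unit (c.adj f) _ _ _)).1 ?_
    refine (hT.two_out_of_three ((c.ι A).map _) (c.cart f y)).2.2 (hcart hy) ?_
      (c.map_map_mem S.W hS.W.id_mem _)
    rw [← c.co_map]
    exact (hT.two_out_of_three _ _).1 (hco hx) hj.2 ((mem_map_iff_of_isHomLift S.W f _).2 hf)
  · intro y x q hy hx hq
    refine (mem_congr (c.classes T B).W (Adjunction.homEquiv_counit (c.adj f) _ _ _)).1 ?_
    refine (hT.two_out_of_three (c.co f x) ((c.ι B).map _)).2.1 (hco hx) ?_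
      (c.map_map_mem S.W hS.W.id_mem _)
    rw [← c.map_cart]
    exact (hT.two_out_of_three _ _).1 hq.2 (hcart hy) ((mem_map_iff_of_isHomLift S.W f _).2 hf)

end BiCleavage
lemma mem_eqToHom_comp_comp_eqToHom_iff {C : Type*} [Category C] (P : MorphismProperty C)
    {X X' Y Y' : C} (h : X' = X) (h' : Y = Y') (g : X ⟶ Y) :
    P (eqToHom h ≫ g ≫ eqToHom h') ↔ P g := by
  subst h h'
  simp

section
universe v₁ u₁
variable {M : Type u₁} [Category.{v₁} M] {X Y : BasedCategory.{v, u} M}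

lemma based_comp_p (K : X.obj ⥤ Y.obj) (h : ∀ ⦃x y : X.obj⦄ (g : x ⟶ y),
      Y.p.IsHomLift (X.p.map g) (K.map g)) : K ⋙ Y.p = X.p :=
  CategoryTheory.Functor.ext
    (fun x => have := h (𝟙 x); IsHomLift.domain_eq Y.p (X.p.map (𝟙 x)) (K.map (𝟙 x)))
    fun _ _ g => have := h g; IsHomLift.fac' Y.p (X.p.map g) (K.map g)

/-- A functor which is full, faithful and surjective on objects has a quasi-inverse. -/
lemma exists_quasiInverse {C D : Type*} [Category C] [Category D] (K : C ⥤ D) [K.Full] [K.Faithful]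
    (hK : ∀ y, ∃ x, K.obj x = y) : ∃ (L : D ⥤ C) (hs : ∀ y, K.obj (L.obj y) = y)
      (η : 𝟭 C ≅ K ⋙ L) (κ : L ⋙ K ≅ 𝟭 D),
      (∀ {y y' : D} (g : y ⟶ y'),
        K.map (L.map g) = eqToHom (hs y) ≫ g ≫ eqToHom (hs y').symm) ∧
      (∀ x, K.map (η.hom.app x) = eqToHom (hs (K.obj x)).symm) ∧
      ∀ y, κ.hom.app y = eqToHom (hs y) := by
  choose s hs using hK
  let L : D ⥤ C :=
    { obj := s
      map := fun {y y'} g => K.preimage (eqToHom (hs y) ≫ g ≫ eqToHom (hs y').symm)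
      map_id := fun y => K.map_injective (by simp)
      map_comp := fun f g => K.map_injective (by simp) }
  have hL {y y' : D} (g : y ⟶ y') : K.map (L.map g) = eqToHom (hs y) ≫ g ≫ eqToHom (hs y').symm :=
    K.map_preimage _
  refine ⟨L, hs, NatIso.ofComponents (fun x => K.preimageIso (eqToIso (hs (K.obj x)).symm))
    (fun {x y} g => K.map_injective ?_), NatIso.ofComponents (fun y => eqToIso (hs y))
    (fun {y y'} g => ?_), hL, fun x => ?_, fun y => rfl⟩
  · simp [hL]
  · simp [hL]
  · simp

/-- A functor over `M` which is full, faithful and surjective on objects has a quasi-inverse over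
`M`. -/
lemma exists_based_quasiInverse (K : X ⟶ Y) (hf : K.toFunctor.Full) (hf' : K.toFunctor.Faithful)
    (hK : ∀ y, ∃ x, K.obj x = y) : ∃ K' : Y ⟶ X, Nonempty (𝟙 X ≅ K ≫ K') ∧
      Nonempty (K' ≫ K ≅ 𝟙 Y) ∧ ∀ {y y' : Y.obj} (g : y ⟶ y'), ∃ (h : K.obj (K'.obj y) = y)
        (h' : y' = K.obj (K'.obj y')), K.map (K'.map g) = eqToHom h ≫ g ≫ eqToHom h' := by
  obtain ⟨L, hs, η, κ, hL, hη, hκ⟩ := exists_quasiInverse K.toFunctor hK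
  let K' : Y ⟶ X :=
    { toFunctor := L
      w := based_comp_p L fun _ _ g => by
        rw [← BasedFunctor.isHomLift_iff K, hL]
        infer_instance }
  refine ⟨K', ⟨BasedNatIso.mkNatIso η fun x => ?_⟩, ⟨BasedNatIso.mkNatIso κ fun y => ?_⟩,
    fun {y y'} g => ⟨hs y, (hs y').symm, hL g⟩⟩
  · refine (BasedFunctor.isHomLift_iff K _ _).1 ?_
    have h : Y.p.IsHomLift (𝟙 (X.p.obj x)) (eqToHom (hs (K.obj x)).symm) :=
      IsHomLift.eqToHom_domain_lift_id _ (K.w_obj x)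
    exact (hη x).symm ▸ h
  · have h : Y.p.IsHomLift (𝟙 (Y.p.obj y)) (eqToHom (hs y)) :=
      IsHomLift.eqToHom_codomain_lift_id _ rfl
    exact (hκ y).symm ▸ h

end

/-- The adjunction underlying an adjoint equivalence. -/
def Equivalence.adjunction {B : Type*} [Bicategory B] {a b : B} (e : Bicategory.Equivalence a b) :
    Bicategory.Adjunction e.hom e.inv where
  unit := e.unit.hom
  counit := e.counit.hom
  left_triangle := e.left_triangle_hom
  right_triangle := e.right_triangle_hom

section
variable {M : Type u} [Category.{v} M] {k : FactorizationKind} {S : MapClasses M}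

/-- A functor over `M` between model fibrations which is full, faithful and surjective on objects,
and which preserves and reflects cofibrations and trivial cofibrations, is an equivalence. -/
lemma nonempty_equivalence_modFib (hS : S.IsPreModel) (X Y : ModelFibration.{v, u} k S)
    (K : X.based ⟶ Y.based) (hf : K.toFunctor.Full) (hf' : K.toFunctor.Faithful)
    (hK : ∀ y, ∃ x, K.obj x = y) (hcof : X.classes.cof = Y.classes.cof.inverseImage K.toFunctor)
    (htriv : X.classes.trivCof = Y.classes.trivCof.inverseImage K.toFunctor) :
    Nonempty (Bicategory.Equivalence (B := ModFib k S) X Y) := by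
  obtain ⟨K', ⟨η⟩, ⟨κ⟩, hKK'⟩ := exists_based_quasiInverse K hf hf' hK
  have adj : Bicategory.Adjunction K K' :=
    Equivalence.adjunction (Bicategory.Equivalence.mkOfAdjointifyCounit η κ)
  have adj' : Bicategory.Adjunction K' K :=
    Equivalence.adjunction (Bicategory.Equivalence.mkOfAdjointifyCounit κ.symm η.symm)
  have h₁ := isModelFibrationMorphism_of_left hS adj X.isModelFibration Y.isModelFibration hcof.le
    htriv.le
  have h₂ := isModelFibrationMorphism_of_left hS adj' Y.isModelFibration X.isModelFibration
    (fun y y' g hg => by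
      obtain ⟨h, h', e⟩ := hKK' g
      rw [hcof]
      exact (mem_congr Y.classes.cof e).2 ((mem_eqToHom_comp_comp_eqToHom_iff _ _ _ _).2 hg))
    (fun y y' g hg => by
      obtain ⟨h, h', e⟩ := hKK' g
      rw [htriv]
      exact (mem_congr Y.classes.trivCof e).2 ((mem_eqToHom_comp_comp_eqToHom_iff _ _ _ _).2 hg))
  let X' : ModFib k S := X
  let Y' : ModFib k S := Y
  let f : X' ⟶ Y' := SubTwoOne.Hom.mk (Adj.Hom.mk (l := K) (r := K') adj) h₁
  let g : Y' ⟶ X' := SubTwoOne.Hom.mk (Adj.Hom.mk (l := K') (r := K) adj') h₂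
  exact ⟨Bicategory.Equivalence.mkOfAdjointifyCounit (f := f) (g := g)
    (SubTwoOne.isoMk (Diagram.adjIso η)) (SubTwoOne.isoMk (Diagram.adjIso κ))⟩

/-- Every model fibration is equivalent to a Grothendieck construction. -/
lemma exists_equivalence_integral (hS : S.IsPreModel)
    (hobj : ∀ F : FunPR.{v, u} S k, IsModelFibration k S (F.1.totalClasses S) F.1.totalBased.p)
    (Y : ModFib.{v, u} k S) :
    ∃ F : FunPR.{v, u} S k, Nonempty (Bicategory.Equivalence (integralObj k S hobj F) Y) := by
  have hY := ModelFibration.isModelFibration Y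
  obtain ⟨c, hc⟩ := exists_biCleavage_fiber hY.bicartesian
  have hT := hY.toIsRelativeModelCategory
  have hm := c.isModelCategory_fiber hS hT (by
    intro hk A
    simp only [BiCleavage.classes, hc]
    exact ⟨hY.functorial_trivCof hk A, hY.functorial_trivFib hk A⟩)
  have hQ := fun {A B : M} (f : A ⟶ B) => c.isQuillenPair_fiber hS hT hm f
  let F : FunPR.{v, u} S k := ⟨c.diagram hm @hQ,
    fun A B f hf => c.isQuillenEquivalence_fiber hS hY f hf,
    fun A B f hf => c.W_map_push hS hT hm f hf, fun A B f hf => c.W_map_pull hS hT hm f hf⟩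
  let K : F.1.totalBased ⟶ ModelFibration.based Y :=
    { toFunctor := c.totalFunctor hm @hQ
      w := based_comp_p (X := F.1.totalBased) (Y := ModelFibration.based Y) _
        fun _ _ g => c.isHomLift_totalFunctor_map hm @hQ g }
  refine ⟨F, nonempty_equivalence_modFib hS (integralObj k S hobj F) Y K ⟨fun g => c.totalFunctor_map_surjective hm @hQ g⟩
    ⟨fun h => c.totalFunctor_map_injective hm @hQ h⟩ (c.totalFunctor_obj_surjective hm @hQ) ?_ ?_⟩
  · ext x y g
    exact (c.isLeftClass_cof hS hT g.base (x := x.fiber) (y := y.fiber) g.fiber).symm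
  · ext x y g
    exact (Diagram.trivCof_total_iff hS F g).trans
      (c.isLeftClass_trivCof hS hT g.base (x := x.fiber) (y := y.fiber) g.fiber).symm

end
end ModelGrothendieck

theorem mainTheorem2 {M : Type u} [Category.{v} M] (S : MapClasses M) (hS : S.IsPreModel)
    (k : FactorizationKind) :
    ∃ (hobj : ∀ F : FunPR.{v, u} S k,
        IsModelFibration k S (F.1.totalClasses S) F.1.totalBased.p)
      (hmap : ∀ {F G : FunPR.{v, u} S k} (α : F ⟶ G),
        IsModelFibrationMorphism (F.1.totalClasses S) (G.1.totalClasses S)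
          (Diagram.totalAdj α.hom).l (Diagram.totalAdj α.hom).r),
      IsBiequivalence (integral k S hobj hmap) :=
  ⟨Diagram.isModelFibration_total hS, Diagram.isModelFibrationMorphism_totalAdj hS,
    { exists_equivalence := exists_equivalence_integral hS _
      isEquivalence_mapFunctor := fun F G =>
        { faithful := faithful_mapFunctor_integral _ _ F G
          full := full_mapFunctor_integral _ _ F G
          essSurj := essSurj_mapFunctor_integral hS _ _ F G } }⟩
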